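/- **Setting.** Let $\Sigma=\mathbb{N}_0^{\mathbb{Z}}$ with the product $\sigma$-algebra and the pointwise order $\preccurlyeq$, and write $\eta(I)=\sum_{x\in I}\eta(x)$ for finite $I\subset\mathbb{Z}$. Time is discrete (a continuous-time environment is observed at integer times). An *environment* consists of a non-empty bounded open interval $J\subseteq[0,\infty)$, probability measures $(\mu_\rho)_{\rho\in J}$ on $\Sigma$, and, depending measurably on $\eta_0\in\Sigma$, laws $\mathbf{P}^{\eta_0}$ of processes $(\eta_t)_{t\ge 0}$ in $\Sigma$ started at $\eta_0$. Put $\mathbf{P}^\rho=\int\mu_\rho(d\eta_0)\,\mathbf{P}^{\eta_0}$. A coupling of two laws is a probability measure on the product space with these marginals, and $\le_{\rm st.}$ means that there is a coupling that is almost surely ordered. Assume: * (P.1) Under $\mathbf{P}^{\eta_0}$, for all $s\ge0$, $x\in\mathbb{Z}$, conditionally on $(\eta_u)_{u\le s}$, the process $(\eta_{s+t}(x+\cdot))_{t\ge0}$ has law $\mathbf{P}^{\eta_s(x+\cdot)}$. * (P.2) For all $\rho\in J$ and $s\ge 0$, $(\eta_{t+s})_{t\ge0}$ has the same law as $(\eta_t)_{t\ge0}$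 under $\mathbf{P}^\rho$. * (P.3) $\mathbf{P}^{\eta_0'}\le_{\rm st.}\mathbf{P}^{\eta_0}$ whenever $\eta_0'\preccurlyeq\eta_0$, and $\mu_{\rho'}\le_{\rm st.}\mu_\rho$ whenever $\rho'\le\rho$ in $J$. * (P.4) There is $c>0$ such that for all $\rho\in J$, $\varepsilon\in(0,1)$, $\ell\ge1$ and every interval $I\subset\mathbb{Z}$ of $\ell$ integers, $\mathbf{P}^\rho(|\eta_0(I)-\rho\ell|\ge\varepsilon\ell)\le 2e^{-c\varepsilon^2\ell}$. Assume also that there is $\nu>0$ such that: * (C.2.1) For all integers $t,H\ge0$, $k\ge1$ and all $\eta_0,\eta_0'$ with $\eta_0\succcurlyeq\eta'_0$ on $[-H,H]$, there is a coupling $\mathbb{Q}$ of $\eta\sim\mathbf{P}^{\eta_0}$ and $\eta'\sim\mathbf{P}^{\eta_0'}$ such that, with probability at least $1-20e^{-k\nu t/4}$, $\eta_s\succcurlyeq\eta_s'$ on $[-H+2\nu kt,H-2\nu kt]$ for all $s\in[0,t]$. * (C.2.2) There are $C,C'>0$ such that for all $\rho\in J$, $\varepsilon\in(0,1)$ with $\rho+\varepsilon\in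 J$, and all integers $H,t\ge1$ with $H>4\nu t$, $\nu^8t>1$ and $\nu t^{1/4}>C\varepsilon^{-2}(1+|\log^3(\nu t)|)$: setting $\ell=\lfloor t^{1/4}\rfloor$, if $\eta_0(I)\ge(\rho+\frac{3\varepsilon}{4})|I|$ and $\eta_0'(I)\le(\rho+\frac{\varepsilon}{4})|I|$ for every interval $I\subset[-H,H]$ with $\lfloor\ell/2\rfloor\le|I|\le\ell$, then there is a coupling of $\eta\sim\mathbf{P}^{\eta_0}$ and $\eta'\sim\mathbf{P}^{\eta_0'}$ such that $\eta_t\succcurlyeq\eta'_t$ on $[-H+4\nu t,H-4\nu t]$ with probability at least $1-C'tH\exp(-(C'(1+\nu^{-1}))^{-1}\varepsilon^2t^{1/4})$. **Walks.** For $L\ge1$, under $\mathbf{P}^{\rho,L}$ the environment is resampled from $\mu_\rho$ at every time in $L\mathbb{N}_0$, independently of the past, and in between evolves according to the original dynamics. Let $0\le p_\circ<p_\bullet\le1$. The walk on $\eta$ has $X_0=0$ and $X_{n+1}=X_n\pm1$, where, independently of everything else, the step is $+1$ with probability $p_\circ$ if $\eta_n(X_n)=0$ and $p_\bullet$ if $\eta_n(X_n)\ge1$.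 Let $\mathbb{P}^{\rho,L}$ be the law of $X$ when $\eta\sim\mathbf{P}^{\rho,L}$, and $v(\rho,L)=\mathbb{E}^{\rho,L}[X_L/L]$. **Proposition 3.1.** For every such environment there is an integer $L_0\ge1$ such that, for all $0\le p_\circ<p_\bullet\le 1$, all integers $L>L_0$ and $n\ge1$, all real $f(L)\in[(\log L)^{90},L^{1/10}]$, all $\rho\in J$ with $\rho>f(L)^{-1/40}$ and all $\varepsilon\ge f(L)^{-1/40}$ with $\rho+\varepsilon\in J$, the following holds. There is a coupling $\mathbb{Q}_{n,L}$ of $(X^{(1)}_s)_{0\le s\le n}$ and $(X^{(2)}_s)_{0\le s\le n}$, where $X^{(1)}\sim\mathbb{P}^{\rho,n}$ and $X^{(2)}\sim\mathbb{P}^{\rho+\varepsilon,L}$, such that $$\mathbb{Q}_{n,L}\Big(\min_{0\le s\le n}\big(X^{(2)}_s-X^{(1)}_s\big)<-\Big\lceil\frac nL-1\Big\rceil f(L)\Big)\le\Big(\Big\lceil\frac nL\Big\rceil-1\Big)^2e^{-f(L)^{1/40}},$$ and, if $n>L$, the same holds with $\le$ in place of $<$ inside the probability. Moreover $$v(\rho,n)\le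 v(\rho+\varepsilon,L)+2\,\frac{n-L\lfloor n/L\rfloor}{n}+\Big\lceil\frac nL-1\Big\rceil\frac{f(L)}{n}+2\Big(\Big\lceil\frac nL\Big\rceil-1\Big)^2e^{-f(L)^{1/40}}.$$ The same holds with $X^{(1)}\sim\mathbb{P}^{\rho,L}$ and $X^{(2)}\sim\mathbb{P}^{\rho+\varepsilon,n}$; that is, there is such a coupling with the same probability bounds, and $v(\rho,L)\le v(\rho+\varepsilon,n)$ plus the same three error terms. -/

import Mathlib

open MeasureTheory ProbabilityTheory

noncomputable section

/-- Particle configurations on `ℤ`. -/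
abbrev Config := ℤ → ℕ

/-- Space-time environments `(η_t)_{t ≥ 0}`. Both spaces carry the product `σ`-algebra and the
pointwise order. -/
abbrev EnvPath := ℕ → Config

/-- The number of particles in the interval `[a, a + m - 1]` (of length `m`). -/
def particles (η : Config) (a : ℤ) (m : ℕ) : ℕ := ∑ i ∈ Finset.range m, η (a + i)

/-- Space translation of a configuration: `x`-translate is `η (x + ·)`. -/
def Config.translate (x : ℤ) (η : Config) : Config := fun y => η (x + y)

/-- The space-time shift `t ↦ η_{s+t}(x + ·)`. -/
def EnvPath.shift (s : ℕ) (x : ℤ) (η : EnvPath) : EnvPath := fun t => (η (s + t)).translate x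

/-- `Q` is a coupling of `μ` and `ν`. -/
def IsCoupling {α β : Type*} [MeasurableSpace α] [MeasurableSpace β]
    (Q : Measure (α × β)) (μ : Measure α) (ν : Measure β) : Prop :=
  Q.map Prod.fst = μ ∧ Q.map Prod.snd = ν

/-- Stochastic domination `μ ≤_st ν`: there is a coupling that is almost surely ordered. -/
def StochLE {α : Type*} [MeasurableSpace α] [LE α] (μ ν : Measure α) : Prop :=
  ∃ Q : Measure (α × α), IsCoupling Q μ ν ∧ ∀ᵐ w ∂Q, w.1 ≤ w.2

/-- `η` covers `η'` on the set of integers lying in the real interval `[-r, r]`. -/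
def CoversOn (η η' : Config) (r : ℝ) : Prop :=
  ∀ x : ℤ, -r ≤ (x : ℝ) → (x : ℝ) ≤ r → η' x ≤ η x

/-- The data of an environment: an open bounded interval `J = (lo, hi) ⊆ [0, ∞)` of densities,
initial laws `μ ρ` (only those with `ρ ∈ J` are meaningful), and the law `P η₀` of the process
started at `η₀`, which depends measurably on `η₀`. -/
structure Environment where
  lo : ℝ
  hi : ℝ
  lo_nonneg : 0 ≤ lo
  lo_lt_hi : lo < hi
  μ : ℝ → Measure Config
  isProbabilityMeasure_μ : ∀ ρ, IsProbabilityMeasure (μ ρ)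
  P : Kernel Config EnvPath
  isMarkovKernel_P : IsMarkovKernel P
  start : ∀ η₀, ∀ᵐ η ∂(P η₀), η 0 = η₀

namespace Environment

instance (E : Environment) (ρ : ℝ) : IsProbabilityMeasure (E.μ ρ) := E.isProbabilityMeasure_μ ρ

instance (E : Environment) : IsMarkovKernel E.P := E.isMarkovKernel_P

/-- The interval of densities. -/
def J (E : Environment) : Set ℝ := Set.Ioo E.lo E.hi

/-- The law `∫ μ_ρ(dη₀) P^{η₀}` of the environment started from `μ_ρ`. -/
def annealed (E : Environment) (ρ : ℝ) : Measure EnvPath := (E.μ ρ).bind E.P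

instance (E : Environment) (ρ : ℝ) : IsProbabilityMeasure (E.annealed ρ) := by
  unfold annealed; infer_instance

/-- Markov property and invariance: under `P^{η₀}`, conditionally on `(η_u)_{u ≤ s}`, the process
`(η_{s+t}(x + ·))_t` has law `P^{η_s(x + ·)}`. -/
def MarkovInvariant (E : Environment) : Prop :=
  ∀ (η₀ : Config) (s : ℕ) (x : ℤ) (A : Set (Set.Iic s → Config)) (B : Set EnvPath),
    MeasurableSet A → MeasurableSet B →
    E.P η₀ {η | (fun u : Set.Iic s => η u) ∈ A ∧ η.shift s x ∈ B} =
      ∫⁻ η in {η : EnvPath | (fun u : Set.Iic s => η u) ∈ A},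
        E.P ((η s).translate x) B ∂(E.P η₀)

/-- Stationarity of `μ_ρ`. -/
def Stationary (E : Environment) : Prop :=
  ∀ ρ ∈ E.J, ∀ s : ℕ, (E.annealed ρ).map (fun η t => η (t + s)) = E.annealed ρ

/-- Monotonicity, quenched and annealed. -/
def Monotonicity (E : Environment) : Prop :=
  (∀ η₀' η₀ : Config, η₀' ≤ η₀ → StochLE (E.P η₀') (E.P η₀)) ∧
  (∀ ρ' ∈ E.J, ∀ ρ ∈ E.J, ρ' ≤ ρ → StochLE (E.μ ρ') (E.μ ρ))

/-- Density at stationarity, on all intervals `[a, a + l - 1]` of length `l`. -/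
def DensityAtStationarity (E : Environment) : Prop :=
  ∃ c : ℝ, 0 < c ∧ ∀ ρ ∈ E.J, ∀ ε : ℝ, 0 < ε → ε < 1 → ∀ l : ℕ, 1 ≤ l → ∀ a : ℤ,
    (E.annealed ρ).real {η | ε * l ≤ |(particles (η 0) a l : ℝ) - ρ * l|} ≤
      2 * Real.exp (-(c * ε ^ 2 * l))

/-- No particle drifting in from the side (`ν` is the activity rate). -/
def NoDriftIn (E : Environment) (ν : ℝ) : Prop :=
  ∀ (t H k : ℕ), 1 ≤ k → ∀ η₀ η₀' : Config, CoversOn η₀ η₀' H →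
    ∃ Q : Measure (EnvPath × EnvPath), IsCoupling Q (E.P η₀) (E.P η₀') ∧
      1 - 20 * Real.exp (-(k * ν * t / 4)) ≤
        Q.real {w | ∀ s ≤ t, CoversOn (w.1 s) (w.2 s) (H - 2 * ν * k * t)}

/-- Covering `η'` by `η` (`ν` is the activity rate). -/
def Covering (E : Environment) (ν : ℝ) : Prop :=
  ∃ C C' : ℝ, 0 < C ∧ 0 < C' ∧
    ∀ ρ ∈ E.J, ∀ ε : ℝ, 0 < ε → ε < 1 → ρ + ε ∈ E.J →
    ∀ H t : ℕ, 1 ≤ H → 1 ≤ t → 4 * ν * t < H → 1 < ν ^ 8 * t →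
      C * (ε ^ 2)⁻¹ * (1 + |Real.log (ν * t) ^ 3|) < ν * (t : ℝ) ^ (1 / 4 : ℝ) →
    ∀ l : ℕ, l = ⌊(t : ℝ) ^ (1 / 4 : ℝ)⌋₊ →
    ∀ η₀ η₀' : Config,
      (∀ (a : ℤ) (m : ℕ), l / 2 ≤ m → m ≤ l → -(H : ℤ) ≤ a → a + m - 1 ≤ H →
        (ρ + 3 * ε / 4) * m ≤ particles η₀ a m ∧
        (particles η₀' a m : ℝ) ≤ (ρ + ε / 4) * m) →
    ∃ Q : Measure (EnvPath × EnvPath), IsCoupling Q (E.P η₀) (E.P η₀') ∧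
      1 - C' * t * H * Real.exp (-((C' * (1 + ν⁻¹))⁻¹ * ε ^ 2 * (t : ℝ) ^ (1 / 4 : ℝ))) ≤
        Q.real {w | CoversOn (w.1 t) (w.2 t) (H - 4 * ν * t)}

/-- Concatenation of blocks of length `L`: on `[kL, (k+1)L)`, follow the `k`-th path. -/
def concat (L : ℕ) (ω : ℕ → EnvPath) : EnvPath := fun t => ω (t / L) (t % L)

/-- The finite-range environment `P^{ρ,L}` (`L ≥ 1`): the environment is resampled from `μ_ρ` at
each multiple of `L`, independently of the past, and evolves as the original one in between. That
is, it is the concatenation of the first `L` time units of i.i.d. copies of the environment started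
from `μ_ρ`. -/
def finiteRange (E : Environment) (ρ : ℝ) (L : ℕ) : Measure EnvPath :=
  (Measure.infinitePi (fun _ : ℕ => E.annealed ρ)).map (concat L)

end Environment

/-- The walk in the environment `η`, started at `0` and driven by `u`; `p₀`, `p₁` are the
probabilities to jump to the right from an empty, resp. occupied, site. -/
def walk (p₀ p₁ : ℝ) (η : EnvPath) (u : ℕ → unitInterval) : ℕ → ℤ
  | 0 => 0
  | n + 1 => walk p₀ p₁ η u n +
      2 * (if (u n : ℝ) ≤ (p₀ - p₁) * (if η n (walk p₀ p₁ η u n) = 0 then 1 else 0) + p₁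
        then 1 else 0) - 1

/-- The annealed law of the walk in the finite-range environment: `η` has law `P^{ρ,L}` and,
independently, the driving variables are i.i.d. uniform on `[0,1]`. -/
def walkLaw (E : Environment) (p₀ p₁ ρ : ℝ) (L : ℕ) : Measure (ℕ → ℤ) :=
  ((E.finiteRange ρ L).prod
    (Measure.infinitePi (fun _ : ℕ => (volume : Measure unitInterval)))).map
      (fun w => walk p₀ p₁ w.1 w.2)

/-- The speed `v(ρ, L) = E[X_L / L]` of the walk in the finite-range environment. -/
def speed (E : Environment) (p₀ p₁ ρ : ℝ) (L : ℕ) : ℝ :=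
  ∫ X, (X L : ℝ) / L ∂(walkLaw E p₀ p₁ ρ L)

/-- The trajectory up to time `n`. -/
def upTo (n : ℕ) (X : ℕ → ℤ) : Fin (n + 1) → ℤ := fun s => X s

/-! Measurability facts: the push-forwards above are genuine probability measures. -/

theorem measurable_concat (L : ℕ) : Measurable (Environment.concat L) := by
  unfold Environment.concat
  fun_prop

theorem measurable_walk (p₀ p₁ : ℝ) :
    Measurable (fun w : EnvPath × (ℕ → unitInterval) => walk p₀ p₁ w.1 w.2) := by
  refine measurable_pi_lambda _ fun n => ?_
  induction n with
  | zero => simp only [walk]; exact measurable_const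
  | succ n ih =>
    simp only [walk]
    have h1 : Measurable (fun w : EnvPath × (ℕ → unitInterval) =>
        w.1 n (walk p₀ p₁ w.1 w.2 n)) := by
      have h : Measurable (fun q : ℤ × (EnvPath × (ℕ → unitInterval)) => q.2.1 n q.1) :=
        measurable_from_prod_countable_right fun x =>
          (measurable_pi_apply x).comp ((measurable_pi_apply n).comp measurable_fst)
      exact h.comp (ih.prodMk measurable_id)
    have h2 : Measurable (fun w : EnvPath × (ℕ → unitInterval) =>
        if w.1 n (walk p₀ p₁ w.1 w.2 n) = 0 then (1 : ℝ) else 0) :=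
      Measurable.ite (h1 (measurableSet_singleton 0)) measurable_const measurable_const
    refine Measurable.sub_const (ih.add (Measurable.const_mul (Measurable.ite ?_
      measurable_const measurable_const) 2)) 1
    refine measurableSet_le ?_ ((h2.const_mul _).add_const _)
    fun_prop

instance (E : Environment) (ρ : ℝ) (L : ℕ) : IsProbabilityMeasure (E.finiteRange ρ L) :=
  Measure.isProbabilityMeasure_map (measurable_concat L).aemeasurable

instance (E : Environment) (p₀ p₁ ρ : ℝ) (L : ℕ) :
    IsProbabilityMeasure (walkLaw E p₀ p₁ ρ L) :=
  Measure.isProbabilityMeasure_map (measurable_walk p₀ p₁).aemeasurable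

end

/-! One block of length `L` is compared as follows. Suppose that at its start the first environment
has density at most `ρ + δ / 4` and the second at least `ρ + 3 * δ / 4` on intervals of length about
`t ^ (1 / 4)` in a large window. The covering hypothesis then couples them so that after `t` time
units the second covers the first, in a frame moved by any moderate shift. Meanwhile each walk moves
by at most `t`. If the shift is the gap allowed so far plus `2 * t`, the walks are ordered in that
frame at time `t`. The no-drift hypothesis keeps the environments ordered up to the end of the block
on a window that the walk cannot leave, and walks driven by the same uniform variables, at even
distance, cannot cross in ordered environments (`traj_sub_le_traj`). So a block enlarges the allowed
gap by `2 * t`. The first block costs nothing, since monotonicity gives ordered environments from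
the start; the other `j = ⌈n / L⌉ - 1` blocks cost `2 * t * j ≤ j * f`.

Nothing here depends on how the environment at the start of a block arose. It may be fresh or the
continuation of the old one; by stationarity its law is `E.μ ρ` in both cases. Hence refreshing
every `n` steps and every `L` steps are treated together, through an update kernel `κ` that is the
identity or constant.

Couplings of successive blocks are not glued. For fixed driving variables, the expectation of a
functional of the path is a value function of the current path and environment. These values are
compared by backward induction (`Scale.stageValue_le`, `Scale.chainValue_le`), with errors counting
the atypical block starts and the failed block couplings. Applied to indicators, this is the
hypothesis of Strassen's theorem on the finite set of trajectories up to time `n`, which yields the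
coupling (`Scale.exists_coupling`).

The speeds are compared in expectation by telescoping: an increment over a block of the walk without
refresh is compared with that of a walk in a fresh environment, whatever the past
(`Scale.meanPosition_sub_le`, `Scale.meanPosition_le_sub`).

For the parameters, let `x = f ^ (1 / 40)`, `δ = x⁻¹` and `t = ⌊x ^ 40 / 8⌋`. Then `δ ^ 2 * t ^ (1 /
4)` is at least of order `x ^ 8`, so the exponential errors beat the polynomial factors in `L ≤ exp
x` (`exists_scale`). -/

/-! ### Strassen's theorem on finite sets -/

section Strassen

open Finset

/-- Sub-couplings of the weights `p` and `q` that are supported on the relation `R`. -/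
def partialCouplings {S T : Type*} [Fintype S] [Fintype T] (p : S → ℝ) (q : T → ℝ)
    (R : S → T → Prop) : Set (S → T → ℝ) :=
  {w | (∀ s t, 0 ≤ w s t) ∧ (∀ s t, ¬ R s t → w s t = 0) ∧
    (∀ s, ∑ t, w s t ≤ p s) ∧ ∀ t, ∑ s, w s t ≤ q t}

theorem isCompact_partialCouplings {S T : Type*} [Fintype S] [Fintype T] (p : S → ℝ) (q : T → ℝ)
    (R : S → T → Prop) : IsCompact (partialCouplings p q R) := by
  have hcl : IsClosed (partialCouplings p q R) := by
    simp only [partialCouplings, Set.ofPred_and, Set.ofPred_forall]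
    refine ((isClosed_iInter fun s => isClosed_iInter fun t => ?_).inter
      ((isClosed_iInter fun s => isClosed_iInter fun t => isClosed_iInter fun _ => ?_).inter
      ((isClosed_iInter fun s => ?_).inter (isClosed_iInter fun t => ?_))))
    · exact isClosed_le continuous_const (by fun_prop)
    · exact isClosed_eq (by fun_prop) continuous_const
    · exact isClosed_le (by fun_prop) continuous_const
    · exact isClosed_le (by fun_prop) continuous_const
  have hsub : partialCouplings p q R ⊆ Set.Icc (fun _ _ => 0) (fun s _ => p s) := by
    rintro w ⟨h0, -, hp, -⟩
    refine ⟨fun s t => h0 s t, fun s t => ?_⟩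
    exact (single_le_sum (fun t _ => h0 s t) (mem_univ t)).trans (hp s)
  exact isCompact_Icc.of_isClosed_subset hcl hsub

theorem convex_partialCouplings {S T : Type*} [Fintype S] [Fintype T] (p : S → ℝ) (q : T → ℝ)
    (R : S → T → Prop) : Convex ℝ (partialCouplings p q R) := by
  rintro w ⟨h0, h1, h2, h3⟩ w' ⟨h0', h1', h2', h3'⟩ a b ha hb hab
  refine ⟨fun s t => ?_, fun s t h => ?_, fun s => ?_, fun t => ?_⟩
  · simp only [Pi.add_apply, Pi.smul_apply, smul_eq_mul]
    exact add_nonneg (mul_nonneg ha (h0 s t)) (mul_nonneg hb (h0' s t))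
  · simp [h1 s t h, h1' s t h]
  · simp only [Pi.add_apply, Pi.smul_apply, smul_eq_mul, sum_add_distrib, ← mul_sum]
    calc _ ≤ a * p s + b * p s :=
          add_le_add (mul_le_mul_of_nonneg_left (h2 s) ha) (mul_le_mul_of_nonneg_left (h2' s) hb)
      _ = p s := by rw [← add_mul, hab, one_mul]
  · simp only [Pi.add_apply, Pi.smul_apply, smul_eq_mul, sum_add_distrib, ← mul_sum]
    calc _ ≤ a * q t + b * q t :=
          add_le_add (mul_le_mul_of_nonneg_left (h3 t) ha) (mul_le_mul_of_nonneg_left (h3' t) hb)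
      _ = q t := by rw [← add_mul, hab, one_mul]

/-- Max-flow min-cut for a bipartite relation. -/
theorem exists_partialCoupling {S T : Type*} [Fintype S] [Fintype T] (p : S → ℝ) (q : T → ℝ)
    (hp : ∀ s, 0 ≤ p s) (hq : ∀ t, 0 ≤ q t) (R : S → T → Prop) (d : ℝ)
    (h : ∀ (A : Finset S) (B : Finset T), (∀ s ∈ A, ∀ t, R s t → t ∈ B) →
      ∑ s ∈ A, p s ≤ ∑ t ∈ B, q t + d) :
    ∃ w ∈ partialCouplings p q R, ∑ s, p s - d ≤ ∑ s, ∑ t, w s t := by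
  classical
  obtain ⟨w₀, hw₀, hmax₀⟩ := (isCompact_partialCouplings p q R).exists_isMaxOn
    ⟨0, by refine ⟨?_, ?_, ?_, ?_⟩ <;> simp [hp, hq]⟩
    (f := fun w => ∑ s, ∑ t, w s t) (by fun_prop)
  set M := ∑ s, ∑ t, w₀ s t with hM
  have hmax : ∀ w ∈ partialCouplings p q R, ∑ s, ∑ t, w s t ≤ M := fun w hw => hmax₀ hw
  -- rows that have slack in some maximal flow
  let slack : S → Prop := fun s => ∃ w ∈ partialCouplings p q R, ∑ s, ∑ t, w s t = M ∧
    ∑ t, w s t < p s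
  let A : Finset S := univ.filter slack
  -- a maximal flow in which all these rows have slack at once
  obtain ⟨w, hw, hwM, hwA⟩ : ∃ w ∈ partialCouplings p q R, ∑ s, ∑ t, w s t = M ∧
      ∀ s ∈ A, ∑ t, w s t < p s := by
    have key : ∀ B : Finset S, (∀ s ∈ B, slack s) → ∃ w ∈ partialCouplings p q R,
        ∑ s, ∑ t, w s t = M ∧ ∀ s ∈ B, ∑ t, w s t < p s := by
      intro B
      induction B using Finset.induction_on with
      | empty => intro _; exact ⟨w₀, hw₀, rfl, by simp⟩
      | insert b B hb ih =>
        intro hB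
        obtain ⟨w, hw, hwM, hwB⟩ := ih fun s hs => hB s (mem_insert_of_mem hs)
        obtain ⟨w', hw', hwM', hwb⟩ := hB b (mem_insert_self _ _)
        refine ⟨(1 / 2 : ℝ) • w + (1 / 2 : ℝ) • w', convex_partialCouplings p q R hw hw'
          (by norm_num) (by norm_num) (by norm_num), ?_, ?_⟩
        · simp only [Pi.add_apply, Pi.smul_apply, smul_eq_mul, sum_add_distrib, ← mul_sum,
            hwM, hwM']
          ring
        · intro s hs
          simp only [Pi.add_apply, Pi.smul_apply, smul_eq_mul, sum_add_distrib, ← mul_sum]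
          rcases mem_insert.1 hs with rfl | hs
          · have := hw.2.2.1 s; linarith
          · have := hwB s hs; have := hw'.2.2.1 s; linarith
    exact key A fun s hs => (mem_filter.1 hs).2
  refine ⟨w, hw, ?_⟩
  obtain ⟨w0, wR, wp, wq⟩ := hw
  let B : Finset T := univ.filter fun t => ∃ s ∈ A, R s t
  -- A row of `A` has slack, so an adjacent column with room left could receive more mass, against
  -- maximality.
  have hsat : ∀ t ∈ B, ∑ s, w s t = q t := by
    intro t ht
    obtain ⟨s, hs, hst⟩ := (mem_filter.1 ht).2
    by_contra hne
    have hlt : ∑ s, w s t < q t := lt_of_le_of_ne (wq t) hne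
    have hls := hwA s hs
    set e := min (q t - ∑ s, w s t) (p s - ∑ t, w s t) with he
    have hepos : 0 < e := lt_min (by linarith) (by linarith)
    have he1 : e ≤ q t - ∑ s, w s t := min_le_left _ _
    have he2 : e ≤ p s - ∑ t, w s t := min_le_right _ _
    let w' : S → T → ℝ := fun a b => w a b + if a = s then (if b = t then e else 0) else 0
    have hrow : ∀ a, ∑ b, w' a b = ∑ b, w a b + if a = s then e else 0 := by
      intro a
      simp only [w', sum_add_distrib]
      split_ifs <;> simp
    have hcol : ∀ b, ∑ a, w' a b = ∑ a, w a b + if b = t then e else 0 := by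
      intro b
      simp only [w', sum_add_distrib]
      simp
    have hw' : w' ∈ partialCouplings p q R := by
      refine ⟨fun a b => ?_, fun a b hab => ?_, fun a => ?_, fun b => ?_⟩
      · have := w0 a b
        simp only [w']; split_ifs <;> linarith
      · have := wR a b hab
        simp only [w']; split_ifs with h1 h2
        · subst h1 h2; exact absurd hst hab
        · linarith
        · linarith
      · rw [hrow]; have := wp a
        split_ifs with h1
        · subst h1; linarith
        · linarith
      · rw [hcol]; have := wq b
        split_ifs with h1
        · subst h1; linarith
        · linarith
    have := hmax w' hw'
    simp only [hrow, sum_add_distrib, hwM] at this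
    simp at this
    linarith
  -- Mass sent to `t` from `s' ∉ A` could be rerouted through the slack row `s`: the total is
  -- unchanged and `s'` gains slack, so `s'` would belong to `A`.
  have hback : ∀ t ∈ B, ∀ s, s ∉ A → w s t = 0 := by
    intro t ht s' hs'
    obtain ⟨s, hs, hst⟩ := (mem_filter.1 ht).2
    by_contra hne
    have hpos : 0 < w s' t := lt_of_le_of_ne (w0 s' t) (Ne.symm hne)
    have hss : s' ≠ s := fun h => hs' (h ▸ hs)
    have hls := hwA s hs
    set e := min (w s' t) (p s - ∑ t, w s t) with he
    have hepos : 0 < e := lt_min (by linarith) (by linarith)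
    have he1 : e ≤ w s' t := min_le_left _ _
    have he2 : e ≤ p s - ∑ t, w s t := min_le_right _ _
    let w' : S → T → ℝ := fun a b => w a b + (if a = s then (if b = t then e else 0) else 0)
      - (if a = s' then (if b = t then e else 0) else 0)
    have hrow : ∀ a, ∑ b, w' a b = ∑ b, w a b + (if a = s then e else 0)
        - if a = s' then e else 0 := by
      intro a
      simp only [w', sum_add_distrib, sum_sub_distrib]
      split_ifs <;> simp
    have hcol : ∀ b, ∑ a, w' a b = ∑ a, w a b := by
      intro b
      simp only [w', sum_add_distrib, sum_sub_distrib]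
      simp
    have hw' : w' ∈ partialCouplings p q R := by
      refine ⟨fun a b => ?_, fun a b hab => ?_, fun a => ?_, fun b => ?_⟩
      · have := w0 a b
        simp only [w']
        split_ifs with h1 h2 h3 h4 h5 h6 <;> try linarith
        subst h5 h6; linarith
      · have := wR a b hab
        simp only [w']
        have h1 : ¬ (a = s ∧ b = t) := by rintro ⟨rfl, rfl⟩; exact hab hst
        have h2 : ¬ (a = s' ∧ b = t) := by rintro ⟨rfl, rfl⟩; exact hne this
        split_ifs <;> first | linarith | (exfalso; tauto)
      · rw [hrow]; have := wp a
        split_ifs with h1 h2 h2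
        · subst h1; linarith
        · subst h1; linarith
        · linarith
        · linarith
      · rw [hcol]; exact wq b
    refine hs' (mem_filter.2 ⟨mem_univ _, w', hw', ?_, ?_⟩)
    · rw [sum_comm]; simp only [hcol]; rw [sum_comm]; exact hwM
    · rw [hrow]; have := wp s'
      simp [hss]; linarith
  -- Rows outside `A` are saturated, rows of `A` send all their mass into `B`, and `B` is filled by
  -- `A` alone. So the flow equals the value of the cut.
  have h1 : ∑ s, ∑ t, w s t = ∑ s ∈ A, ∑ t, w s t + ∑ s ∈ Aᶜ, p s := by
    rw [← sum_add_sum_compl A]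
    congr 1
    refine sum_congr rfl fun s hs => ?_
    by_contra hne
    exact (mem_compl.1 hs) (mem_filter.2 ⟨mem_univ _, w, ⟨w0, wR, wp, wq⟩, hwM,
      lt_of_le_of_ne (wp s) hne⟩)
  have h2 : ∑ s ∈ A, ∑ t, w s t = ∑ t ∈ B, q t := by
    calc ∑ s ∈ A, ∑ t, w s t = ∑ s ∈ A, ∑ t ∈ B, w s t := by
          refine sum_congr rfl fun s hs => (sum_subset (subset_univ _) fun t _ ht => ?_).symm
          exact wR s t fun hst => ht (mem_filter.2 ⟨mem_univ _, s, hs, hst⟩)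
      _ = ∑ t ∈ B, ∑ s ∈ A, w s t := sum_comm
      _ = ∑ t ∈ B, ∑ s, w s t := sum_congr rfl fun t ht =>
          sum_subset (subset_univ _) fun s _ hs => hback t ht s hs
      _ = _ := sum_congr rfl hsat
  have h3 := h A B fun s hs t hst => mem_filter.2 ⟨mem_univ _, s, hs, hst⟩
  have h4 := sum_add_sum_compl A p
  rw [h1, h2]; linarith

/-- Strassen's theorem for weights of total mass one on finite types. -/
theorem exists_coupling_of_fintype {S T : Type*} [Fintype S] [Fintype T] (p : S → ℝ) (q : T → ℝ)
    (hp : ∀ s, 0 ≤ p s) (hq : ∀ t, 0 ≤ q t) (hp1 : ∑ s, p s = 1) (hq1 : ∑ t, q t = 1)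
    (R : S → T → Prop) (d : ℝ)
    (h : ∀ (A : Finset S) (B : Finset T), (∀ s ∈ A, ∀ t, R s t → t ∈ B) →
      ∑ s ∈ A, p s ≤ ∑ t ∈ B, q t + d) :
    ∃ w v : S → T → ℝ, (∀ s t, 0 ≤ w s t) ∧ (∀ s t, 0 ≤ v s t) ∧ (∀ s t, ¬ R s t → w s t = 0) ∧
      (∀ s, ∑ t, (w s t + v s t) = p s) ∧ (∀ t, ∑ s, (w s t + v s t) = q t) ∧
      ∑ s, ∑ t, v s t ≤ d := by
  obtain ⟨w, ⟨w0, wR, wp, wq⟩, hw⟩ := exists_partialCoupling p q hp hq R d h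
  set r : S → ℝ := fun s => p s - ∑ t, w s t with hr
  set r' : T → ℝ := fun t => q t - ∑ s, w s t with hr'
  have r0 : ∀ s, 0 ≤ r s := fun s => sub_nonneg.2 (wp s)
  have r0' : ∀ t, 0 ≤ r' t := fun t => sub_nonneg.2 (wq t)
  set m := ∑ s, r s with hm
  have hmw : m = 1 - ∑ s, ∑ t, w s t := by simp only [hm, hr, sum_sub_distrib, hp1]
  have hm' : ∑ t, r' t = m := by
    rw [hmw, sum_comm]; simp only [hr', sum_sub_distrib, hq1]
  have m0 : 0 ≤ m := sum_nonneg fun s _ => r0 s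
  -- If `m = 0`, the residual masses vanish, and division by zero returns the correct value `0`.
  have hrm : ∀ s, r s * m / m = r s := by
    intro s
    rcases eq_or_ne m 0 with h0 | h0
    · have := (sum_eq_zero_iff_of_nonneg fun s _ => r0 s).1 (hm ▸ h0) s (mem_univ s)
      simp [this]
    · field_simp
  have hrm' : ∀ t, m * r' t / m = r' t := by
    intro t
    rcases eq_or_ne m 0 with h0 | h0
    · have := (sum_eq_zero_iff_of_nonneg fun s _ => r0' s).1 (hm'.trans h0) t (mem_univ t)
      simp [this]
    · field_simp
  -- The normalized product of the unmatched masses repairs both marginals, at the cost `m ≤ d`.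
  refine ⟨w, fun s t => r s * r' t / m, w0,
    fun s t => div_nonneg (mul_nonneg (r0 s) (r0' t)) m0, wR, fun s => ?_, fun t => ?_, ?_⟩
  · rw [sum_add_distrib, ← sum_div, ← mul_sum, hm', hrm]; simp [hr]
  · rw [sum_add_distrib, ← sum_div, ← sum_mul, ← hm, hrm']; simp [hr']
  · simp only [← sum_div, ← mul_sum, hm', hrm]
    rw [← hm, hmw]; linarith [hp1]

theorem eq_sum_dirac_of_compl_finset_null {γ : Type*} [MeasurableSpace γ]
    [MeasurableSingletonClass γ] (μ : Measure γ) [IsProbabilityMeasure μ] (S : Finset γ)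
    (hS : μ (S : Set γ)ᶜ = 0) :
    μ = ∑ s : S, ENNReal.ofReal (μ.real {s.1}) • Measure.dirac s.1 := by
  classical
  ext A hA
  have h1 : μ A = μ (S.filter (· ∈ A) : Finset γ) := by
    refine measure_congr ?_
    have : ∀ᵐ x ∂μ, x ∈ (S : Set γ) := by rw [ae_iff]; exact hS
    filter_upwards [this] with x hx
    simp only [Finset.mem_coe] at hx
    apply propext
    change x ∈ A ↔ x ∈ ((S.filter (· ∈ A) : Finset γ) : Set γ)
    simp [hx]
  rw [h1, ← sum_measure_singleton, Measure.finsetSum_apply, sum_filter,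
    Finset.sum_coe_sort S fun s => (ENNReal.ofReal (μ.real {s}) • Measure.dirac s) A]
  refine sum_congr rfl fun s _ => ?_
  simp [Measure.dirac_apply' s hA, Set.indicator_apply, Measure.real]

theorem sum_measureReal_subtype {γ : Type*} [MeasurableSpace γ] [MeasurableSingletonClass γ]
    (μ : Measure γ) [IsProbabilityMeasure μ] (S : Finset γ) (A : Finset S) :
    ∑ s ∈ A, μ.real {s.1} = μ.real (A.map (Function.Embedding.subtype _) : Finset γ) := by
  rw [← sum_measureReal_singleton, Finset.sum_map]
  rfl

theorem sum_measureReal_eq_one {γ : Type*} [MeasurableSpace γ] [MeasurableSingletonClass γ]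
    (μ : Measure γ) [IsProbabilityMeasure μ] (S : Finset γ) (hS : μ (S : Set γ)ᶜ = 0) :
    ∑ s : S, μ.real {s.1} = 1 := by
  rw [Finset.sum_coe_sort S fun s => μ.real {s}, sum_measureReal_singleton]
  have := prob_compl_eq_zero_iff (μ := μ) S.measurableSet |>.1 hS
  simp [Measure.real, this]

/-- Strassen's theorem for probability measures that are carried by finite sets. -/
theorem exists_coupling_of_finset {α β : Type*} [MeasurableSpace α] [MeasurableSpace β]
    [MeasurableSingletonClass α] [MeasurableSingletonClass β] (μ : Measure α) (ν : Measure β)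
    [IsProbabilityMeasure μ] [IsProbabilityMeasure ν] (S : Finset α) (T : Finset β)
    (hS : μ (S : Set α)ᶜ = 0) (hT : ν (T : Set β)ᶜ = 0) (R : α → β → Prop) (d : ℝ)
    (h : ∀ A : Finset α, μ.real A ≤ ν.real {t | ∃ s ∈ A, R s t} + d) :
    ∃ Q : Measure (α × β), IsCoupling Q μ ν ∧ Q.real {w | ¬ R w.1 w.2} ≤ d := by
  classical
  obtain ⟨w, v, w0, v0, wR, hp, hq, hd⟩ := exists_coupling_of_fintype
    (fun s : S => μ.real {s.1}) (fun t : T => ν.real {t.1}) (fun _ => measureReal_nonneg)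
    (fun _ => measureReal_nonneg) (sum_measureReal_eq_one μ S hS) (sum_measureReal_eq_one ν T hT)
    (fun s t => R s.1 t.1) d
    (by
      intro A B hAB
      rw [sum_measureReal_subtype, sum_measureReal_subtype]
      refine (h _).trans (add_le_add_left ?_ d)
      refine ENNReal.toReal_mono (measure_ne_top _ _) (measure_mono_ae ?_)
      have : ∀ᵐ x ∂ν, x ∈ (T : Set β) := by rw [ae_iff]; exact hT
      filter_upwards [this] with t ht hst
      obtain ⟨s, hs, hst⟩ := hst
      obtain ⟨s', hs', rfl⟩ := Finset.mem_map.1 hs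
      exact Finset.mem_coe.2 (Finset.mem_map.2 ⟨⟨t, ht⟩, hAB s' hs' ⟨t, ht⟩ hst, rfl⟩))
  let Q : Measure (α × β) := ∑ s : S, ∑ t : T,
    ENNReal.ofReal (w s t + v s t) • Measure.dirac (s.1, t.1)
  have wv0 : ∀ s t, 0 ≤ w s t + v s t := fun s t => add_nonneg (w0 s t) (v0 s t)
  refine ⟨Q, ⟨?_, ?_⟩, ?_⟩
  · rw [eq_sum_dirac_of_compl_finset_null μ S hS]
    simp only [Q]
    rw [← Measure.mapₗ_apply_of_measurable measurable_fst, map_sum]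
    refine sum_congr rfl fun s _ => ?_
    have hdirac : ∀ t, Measure.mapₗ Prod.fst (ENNReal.ofReal (w s t + v s t) •
        Measure.dirac (s.1, t.1)) = ENNReal.ofReal (w s t + v s t) • Measure.dirac s.1 := by
      intro t
      rw [map_smul, Measure.mapₗ_apply_of_measurable measurable_fst,
        Measure.map_dirac' measurable_fst]
    rw [map_sum, sum_congr rfl fun t _ => hdirac t]
    rw [← Finset.sum_smul, ← ENNReal.ofReal_sum_of_nonneg fun t _ => wv0 s t, hp]
  · rw [eq_sum_dirac_of_compl_finset_null ν T hT]
    simp only [Q]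
    rw [sum_comm, ← Measure.mapₗ_apply_of_measurable measurable_snd, map_sum]
    refine sum_congr rfl fun t _ => ?_
    have hdirac : ∀ s, Measure.mapₗ Prod.snd (ENNReal.ofReal (w s t + v s t) •
        Measure.dirac (s.1, t.1)) = ENNReal.ofReal (w s t + v s t) • Measure.dirac t.1 := by
      intro s
      rw [map_smul, Measure.mapₗ_apply_of_measurable measurable_snd,
        Measure.map_dirac' measurable_snd]
    rw [map_sum, sum_congr rfl fun s _ => hdirac s]
    rw [← Finset.sum_smul, ← ENNReal.ofReal_sum_of_nonneg fun s _ => wv0 s t, hq]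
  · have hd0 : 0 ≤ d := le_trans (sum_nonneg fun s _ => sum_nonneg fun t _ => v0 s t) hd
    refine ENNReal.toReal_le_of_le_ofReal hd0 ?_
    -- As `w` vanishes off `R`, only `v` contributes to the failure.
    calc Q {w | ¬ R w.1 w.2} ≤ ∑ s : S, ∑ t : T, ENNReal.ofReal (v s t) := by
          simp only [Q, Measure.finsetSum_apply, Measure.smul_apply, smul_eq_mul]
          refine sum_le_sum fun s _ => sum_le_sum fun t _ => ?_
          by_cases hst : R s.1 t.1
          · have : (Measure.dirac ((s : α), (t : β))) {w | ¬ R w.1 w.2} = 0 := by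
              rw [Measure.dirac_apply]
              simp [hst]
            rw [this]; simp
          · rw [wR s t hst, zero_add]
            exact mul_le_of_le_one_right' prob_le_one
      _ = ENNReal.ofReal (∑ s, ∑ t, v s t) := by
          rw [ENNReal.ofReal_sum_of_nonneg fun s _ => sum_nonneg fun t _ => v0 s t]
          exact sum_congr rfl fun s _ => (ENNReal.ofReal_sum_of_nonneg fun t _ => v0 s t).symm
      _ ≤ ENNReal.ofReal d := ENNReal.ofReal_le_ofReal hd

end Strassen

/-! ### Translations, Markov property and stationarity in integral form -/

noncomputable section

open scoped ENNReal

theorem Config.translate_zero (η : Config) : η.translate 0 = η := by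
  funext y; simp [Config.translate]

theorem Config.translate_translate (x y : ℤ) (η : Config) :
    (η.translate x).translate y = η.translate (x + y) := by
  funext z; simp [Config.translate, add_assoc]

@[fun_prop]
theorem measurable_configTranslate (x : ℤ) : Measurable (Config.translate x) := by
  unfold Config.translate; fun_prop

/-- Space translation of a space-time environment. -/
def EnvPath.translate (x : ℤ) (ζ : EnvPath) : EnvPath := fun t => (ζ t).translate x

theorem EnvPath.translate_translate (x y : ℤ) (ζ : EnvPath) :
    (ζ.translate x).translate y = ζ.translate (x + y) :=
  funext fun t => Config.translate_translate x y (ζ t)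

theorem EnvPath.translate_zero (ζ : EnvPath) : ζ.translate 0 = ζ :=
  funext fun t => Config.translate_zero (ζ t)

@[fun_prop]
theorem measurable_envTranslate (x : ℤ) : Measurable (EnvPath.translate x) := by
  unfold EnvPath.translate Config.translate; fun_prop

@[fun_prop]
theorem measurable_shift (s : ℕ) (x : ℤ) : Measurable (EnvPath.shift s x) := by
  unfold EnvPath.shift Config.translate; fun_prop

/-- The environment frozen at time `a`. -/
def EnvPath.freeze (a : ℕ) (ζ : EnvPath) : EnvPath := fun t => ζ (min t a)

theorem particles_translate (η : Config) (x a : ℤ) (m : ℕ) :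
    particles (η.translate x) a m = particles η (x + a) m := by
  simp [particles, Config.translate, add_assoc]

theorem measurable_particles (a : ℤ) (m : ℕ) : Measurable fun η : Config => particles η a m := by
  unfold particles; fun_prop

namespace Environment

variable {E : Environment}

/-- At `s = 0`, with no condition on the past, the Markov property reduces to translation
covariance, because the initial configuration is almost surely `η`. -/
theorem MarkovInvariant.map_translate (h : E.MarkovInvariant) (x : ℤ) (η : Config) :
    (E.P η).map (EnvPath.translate x) = E.P (η.translate x) := by
  ext B hB
  rw [Measure.map_apply (by fun_prop) hB]
  have h1 := h η 0 x Set.univ B MeasurableSet.univ hB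
  have h2 : {ζ : EnvPath | (fun u : Set.Iic 0 => ζ u) ∈ (Set.univ : Set (Set.Iic 0 → Config)) ∧
      ζ.shift 0 x ∈ B} = EnvPath.translate x ⁻¹' B := by
    ext ζ
    have : ζ.shift 0 x = ζ.translate x := by
      funext t; simp [EnvPath.shift, EnvPath.translate]
    simp [this]
  rw [h2] at h1
  rw [h1]
  simp only [Set.mem_univ, Set.ofPred_true, Measure.restrict_univ]
  have h3 : ∀ᵐ ζ ∂(E.P η), E.P ((ζ 0).translate x) B = E.P (η.translate x) B := by
    filter_upwards [E.start η] with ζ hζ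
    rw [hζ]
  rw [lintegral_congr_ae h3]
  simp

/-- The past up to time `a` and the future have the joint law of the past followed by `E.P` from the
present configuration. Freezing expresses dependence on the past alone by a function on path space.
-/
theorem MarkovInvariant.lintegral_eq (h : E.MarkovInvariant) (a : ℕ) (η : Config)
    {Φ : EnvPath × EnvPath → ℝ≥0∞} (hΦ : Measurable Φ) :
    ∫⁻ ζ, Φ (ζ.freeze a, ζ.shift a 0) ∂(E.P η) =
      ∫⁻ ζ, ∫⁻ ξ, Φ (ζ.freeze a, ξ) ∂(E.P (ζ a)) ∂(E.P η) := by
  let r : EnvPath → (Set.Iic a → Config) := fun ζ u => ζ u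
  have hr : Measurable r := by fun_prop
  let ev : (Set.Iic a → Config) → Config := fun w => w ⟨a, le_refl a⟩
  have hev : Measurable ev := by fun_prop
  -- Continues a past as a constant path, so that `ext' ∘ r` is freezing at time `a`.
  let ext' : (Set.Iic a → Config) → EnvPath := fun w t =>
    w ⟨min t a, Set.mem_Iic.2 (min_le_right _ _)⟩
  have hext : Measurable ext' := by fun_prop
  have hmeas : (E.P η).map (fun ζ => (r ζ, ζ.shift a 0)) =
      ((E.P η).map r) ⊗ₘ (E.P.comap ev hev) := by
    have : IsProbabilityMeasure ((E.P η).map r) :=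
      Measure.isProbabilityMeasure_map hr.aemeasurable
    have : IsProbabilityMeasure ((E.P η).map (fun ζ => (r ζ, ζ.shift a 0))) :=
      Measure.isProbabilityMeasure_map (by fun_prop)
    refine Measure.ext_prod fun {s t} hs ht => ?_
    rw [Measure.map_apply (by fun_prop) (hs.prod ht), Measure.compProd_apply_prod hs ht,
      setLIntegral_map hs (Kernel.measurable_coe _ ht) hr]
    have := h η a 0 s t hs ht
    simp only [Config.translate_zero] at this
    exact this
  have h1 : ∫⁻ ζ, Φ (ζ.freeze a, ζ.shift a 0) ∂(E.P η) =
      ∫⁻ w, Φ (ext' w.1, w.2) ∂((E.P η).map (fun ζ => (r ζ, ζ.shift a 0))) := by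
    rw [lintegral_map (by fun_prop) (by fun_prop)]
    rfl
  rw [h1, hmeas, Measure.lintegral_compProd (by fun_prop),
    lintegral_map (Measurable.lintegral_kernel_prod_right (by fun_prop)) hr]
  rfl

/-- The annealed law is invariant under time shifts and starts from `E.μ ρ`. This gives the law of
the environment at the end of a block. -/
theorem Stationary.lintegral_eq (h : E.Stationary) {ρ : ℝ} (hρ : ρ ∈ E.J) (s : ℕ)
    {g : Config → ℝ≥0∞} (hg : Measurable g) :
    ∫⁻ η, ∫⁻ ζ, g (ζ s) ∂(E.P η) ∂(E.μ ρ) = ∫⁻ η, g η ∂(E.μ ρ) := by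
  have h1 : ∫⁻ ζ, g (ζ s) ∂(E.annealed ρ) = ∫⁻ ζ, g (ζ 0) ∂(E.annealed ρ) := by
    conv_rhs => rw [← h ρ hρ s]
    rw [lintegral_map (by fun_prop) (by fun_prop)]
    simp
  have h2 : ∀ t, ∫⁻ ζ, g (ζ t) ∂(E.annealed ρ) = ∫⁻ η, ∫⁻ ζ, g (ζ t) ∂(E.P η) ∂(E.μ ρ) :=
    fun t => Measure.lintegral_bind E.P.aemeasurable (hg.comp (measurable_pi_apply t)).aemeasurable
  rw [← h2, h1, h2]
  refine lintegral_congr fun η => ?_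
  have h3 : ∀ᵐ ζ ∂(E.P η), g (ζ 0) = g η := by
    filter_upwards [E.start η] with ζ hζ
    rw [hζ]
  rw [lintegral_congr_ae h3]
  simp

end Environment

/-! ### Couplings -/

theorem IsCoupling.isProbabilityMeasure {α β : Type*} [MeasurableSpace α] [MeasurableSpace β]
    {Q : Measure (α × β)} {μ : Measure α} {ν : Measure β} [IsProbabilityMeasure μ]
    (h : IsCoupling Q μ ν) : IsProbabilityMeasure Q := by
  constructor
  have := h.1 ▸ measure_univ (μ := μ)
  rwa [Measure.map_apply measurable_fst MeasurableSet.univ, Set.preimage_univ] at this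

/-- Comparing expectations through a coupling, up to an exceptional event. -/
theorem IsCoupling.lintegral_le {α β : Type*} [MeasurableSpace α] [MeasurableSpace β]
    {Q : Measure (α × β)} {μ : Measure α} {ν : Measure β}
    (h : IsCoupling Q μ ν) {f : α → ℝ≥0∞} {e : α → ℝ≥0∞} {g : β → ℝ≥0∞} (hf : Measurable f)
    (he : Measurable e) (hg : Measurable g) (hf1 : ∀ a, f a ≤ 1) {B : Set (α × β)}
    (hB : MeasurableSet B) (hle : ∀ w ∈ B, f w.1 ≤ g w.2 + e w.1) :
    ∫⁻ a, f a ∂μ ≤ ∫⁻ b, g b ∂ν + ∫⁻ a, e a ∂μ + Q Bᶜ := by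
  rw [← h.1, ← h.2, lintegral_map hf measurable_fst, lintegral_map hg measurable_snd,
    lintegral_map he measurable_fst, ← lintegral_indicator_one hB.compl,
    ← lintegral_add_right _ (by fun_prop : Measurable fun w : α × β => e w.1),
    ← lintegral_add_right _ (measurable_one.indicator hB.compl)]
  refine lintegral_mono fun w => ?_
  by_cases hw : w ∈ B
  · exact (hle w hw).trans le_self_add
  · have : (Bᶜ).indicator (1 : α × β → ℝ≥0∞) w = 1 := Set.indicator_of_mem hw _
    simp only [this]
    exact (hf1 _).trans le_add_self

theorem measurableSet_coversOn (r : ℝ) :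
    MeasurableSet {w : Config × Config | CoversOn w.1 w.2 r} := by
  simp only [CoversOn, Set.ofPred_forall]
  refine MeasurableSet.iInter fun x => MeasurableSet.iInter fun _ =>
    MeasurableSet.iInter fun _ => ?_
  exact measurableSet_le (by fun_prop) (by fun_prop)

theorem CoversOn.mono {η η' : Config} {r s : ℝ} (h : CoversOn η η' r) (hs : s ≤ r) :
    CoversOn η η' s := fun x h1 h2 => h x (by linarith) (by linarith)

/-! ### The coupling hypotheses in a shifted frame -/

namespace Environment

variable {E : Environment}

/-- Exchange the two paths of a coupling and translate the new first one back by `d`. -/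
theorem MarkovInvariant.isCoupling_swap (h : E.MarkovInvariant) {η₁ η₂ : Config} {d : ℤ}
    {Q : Measure (EnvPath × EnvPath)} (hQ : IsCoupling Q (E.P η₂) (E.P (η₁.translate d))) :
    IsCoupling (Q.map fun w => (w.2.translate (-d), w.1)) (E.P η₁) (E.P η₂) := by
  have hm : Measurable fun w : EnvPath × EnvPath => (w.2.translate (-d), w.1) := by fun_prop
  constructor
  · rw [Measure.map_map measurable_fst hm]
    have : Prod.fst ∘ (fun w : EnvPath × EnvPath => (w.2.translate (-d), w.1)) =
        EnvPath.translate (-d) ∘ Prod.snd := rfl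
    rw [this, ← Measure.map_map (by fun_prop) measurable_snd, hQ.2, h.map_translate,
      Config.translate_translate]
    simp [Config.translate_zero]
  · rw [Measure.map_map measurable_snd hm]
    exact hQ.1

theorem compl_le_of_le_real {α : Type*} [MeasurableSpace α] {Q : Measure α}
    [IsProbabilityMeasure Q] {B : Set α} (hB : MeasurableSet B) {p : ℝ}
    (h : 1 - p ≤ Q.real B) : Q Bᶜ ≤ ENNReal.ofReal p := by
  have h1 : Q.real Bᶜ = 1 - Q.real B := probReal_compl_eq_one_sub hB
  have h2 : Q Bᶜ = ENNReal.ofReal (Q.real Bᶜ) := by simp [Measure.real]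
  rw [h2]
  exact ENNReal.ofReal_le_ofReal (by linarith)

/-- The hypothesis is used with `k = 1` on the translate of `η₁`. Translating the resulting path
back restores the marginal `E.P η₁`, and the good event is made explicit and measurable for use in
expectations. -/
theorem NoDriftIn.exists_coupling {ν : ℝ} (hE : E.MarkovInvariant) (h : E.NoDriftIn ν)
    (t H : ℕ) {η₁ η₂ : Config} {d : ℤ} (hc : CoversOn η₂ (η₁.translate d) H) :
    ∃ Q : Measure (EnvPath × EnvPath), IsCoupling Q (E.P η₁) (E.P η₂) ∧
      ∃ B, MeasurableSet B ∧ (∀ w ∈ B, ∀ s ≤ t, CoversOn (w.2 s) ((w.1 s).translate d)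
        (H - 2 * ν * t)) ∧ Q Bᶜ ≤ ENNReal.ofReal (20 * Real.exp (-(ν * t / 4))) := by
  obtain ⟨Q, hQ, hle⟩ := h t H 1 le_rfl η₂ (η₁.translate d) hc
  have := hQ.isProbabilityMeasure
  let B : Set (EnvPath × EnvPath) :=
    {w | ∀ s ≤ t, CoversOn (w.1 s) (w.2 s) (H - 2 * ν * ((1 : ℕ) : ℝ) * t)}
  have hB : MeasurableSet B := by
    simp only [B, Set.ofPred_forall]
    refine MeasurableSet.iInter fun s => MeasurableSet.iInter fun _ => ?_
    exact (measurableSet_coversOn _).preimage (f := fun w : EnvPath × EnvPath => (w.1 s, w.2 s))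
      (by fun_prop)
  let g : EnvPath × EnvPath → EnvPath × EnvPath := fun w => (w.2, w.1.translate d)
  have hg : Measurable g := by fun_prop
  have hm : Measurable fun w : EnvPath × EnvPath => (w.2.translate (-d), w.1) := by fun_prop
  refine ⟨_, hE.isCoupling_swap hQ, g ⁻¹' B, hg hB, ?_, ?_⟩
  · intro w hw s hs
    have h2 : CoversOn (w.2 s) ((w.1.translate d) s) (H - 2 * ν * ((1 : ℕ) : ℝ) * t) := hw s hs
    rw [Nat.cast_one, mul_one] at h2
    exact h2
  · rw [Measure.map_apply hm (hg hB).compl]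
    have h1 : (fun w : EnvPath × EnvPath => (w.2.translate (-d), w.1)) ⁻¹' (g ⁻¹' B)ᶜ = Bᶜ := by
      ext w
      simp [g, EnvPath.translate_translate, EnvPath.translate_zero]
    rw [h1]
    refine compl_le_of_le_real hB ?_
    have hle' : 1 - 20 * Real.exp (-((1 : ℕ) * ν * t / 4)) ≤ Q.real B := hle
    rwa [Nat.cast_one, one_mul] at hle'

/-- The covering property with its constants `C`, `C'` fixed. -/
def CoveringWith (E : Environment) (ν C C' : ℝ) : Prop :=
    ∀ ρ ∈ E.J, ∀ ε : ℝ, 0 < ε → ε < 1 → ρ + ε ∈ E.J →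
    ∀ H t : ℕ, 1 ≤ H → 1 ≤ t → 4 * ν * t < H → 1 < ν ^ 8 * t →
      C * (ε ^ 2)⁻¹ * (1 + |Real.log (ν * t) ^ 3|) < ν * (t : ℝ) ^ (1 / 4 : ℝ) →
    ∀ l : ℕ, l = ⌊(t : ℝ) ^ (1 / 4 : ℝ)⌋₊ →
    ∀ η₀ η₀' : Config,
      (∀ (a : ℤ) (m : ℕ), l / 2 ≤ m → m ≤ l → -(H : ℤ) ≤ a → a + m - 1 ≤ H →
        (ρ + 3 * ε / 4) * m ≤ particles η₀ a m ∧
        (particles η₀' a m : ℝ) ≤ (ρ + ε / 4) * m) →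
    ∃ Q : Measure (EnvPath × EnvPath), IsCoupling Q (E.P η₀) (E.P η₀') ∧
      1 - C' * t * H * Real.exp (-((C' * (1 + ν⁻¹))⁻¹ * ε ^ 2 * (t : ℝ) ^ (1 / 4 : ℝ))) ≤
        Q.real {w | CoversOn (w.1 t) (w.2 t) (H - 4 * ν * t)}

/-- On `[-H, H]`, the particle density on the scale `l` is at most `r`. -/
def Sparse (r : ℝ) (l H : ℕ) : Set Config :=
  {η | ∀ (a : ℤ) (m : ℕ), l / 2 ≤ m → m ≤ l → -(H : ℤ) ≤ a → a + m - 1 ≤ H →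
    (particles η a m : ℝ) ≤ r * m}

/-- On `[-H, H]`, the particle density on the scale `l` is at least `r`. -/
def Dense (r : ℝ) (l H : ℕ) : Set Config :=
  {η | ∀ (a : ℤ) (m : ℕ), l / 2 ≤ m → m ≤ l → -(H : ℤ) ≤ a → a + m - 1 ≤ H →
    r * m ≤ (particles η a m : ℝ)}

theorem measurableSet_sparse (r : ℝ) (l H : ℕ) : MeasurableSet (Sparse r l H) := by
  simp only [Sparse, Set.ofPred_forall]
  refine MeasurableSet.iInter fun a => MeasurableSet.iInter fun m => MeasurableSet.iInter fun _ =>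
    MeasurableSet.iInter fun _ => MeasurableSet.iInter fun _ => MeasurableSet.iInter fun _ => ?_
  exact measurableSet_le (measurable_from_nat.comp (measurable_particles a m)) measurable_const

theorem measurableSet_dense (r : ℝ) (l H : ℕ) : MeasurableSet (Dense r l H) := by
  simp only [Dense, Set.ofPred_forall]
  refine MeasurableSet.iInter fun a => MeasurableSet.iInter fun m => MeasurableSet.iInter fun _ =>
    MeasurableSet.iInter fun _ => MeasurableSet.iInter fun _ => MeasurableSet.iInter fun _ => ?_
  exact measurableSet_le measurable_const (measurable_from_nat.comp (measurable_particles a m))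

/-- The density bounds are required on the larger window `H'`, so they survive the translation by
`d`. This is what allows a shift between the two environments. -/
theorem CoveringWith.exists_coupling {ν C C' : ℝ} (hE : E.MarkovInvariant)
    (h : E.CoveringWith ν C C') {ρ ε : ℝ} (hρ : ρ ∈ E.J) (hε : 0 < ε) (hε1 : ε < 1)
    (hρε : ρ + ε ∈ E.J) {H t : ℕ} (hH : 1 ≤ H) (ht : 1 ≤ t) (htH : 4 * ν * t < H)
    (hνt : 1 < ν ^ 8 * t)
    (hC : C * (ε ^ 2)⁻¹ * (1 + |Real.log (ν * t) ^ 3|) < ν * (t : ℝ) ^ (1 / 4 : ℝ))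
    {H' : ℕ} {η₁ η₂ : Config} {d : ℤ} (hd : H + |d| ≤ H')
    (h₁ : η₁ ∈ Sparse (ρ + ε / 4) ⌊(t : ℝ) ^ (1 / 4 : ℝ)⌋₊ H')
    (h₂ : η₂ ∈ Dense (ρ + 3 * ε / 4) ⌊(t : ℝ) ^ (1 / 4 : ℝ)⌋₊ H') :
    ∃ Q : Measure (EnvPath × EnvPath), IsCoupling Q (E.P η₁) (E.P η₂) ∧
      ∃ B, MeasurableSet B ∧ (∀ w ∈ B, CoversOn (w.2 t) ((w.1 t).translate d) (H - 4 * ν * t)) ∧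
      Q Bᶜ ≤ ENNReal.ofReal (C' * t * H *
        Real.exp (-((C' * (1 + ν⁻¹))⁻¹ * ε ^ 2 * (t : ℝ) ^ (1 / 4 : ℝ)))) := by
  obtain ⟨Q, hQ, hle⟩ := h ρ hρ ε hε hε1 hρε H t hH ht htH hνt hC _ rfl η₂ (η₁.translate d) (by
    intro a m h1 h2 h3 h4
    have := neg_abs_le d
    have := le_abs_self d
    refine ⟨h₂ a m h1 h2 (by omega) (by omega), ?_⟩
    rw [particles_translate]
    exact h₁ (d + a) m h1 h2 (by omega) (by omega))
  have := hQ.isProbabilityMeasure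
  let B : Set (EnvPath × EnvPath) := {w | CoversOn (w.1 t) (w.2 t) (H - 4 * ν * t)}
  have hB : MeasurableSet B :=
    (measurableSet_coversOn _).preimage (f := fun w : EnvPath × EnvPath => (w.1 t, w.2 t))
      (by fun_prop)
  let g : EnvPath × EnvPath → EnvPath × EnvPath := fun w => (w.2, w.1.translate d)
  have hg : Measurable g := by fun_prop
  have hm : Measurable fun w : EnvPath × EnvPath => (w.2.translate (-d), w.1) := by fun_prop
  refine ⟨_, hE.isCoupling_swap hQ, g ⁻¹' B, hg hB, fun w hw => hw, ?_⟩
  rw [Measure.map_apply hm (hg hB).compl]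
  have h1 : (fun w : EnvPath × EnvPath => (w.2.translate (-d), w.1)) ⁻¹' (g ⁻¹' B)ᶜ = Bᶜ := by
    ext w
    simp [g, EnvPath.translate_translate, EnvPath.translate_zero]
  rw [h1]
  exact compl_le_of_le_real hB hle

end Environment

/-! ### Walks in a fixed environment -/

/-- The jump of the walk from a site with `a` particles, driven by `v`. -/
def jump (p₀ p₁ : ℝ) (a : ℕ) (v : unitInterval) : ℤ :=
  2 * (if (v : ℝ) ≤ (p₀ - p₁) * (if a = 0 then 1 else 0) + p₁ then 1 else 0) - 1

theorem jump_eq (p₀ p₁ : ℝ) (a : ℕ) (v : unitInterval) :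
    jump p₀ p₁ a v = 1 ∨ jump p₀ p₁ a v = -1 := by
  unfold jump; split_ifs <;> simp

/-- The threshold is `p₀` on an empty site and `p₁` on an occupied one, so for the same `v` more
particles can only turn a left jump into a right one. -/
theorem jump_mono {p₀ p₁ : ℝ} (hp : p₀ ≤ p₁) {a b : ℕ} (hab : a ≤ b) (v : unitInterval) :
    jump p₀ p₁ a v ≤ jump p₀ p₁ b v := by
  unfold jump
  by_cases hb : b = 0
  · have : a = 0 := by omega
    simp [hb, this]
  · by_cases ha : a = 0
    · simp only [ha, hb, if_true, if_false]
      split_ifs <;> first | simp; done | (simp; linarith)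
    · simp [ha, hb]

/-- The walk in the environment `ζ` that is at `x` at time `m`, where the environment is read from
time `0` on. -/
def traj (p₀ p₁ : ℝ) (u : ℕ → unitInterval) (m : ℕ) (x : ℤ) (ζ : EnvPath) : ℕ → ℤ
  | 0 => x
  | k + 1 => traj p₀ p₁ u m x ζ k + jump p₀ p₁ (ζ k (traj p₀ p₁ u m x ζ k)) (u (m + k))

theorem walk_eq_traj (p₀ p₁ : ℝ) (ζ : EnvPath) (u : ℕ → unitInterval) :
    walk p₀ p₁ ζ u = traj p₀ p₁ u 0 0 ζ := by
  funext n
  induction n with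
  | zero => rfl
  | succ n ih => simp only [walk, traj, ih, jump, zero_add]; ring

theorem traj_shift_index (p₀ p₁ : ℝ) (u : ℕ → unitInterval) (m : ℕ) (x : ℤ) (ζ : EnvPath) :
    traj p₀ p₁ u m x ζ = traj p₀ p₁ (fun k => u (m + k)) 0 x ζ := by
  funext n
  induction n with
  | zero => rfl
  | succ n ih => simp only [traj, ih, zero_add]

theorem traj_congr {p₀ p₁ : ℝ} {u : ℕ → unitInterval} {m : ℕ} {x : ℤ} {ζ ζ' : EnvPath} {T : ℕ}
    (h : ∀ k < T, ζ k = ζ' k) : ∀ k ≤ T, traj p₀ p₁ u m x ζ k = traj p₀ p₁ u m x ζ' k := by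
  intro k
  induction k with
  | zero => intro _; rfl
  | succ k ih =>
    intro hk
    simp only [traj, ih (by omega), h k (by omega)]

theorem traj_add (p₀ p₁ : ℝ) (u : ℕ → unitInterval) (m : ℕ) (x : ℤ) (ζ : EnvPath) (a k : ℕ) :
    traj p₀ p₁ u m x ζ (a + k) =
      traj p₀ p₁ u (m + a) (traj p₀ p₁ u m x ζ a) (ζ.shift a 0) k := by
  induction k with
  | zero => rfl
  | succ k ih =>
    rw [← add_assoc]
    simp only [traj, ← ih, EnvPath.shift, Config.translate_zero, add_assoc]

theorem measurable_traj (p₀ p₁ : ℝ) (m : ℕ) :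
    Measurable fun w : ((ℕ → unitInterval) × ℤ) × EnvPath => traj p₀ p₁ w.1.1 m w.1.2 w.2 := by
  refine measurable_pi_lambda _ fun n => ?_
  induction n with
  | zero => simp only [traj]; fun_prop
  | succ n ih =>
    simp only [traj]
    refine ih.add ?_
    have h1 : Measurable fun w : ((ℕ → unitInterval) × ℤ) × EnvPath =>
        w.2 n (traj p₀ p₁ w.1.1 m w.1.2 w.2 n) := by
      have h : Measurable (fun q : ℤ × (((ℕ → unitInterval) × ℤ) × EnvPath) => q.2.2 n q.1) :=
        measurable_from_prod_countable_right fun x =>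
          (measurable_pi_apply x).comp ((measurable_pi_apply n).comp measurable_snd)
      exact h.comp (ih.prodMk measurable_id)
    have h2 : Measurable fun w : ((ℕ → unitInterval) × ℤ) × EnvPath =>
        if w.2 n (traj p₀ p₁ w.1.1 m w.1.2 w.2 n) = 0 then (1 : ℝ) else 0 :=
      Measurable.ite (h1 (measurableSet_singleton 0)) measurable_const measurable_const
    unfold jump
    refine (Measurable.const_mul (Measurable.ite ?_ measurable_const measurable_const)
      2).sub_const 1
    refine measurableSet_le ?_ ((h2.const_mul _).add_const _)
    fun_prop

/-- Nearest-neighbour paths. -/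
def IsPath (h : ℕ → ℤ) : Prop := ∀ s, h (s + 1) - h s = 1 ∨ h (s + 1) - h s = -1

theorem isPath_traj (p₀ p₁ : ℝ) (u : ℕ → unitInterval) (m : ℕ) (x : ℤ) (ζ : EnvPath) :
    IsPath (traj p₀ p₁ u m x ζ) := by
  intro s
  simp only [traj, add_sub_cancel_left]
  exact jump_eq _ _ _ _

theorem IsPath.le {h : ℕ → ℤ} (hh : IsPath h) (m k : ℕ) :
    h m - k ≤ h (m + k) ∧ h (m + k) ≤ h m + k := by
  induction k with
  | zero => simp
  | succ k ih => have := hh (m + k); rw [← add_assoc]; push_cast; omega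

/-- Parity bookkeeping: walks at even distance cannot exchange their order without meeting. -/
theorem IsPath.dvd {h : ℕ → ℤ} (hh : IsPath h) (m k : ℕ) : (2 : ℤ) ∣ h (m + k) - h m - k := by
  induction k with
  | zero => simp
  | succ k ih => have := hh (m + k); rw [← add_assoc]; push_cast; omega

theorem IsPath.abs_le {h : ℕ → ℤ} (hh : IsPath h) (m k : ℕ) : |h (m + k)| ≤ |h m| + k := by
  have := hh.le m k
  rw [_root_.abs_le]
  have h1 := neg_abs_le (h m)
  have h2 := le_abs_self (h m)
  constructor <;> omega

/-- Ordered walks in ordered environments. -/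
theorem traj_sub_le_traj {p₀ p₁ : ℝ} (hp : p₀ ≤ p₁) (u : ℕ → unitInterval) (m : ℕ) {x₁ x₂ d : ℤ}
    {ζ₁ ζ₂ : EnvPath} {T : ℕ} {r : ℝ} (hx : x₁ - d ≤ x₂) (hpar : (2 : ℤ) ∣ x₂ - (x₁ - d))
    (hr : (|x₂| : ℤ) + (T : ℝ) ≤ r)
    (hc : ∀ s < T, CoversOn (ζ₂ s) ((ζ₁ s).translate d) r) :
    ∀ k ≤ T, traj p₀ p₁ u m x₁ ζ₁ k - d ≤ traj p₀ p₁ u m x₂ ζ₂ k := by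
  intro k
  induction k with
  | zero => intro _; exact hx
  | succ k ih =>
    intro hk
    have ih := ih (by omega)
    have p1 := (isPath_traj p₀ p₁ u m x₁ ζ₁).dvd 0 k
    have p2 := (isPath_traj p₀ p₁ u m x₂ ζ₂).dvd 0 k
    have s1 := isPath_traj p₀ p₁ u m x₁ ζ₁ k
    have s2 := isPath_traj p₀ p₁ u m x₂ ζ₂ k
    have b2 := (isPath_traj p₀ p₁ u m x₂ ζ₂).abs_le 0 k
    simp only [zero_add] at p1 p2 b2
    simp only [traj] at p1 p2 b2
    -- By parity the gap is `0` or at least `2`. At gap `0` the walks read corresponding sites,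
    -- still inside the window, where the environments are ordered. Otherwise one step reduces the
    -- gap by at most `2`.
    rcases eq_or_lt_of_le ih with heq | hlt
    · have hb : ((|traj p₀ p₁ u m x₂ ζ₂ k| : ℤ) : ℝ) ≤ r := by
        have : ((|traj p₀ p₁ u m x₂ ζ₂ k| : ℤ) : ℝ) ≤ (|x₂| : ℤ) + (k : ℝ) := by exact_mod_cast b2
        have hk' : (k : ℝ) ≤ T := by exact_mod_cast (by omega : k ≤ T)
        linarith
      rw [Int.cast_abs, abs_le] at hb
      have := hc k (by omega) _ hb.1 hb.2
      have hj := jump_mono hp this (u (m + k))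
      rw [Config.translate, ← heq] at hj
      simp only [add_sub_cancel] at hj
      simp only [traj, ← heq] at hj ⊢
      linarith
    · omega

/-- Follow the path `h` up to time `m`, and then the walk in the environment `ζ`. -/
def extendPath (p₀ p₁ : ℝ) (u : ℕ → unitInterval) (m : ℕ) (h : ℕ → ℤ) (ζ : EnvPath) : ℕ → ℤ :=
  fun s => if s ≤ m then h s else traj p₀ p₁ u m (h m) ζ (s - m)

section extendPath

variable {p₀ p₁ : ℝ} {u : ℕ → unitInterval} {m : ℕ} {h : ℕ → ℤ} {ζ : EnvPath}

theorem extendPath_of_le {s : ℕ} (hs : s ≤ m) : extendPath p₀ p₁ u m h ζ s = h s := if_pos hs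

theorem extendPath_add (k : ℕ) :
    extendPath p₀ p₁ u m h ζ (m + k) = traj p₀ p₁ u m (h m) ζ k := by
  unfold extendPath
  rcases Nat.eq_zero_or_pos k with rfl | hk
  · simp [traj]
  · rw [if_neg (by omega)]; simp

theorem IsPath.extendPath (hh : IsPath h) : IsPath (extendPath p₀ p₁ u m h ζ) := by
  intro s
  rcases lt_or_ge s m with hs | hs
  · rw [extendPath_of_le (by omega), extendPath_of_le (by omega)]; exact hh s
  · obtain ⟨k, rfl⟩ := Nat.exists_eq_add_of_le hs
    rw [add_assoc, extendPath_add, extendPath_add]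
    exact isPath_traj p₀ p₁ u m (h m) ζ k

theorem extendPath_congr {h' : ℕ → ℤ} (hh : ∀ s ≤ m, h s = h' s) :
    extendPath p₀ p₁ u m h ζ = extendPath p₀ p₁ u m h' ζ := by
  funext s
  unfold _root_.extendPath
  rw [hh m le_rfl]
  split_ifs with hs
  · exact hh s hs
  · rfl

/-- Flow property: stopping at time `m + a` and restarting in the shifted environment gives the same
path. With the Markov property it yields `stageValue_add`. -/
theorem extendPath_extendPath (a : ℕ) :
    extendPath p₀ p₁ u (m + a) (extendPath p₀ p₁ u m h ζ) (ζ.shift a 0) =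
      extendPath p₀ p₁ u m h ζ := by
  funext s
  rcases le_or_gt s (m + a) with hs | hs
  · exact extendPath_of_le hs
  · obtain ⟨k, rfl⟩ := Nat.exists_eq_add_of_le hs.le
    rw [extendPath_add, extendPath_add, ← traj_add, add_assoc, extendPath_add]

theorem extendPath_congr_env {ζ' : EnvPath} {a : ℕ} (hζ : ∀ k < a, ζ k = ζ' k) :
    ∀ s ≤ m + a, extendPath p₀ p₁ u m h ζ s = extendPath p₀ p₁ u m h ζ' s := by
  intro s hs
  rcases le_or_gt s m with hsm | hsm
  · rw [extendPath_of_le hsm, extendPath_of_le hsm]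
  · obtain ⟨k, rfl⟩ := Nat.exists_eq_add_of_le hsm.le
    rw [extendPath_add, extendPath_add]
    exact traj_congr hζ k (by omega)

theorem measurable_extendPath (p₀ p₁ : ℝ) (u : ℕ → unitInterval) (m : ℕ) :
    Measurable fun w : (ℕ → ℤ) × EnvPath => extendPath p₀ p₁ u m w.1 w.2 := by
  refine measurable_pi_lambda _ fun s => ?_
  unfold extendPath
  split_ifs with hs
  · fun_prop
  · have := (measurable_pi_apply (s - m)).comp ((measurable_traj p₀ p₁ m).comp
      (f := fun w : (ℕ → ℤ) × EnvPath => (((u, w.1 m) : (ℕ → unitInterval) × ℤ), w.2))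
      (by fun_prop))
    exact this

end extendPath

/-! ### Value functions over one block -/

namespace Environment

/-- The expectation of `G` (a function of the path of the walk and of the final environment) over
`T` further time units, given the path `h` up to time `m` and the environment `η` at time `m`. -/
def stageValue (E : Environment) (p₀ p₁ : ℝ) (u : ℕ → unitInterval) (T m : ℕ)
    (G : (ℕ → ℤ) → Config → ℝ≥0∞) (h : ℕ → ℤ) (η : Config) : ℝ≥0∞ :=
  ∫⁻ ζ, G (extendPath p₀ p₁ u m h ζ) (ζ T) ∂(E.P η)

variable {E : Environment} {p₀ p₁ : ℝ} {u : ℕ → unitInterval}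

theorem measurable_stageValue {T m : ℕ} {G : (ℕ → ℤ) → Config → ℝ≥0∞}
    (hG : Measurable (Function.uncurry G)) :
    Measurable (Function.uncurry (E.stageValue p₀ p₁ u T m G)) := by
  have h1 : Measurable fun w : ((ℕ → ℤ) × Config) × EnvPath =>
      Function.uncurry G (extendPath p₀ p₁ u m w.1.1 w.2, w.2 T) := by
    refine hG.comp (Measurable.prodMk ?_ (by fun_prop))
    exact (measurable_extendPath p₀ p₁ u m).comp
      (f := fun w : ((ℕ → ℤ) × Config) × EnvPath => (w.1.1, w.2)) (by fun_prop)
  exact Measurable.lintegral_kernel_prod_right' (κ := E.P.comap Prod.snd measurable_snd) h1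

theorem measurable_extendPath_apply {T m : ℕ} {G : (ℕ → ℤ) → Config → ℝ≥0∞}
    (hG : Measurable (Function.uncurry G)) (h : ℕ → ℤ) :
    Measurable fun ζ : EnvPath => G (extendPath p₀ p₁ u m h ζ) (ζ T) := by
  refine hG.comp (Measurable.prodMk ?_ (by fun_prop))
  exact (measurable_extendPath p₀ p₁ u m).comp
      (f := fun w : EnvPath => (h, w)) (by fun_prop)

theorem stageValue_le_one {T m : ℕ} {G : (ℕ → ℤ) → Config → ℝ≥0∞} (hG : ∀ h η, G h η ≤ 1)
    (h : ℕ → ℤ) (η : Config) : E.stageValue p₀ p₁ u T m G h η ≤ 1 := by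
  calc _ ≤ ∫⁻ _, 1 ∂(E.P η) := lintegral_mono fun ζ => hG _ _
    _ = 1 := by simp

/-- For fixed driving variables, the pair of the path so far and the current environment is Markov;
this is conditioning at time `a`. -/
theorem MarkovInvariant.stageValue_add (hE : E.MarkovInvariant) {a b m : ℕ}
    {G : (ℕ → ℤ) → Config → ℝ≥0∞} (hG : Measurable (Function.uncurry G)) (h : ℕ → ℤ)
    (η : Config) :
    E.stageValue p₀ p₁ u (a + b) m G h η =
      E.stageValue p₀ p₁ u a m (E.stageValue p₀ p₁ u b (m + a) G) h η := by
  let Φ : EnvPath × EnvPath → ℝ≥0∞ := fun w =>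
    G (extendPath p₀ p₁ u (m + a) (extendPath p₀ p₁ u m h w.1) w.2) (w.2 b)
  have hΦ : Measurable Φ := by
    refine hG.comp (Measurable.prodMk ?_ (by fun_prop))
    refine (measurable_extendPath p₀ p₁ u (m + a)).comp
      (f := fun w : EnvPath × EnvPath => (extendPath p₀ p₁ u m h w.1, w.2))
      (Measurable.prodMk ?_ measurable_snd)
    exact (measurable_extendPath p₀ p₁ u m).comp
      (f := fun w : EnvPath × EnvPath => (h, w.1)) (by fun_prop)
  -- The path up to time `m + a` reads the environment only at its times before `a`.
  have hfreeze : ∀ (ζ ξ : EnvPath), Φ (ζ.freeze a, ξ) = Φ (ζ, ξ) := by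
    intro ζ ξ
    simp only [Φ]
    rw [extendPath_congr (h' := extendPath p₀ p₁ u m h ζ)]
    refine extendPath_congr_env fun k hk => ?_
    simp [EnvPath.freeze, hk.le]
  have := hE.lintegral_eq a η hΦ
  simp only [hfreeze] at this
  unfold stageValue
  rw [← this]
  refine lintegral_congr fun ζ => ?_
  simp only [Φ, extendPath_extendPath]
  simp [EnvPath.shift, Config.translate_zero]

/-- Comparison of two walks over a stage that starts with ordered environments. -/
theorem NoDriftIn.stageValue_le {ν : ℝ} (hE : E.MarkovInvariant) (hC : E.NoDriftIn ν)
    (hp : p₀ ≤ p₁) {t T m N M : ℕ} {d : ℤ} {η₁ η₂ : Config} (hc : CoversOn η₂ (η₁.translate d) M)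
    {h₁ h₂ : ℕ → ℤ} (hx : h₁ m - d ≤ h₂ m) (hpar : (2 : ℤ) ∣ h₂ m - (h₁ m - d))
    (hN : |h₂ m| + T ≤ N) (hT : T ≤ t) (hM : (N : ℝ) ≤ M - 2 * ν * t)
    {G₁ G₂ : (ℕ → ℤ) → Config → ℝ≥0∞} {e₁ e₂ : Config → ℝ≥0∞}
    (hG₁ : Measurable (Function.uncurry G₁)) (hG₂ : Measurable (Function.uncurry G₂))
    (he₁ : Measurable e₁) (he₂ : Measurable e₂) (h1 : ∀ h η, G₁ h η ≤ 1)
    (hle : ∀ ζ₁ ζ₂ : EnvPath,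
      (∀ k ≤ T, traj p₀ p₁ u m (h₁ m) ζ₁ k - d ≤ traj p₀ p₁ u m (h₂ m) ζ₂ k) →
      G₁ (extendPath p₀ p₁ u m h₁ ζ₁) (ζ₁ T) ≤
        G₂ (extendPath p₀ p₁ u m h₂ ζ₂) (ζ₂ T) + e₁ (ζ₁ T) + e₂ (ζ₂ T)) :
    E.stageValue p₀ p₁ u T m G₁ h₁ η₁ ≤ E.stageValue p₀ p₁ u T m G₂ h₂ η₂ +
      ∫⁻ ζ, e₁ (ζ T) ∂(E.P η₁) + ∫⁻ ζ, e₂ (ζ T) ∂(E.P η₂) +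
      ENNReal.ofReal (20 * Real.exp (-(ν * t / 4))) := by
  obtain ⟨Q, hQ, B, hB, hcov, hQB⟩ := hC.exists_coupling hE t M hc
  have hf1 := measurable_extendPath_apply (p₀ := p₀) (p₁ := p₁) (u := u) (m := m) (T := T) hG₁ h₁
  have hf2 := measurable_extendPath_apply (p₀ := p₀) (p₁ := p₁) (u := u) (m := m) (T := T) hG₂ h₂
  have he₁' : Measurable fun ζ : EnvPath => e₁ (ζ T) := he₁.comp (measurable_pi_apply T)
  have he₂' : Measurable fun ζ : EnvPath => e₂ (ζ T) := he₂.comp (measurable_pi_apply T)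
  have key := hQ.lintegral_le hf1 he₁' (hf2.add he₂') (fun ζ => h1 _ _) hB (fun w hw => by
    refine (hle w.1 w.2 ?_).trans_eq (by simp only [Pi.add_apply]; ring)
    refine traj_sub_le_traj hp u m hx hpar (r := N) (by exact_mod_cast hN) fun s hs => ?_
    exact (hcov w hw s (by omega)).mono hM)
  simp only [Pi.add_apply] at key
  rw [lintegral_add_left hf2] at key
  unfold stageValue
  refine key.trans ?_
  rw [add_right_comm (∫⁻ ζ, G₂ (extendPath p₀ p₁ u m h₂ ζ) (ζ T) ∂(E.P η₂))
    (∫⁻ ζ, e₂ (ζ T) ∂(E.P η₂))]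
  gcongr

end Environment

theorem IsCoupling.lintegral_le_of_ae {α β : Type*} [MeasurableSpace α] [MeasurableSpace β]
    {Q : Measure (α × β)} {μ : Measure α} {ν : Measure β}
    (h : IsCoupling Q μ ν) {f e : α → ℝ≥0∞} {g : β → ℝ≥0∞} (hf : Measurable f)
    (he : Measurable e) (hg : Measurable g) (hle : ∀ᵐ w ∂Q, f w.1 ≤ g w.2 + e w.1) :
    ∫⁻ a, f a ∂μ ≤ ∫⁻ b, g b ∂ν + ∫⁻ a, e a ∂μ := by
  rw [← h.1, ← h.2, lintegral_map hf measurable_fst, lintegral_map hg measurable_snd,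
    lintegral_map he measurable_fst,
    ← lintegral_add_right _ (by fun_prop : Measurable fun w : α × β => e w.1)]
  exact lintegral_mono_ae hle

theorem isCoupling_prod {α β : Type*} [MeasurableSpace α] [MeasurableSpace β]
    (μ : Measure α) (ν : Measure β) [IsProbabilityMeasure μ] [IsProbabilityMeasure ν] :
    IsCoupling (μ.prod ν) μ ν := by
  constructor
  · rw [Measure.map_fst_prod]; simp
  · rw [Measure.map_snd_prod]; simp

namespace Environment

variable {E : Environment} {p₀ p₁ : ℝ} {u : ℕ → unitInterval}

/-- The relations between the parameters of a coupling over one block: the block length `L`, the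
covering time `t`, the range `N` of the walks, and the sizes `M ≤ H` of the windows in which the
environments are compared. -/
structure Scale (E : Environment) (ν C ρ δ : ℝ) (L t N M H : ℕ) : Prop where
  rho_mem : ρ ∈ E.J
  pos : 0 < δ
  lt_one : δ < 1
  rho_add_mem : ρ + δ ∈ E.J
  one_le : 1 ≤ t
  le_block : t ≤ L
  one_le_window : 1 ≤ H
  window : 4 * ν * t < H
  large : 1 < ν ^ 8 * t
  covering : C * (δ ^ 2)⁻¹ * (1 + |Real.log (ν * t) ^ 3|) < ν * (t : ℝ) ^ (1 / 4 : ℝ)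
  window_stage : (M : ℝ) ≤ H - 4 * ν * t
  window_block : (N : ℝ) ≤ M - 2 * ν * L

/-- The probability that the coupling over a block fails. -/
def blockError (ν C' δ : ℝ) (L t H : ℕ) : ℝ≥0∞ :=
  ENNReal.ofReal (C' * t * H *
    Real.exp (-((C' * (1 + ν⁻¹))⁻¹ * δ ^ 2 * (t : ℝ) ^ (1 / 4 : ℝ)))) +
  ENNReal.ofReal (20 * Real.exp (-(ν * L / 4)))

/-- The block is split at time `t`. First the covering coupling runs in the frame of shift `d + 2 *
t`, while the walks are controlled only by their unit speed. Then walks and environments are both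
ordered in this frame, and the no-drift coupling preserves this. The functions `e₁`, `e₂` transport
the errors of later blocks. -/
theorem Scale.stageValue_le {ν C C' ρ δ : ℝ} {L t N M H : ℕ} (S : E.Scale ν C ρ δ L t N M H)
    (hE : E.MarkovInvariant) (hN : E.NoDriftIn ν) (hC : E.CoveringWith ν C C')
    (hp : p₀ ≤ p₁) {m H' : ℕ} {d : ℤ} {h₁ h₂ : ℕ → ℤ} {η₁ η₂ : Config}
    (P₁ : IsPath h₁) (P₂ : IsPath h₂)
    (hx : h₁ m - d ≤ h₂ m) (hpar : (2 : ℤ) ∣ h₂ m - (h₁ m - d)) (hrange : |h₂ m| + L ≤ N)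
    (hd : H + |d + 2 * t| ≤ H')
    (g₁ : η₁ ∈ Sparse (ρ + δ / 4) ⌊(t : ℝ) ^ (1 / 4 : ℝ)⌋₊ H')
    (g₂ : η₂ ∈ Dense (ρ + 3 * δ / 4) ⌊(t : ℝ) ^ (1 / 4 : ℝ)⌋₊ H')
    {G₁ G₂ : (ℕ → ℤ) → Config → ℝ≥0∞} {e₁ e₂ : Config → ℝ≥0∞}
    (hG₁ : Measurable (Function.uncurry G₁)) (hG₂ : Measurable (Function.uncurry G₂))
    (he₁ : Measurable e₁) (he₂ : Measurable e₂) (h1 : ∀ h η, G₁ h η ≤ 1)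
    (hle : ∀ (h₁' h₂' : ℕ → ℤ) (η₁' η₂' : Config), IsPath h₁' → IsPath h₂' →
      (∀ s ≤ m, h₁' s = h₁ s) → (∀ s ≤ m, h₂' s = h₂ s) →
      (∀ k ≤ L, h₁' (m + k) - (d + 2 * t) ≤ h₂' (m + k)) →
      G₁ h₁' η₁' ≤ G₂ h₂' η₂' + e₁ η₁' + e₂ η₂') :
    E.stageValue p₀ p₁ u L m G₁ h₁ η₁ ≤ E.stageValue p₀ p₁ u L m G₂ h₂ η₂ +
      ∫⁻ ζ, e₁ (ζ L) ∂(E.P η₁) + ∫⁻ ζ, e₂ (ζ L) ∂(E.P η₂) + blockError ν C' δ L t H := by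
  obtain ⟨T, rfl⟩ := Nat.exists_eq_add_of_le S.le_block
  have me : ∀ {e : Config → ℝ≥0∞}, Measurable e →
      Measurable (Function.uncurry fun (_ : ℕ → ℤ) η => e η) := fun h => h.comp measurable_snd
  have hsplit : ∀ {e : Config → ℝ≥0∞} (η : Config), Measurable e →
      ∫⁻ ζ, e (ζ (t + T)) ∂(E.P η) = ∫⁻ ζ, ∫⁻ ξ, e (ξ T) ∂(E.P (ζ t)) ∂(E.P η) :=
    fun η h => hE.stageValue_add (p₀ := p₀) (p₁ := p₁) (u := u) (m := m) (me h) h₁ η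
  have msplit : ∀ {e : Config → ℝ≥0∞}, Measurable e →
      Measurable fun ζ : EnvPath => ∫⁻ ξ, e (ξ T) ∂(E.P (ζ t)) := by
    intro e h
    exact (Measurable.lintegral_kernel (κ := E.P) (h.comp (measurable_pi_apply T))).comp
      (measurable_pi_apply t)
  rw [hE.stageValue_add hG₁, hE.stageValue_add hG₂, hsplit _ he₁, hsplit _ he₂]
  obtain ⟨Q, hQ, B, hB, hcov, hQB⟩ := hC.exists_coupling hE S.rho_mem S.pos S.lt_one S.rho_add_mem
    S.one_le_window S.one_le S.window S.large S.covering hd g₁ g₂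
  have mf₁ := measurable_extendPath_apply (p₀ := p₀) (p₁ := p₁) (u := u) (m := m) (T := t)
    (measurable_stageValue (E := E) (p₀ := p₀) (p₁ := p₁) (u := u) (m := m + t) (T := T) hG₁) h₁
  have mf₂ := measurable_extendPath_apply (p₀ := p₀) (p₁ := p₁) (u := u) (m := m) (T := t)
    (measurable_stageValue (E := E) (p₀ := p₀) (p₁ := p₁) (u := u) (m := m + t) (T := T) hG₂) h₂
  have key := hQ.lintegral_le mf₁ (msplit he₁) ((mf₂.add (msplit he₂)).add_const
    (ENNReal.ofReal (20 * Real.exp (-(ν * (t + T : ℕ) / 4)))))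
    (fun ζ => stageValue_le_one h1 _ _) hB (fun w hw => by
      have q₁ := P₁.extendPath (p₀ := p₀) (p₁ := p₁) (u := u) (m := m) (ζ := w.1)
      have q₂ := P₂.extendPath (p₀ := p₀) (p₁ := p₁) (u := u) (m := m) (ζ := w.2)
      have a₁ : ∀ s ≤ m, extendPath p₀ p₁ u m h₁ w.1 s = h₁ s := fun s hs => extendPath_of_le hs
      have a₂ : ∀ s ≤ m, extendPath p₀ p₁ u m h₂ w.2 s = h₂ s := fun s hs => extendPath_of_le hs
      have b₁ := a₁ m le_rfl
      have b₂ := a₂ m le_rfl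
      set k₁ := extendPath p₀ p₁ u m h₁ w.1
      set k₂ := extendPath p₀ p₁ u m h₂ w.2
      -- The no-drift coupling is taken over the horizon `t + T = L`, although only `T` units
      -- remain, so that its error is `20 * exp (-(ν * L / 4))` however small `T` is.
      have key := hN.stageValue_le (u := u) hE hp (t := t + T) (T := T) (m := m + t) (N := N)
        (d := d + 2 * t) (h₁ := k₁) (h₂ := k₂) ((hcov w hw).mono S.window_stage)
        (by have := q₁.le m t; have := q₂.le m t; omega)
        (by have := q₁.dvd m t; have := q₂.dvd m t; omega)
        (by have := q₂.abs_le m t; rw [b₂] at this; push_cast at hrange; omega)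
        (by omega) S.window_block hG₁ hG₂ he₁ he₂ h1 (fun ζ₁ ζ₂ hζ => by
          refine hle _ _ _ _ q₁.extendPath q₂.extendPath (fun s hs => ?_) (fun s hs => ?_)
            fun k hk => ?_
          · rw [extendPath_of_le (by omega), a₁ s hs]
          · rw [extendPath_of_le (by omega), a₂ s hs]
          · rcases le_or_gt k t with hkt | hkt
            · rw [extendPath_of_le (by omega), extendPath_of_le (by omega)]
              have := q₁.le m k
              have := q₂.le m k
              omega
            · obtain ⟨k', rfl⟩ := Nat.exists_eq_add_of_le hkt.le
              rw [← add_assoc, extendPath_add, extendPath_add]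
              exact hζ k' (by omega))
      refine key.trans_eq ?_
      simp only [Pi.add_apply]
      ring)
  simp only [Pi.add_apply] at key
  rw [lintegral_add_right _ measurable_const, lintegral_add_left mf₂, lintegral_const,
    measure_univ, mul_one] at key
  unfold stageValue blockError at *
  refine key.trans ?_
  calc _ ≤ _ := add_le_add_right hQB _
    _ = _ := by ring

theorem stageValue_add_const {L m : ℕ} (G : (ℕ → ℤ) → Config → ℝ≥0∞) (c : ℝ≥0∞) (h : ℕ → ℤ)
    (η : Config) :
    E.stageValue p₀ p₁ u L m (fun h η => G h η + c) h η = E.stageValue p₀ p₁ u L m G h η + c := by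
  unfold stageValue
  rw [lintegral_add_right _ measurable_const, lintegral_const, measure_univ, mul_one]

/-! ### Chains of blocks -/

/-- The expectation of `F` (a function of the path of the walk) over `j` further blocks of length
`L`, where the environment is updated by `κ` at the start of every block. -/
def chainValue (E : Environment) (p₀ p₁ : ℝ) (u : ℕ → unitInterval) (L : ℕ)
    (κ : Kernel Config Config) (F : (ℕ → ℤ) → ℝ≥0∞) : ℕ → ℕ → (ℕ → ℤ) → Config → ℝ≥0∞
  | 0, _ => fun h _ => F h
  | j + 1, m => fun h η =>
      ∫⁻ η', E.stageValue p₀ p₁ u L m (chainValue E p₀ p₁ u L κ F j (m + L)) h η' ∂(κ η)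

/-- The expected number of the next `j` blocks that start with an environment in `bad`. -/
def chainError (E : Environment) (L : ℕ) (κ : Kernel Config Config) (bad : Set Config) :
    ℕ → Config → ℝ≥0∞
  | 0 => fun _ => 0
  | j + 1 => fun η =>
      ∫⁻ η', (bad.indicator 1 η' + ∫⁻ ζ, chainError E L κ bad j (ζ L) ∂(E.P η')) ∂(κ η)

theorem measurable_chainValue {L : ℕ} {κ : Kernel Config Config} [IsMarkovKernel κ]
    {F : (ℕ → ℤ) → ℝ≥0∞} (hF : Measurable F) (j m : ℕ) :
    Measurable (Function.uncurry (E.chainValue p₀ p₁ u L κ F j m)) := by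
  induction j generalizing m with
  | zero => exact hF.comp measurable_fst
  | succ j ih =>
    have h1 : Measurable fun w : ((ℕ → ℤ) × Config) × Config => Function.uncurry
        (E.stageValue p₀ p₁ u L m (E.chainValue p₀ p₁ u L κ F j (m + L))) (w.1.1, w.2) :=
      (measurable_stageValue (ih (m + L))).comp (by fun_prop)
    exact Measurable.lintegral_kernel_prod_right' (κ := κ.comap Prod.snd measurable_snd) h1

theorem chainValue_le_one {L : ℕ} {κ : Kernel Config Config} [IsMarkovKernel κ]
    {F : (ℕ → ℤ) → ℝ≥0∞} (hF : ∀ h, F h ≤ 1) (j m : ℕ) (h : ℕ → ℤ) (η : Config) :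
    E.chainValue p₀ p₁ u L κ F j m h η ≤ 1 := by
  induction j generalizing m h η with
  | zero => exact hF h
  | succ j ih =>
    calc _ ≤ ∫⁻ _, 1 ∂(κ η) := lintegral_mono fun η' => stageValue_le_one (ih (m + L)) h η'
      _ = 1 := by simp

theorem measurable_chainError {L : ℕ} {κ : Kernel Config Config} [IsMarkovKernel κ]
    {bad : Set Config} (hbad : MeasurableSet bad) (j : ℕ) :
    Measurable (E.chainError L κ bad j) := by
  induction j with
  | zero => exact measurable_const
  | succ j ih =>
    exact Measurable.lintegral_kernel ((measurable_one.indicator hbad).add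
      (Measurable.lintegral_kernel (ih.comp (measurable_pi_apply L))))

/-- Both the update `κ` and the dynamics over a block preserve `E.μ ρ`, so every block start has
this law. Independence of the blocks plays no role. -/
theorem Stationary.lintegral_chainError (hS : E.Stationary) {ρ : ℝ} (hρ : ρ ∈ E.J) {L : ℕ}
    {κ : Kernel Config Config} [IsMarkovKernel κ]
    (hκ : ∀ g : Config → ℝ≥0∞, Measurable g →
      ∫⁻ η, ∫⁻ η', g η' ∂(κ η) ∂(E.μ ρ) = ∫⁻ η, g η ∂(E.μ ρ))
    {bad : Set Config} (hbad : MeasurableSet bad) (j : ℕ) :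
    ∫⁻ η, E.chainError L κ bad j η ∂(E.μ ρ) = j * E.μ ρ bad := by
  induction j with
  | zero => simp [chainError]
  | succ j ih =>
    have m1 : Measurable (bad.indicator (1 : Config → ℝ≥0∞)) := measurable_one.indicator hbad
    simp only [chainError]
    have m2 : Measurable fun η' => ∫⁻ ζ, E.chainError L κ bad j (ζ L) ∂(E.P η') :=
      Measurable.lintegral_kernel ((measurable_chainError hbad j).comp (measurable_pi_apply L))
    rw [hκ (fun η' => bad.indicator 1 η' + ∫⁻ ζ, E.chainError L κ bad j (ζ L) ∂(E.P η'))
      (m1.add m2), lintegral_add_left m1,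
      lintegral_indicator_one hbad, hS.lintegral_eq hρ L (measurable_chainError hbad j), ih]
    push_cast
    ring

/-- A bound valid for every pair of configurations can be integrated against the independent
coupling. -/
theorem lintegral_le_of_forall_le {μ ν : Measure Config} [IsProbabilityMeasure μ]
    [IsProbabilityMeasure ν] {f e g g' : Config → ℝ≥0∞} (hf : Measurable f) (he : Measurable e)
    (hg : Measurable g) (hg' : Measurable g') (c : ℝ≥0∞)
    (h : ∀ η η', f η ≤ g η' + e η + g' η' + c) :
    ∫⁻ η, f η ∂μ ≤ ∫⁻ η, g η ∂ν + ∫⁻ η, e η ∂μ + ∫⁻ η, g' η ∂ν + c := by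
  have key := (isCoupling_prod μ ν).lintegral_le_of_ae hf he ((hg.add hg').add_const c)
    (Filter.Eventually.of_forall fun w => (h w.1 w.2).trans_eq (by simp only [Pi.add_apply]; ring))
  simp only [Pi.add_apply] at key
  rw [lintegral_add_right _ measurable_const, lintegral_add_left hg, lintegral_const,
    measure_univ, mul_one] at key
  exact key.trans_eq (by ring)

/-- Backward induction. A bad block start is paid for by `1`, which bounds the values. Otherwise the
block estimate applies, with the value of the remaining blocks plus their constant error as terminal
function. Since it holds for all pairs of good configurations, the updates `κ₁` and `κ₂` may be
taken independently. The allowed gap `d` grows by `2 * t`, so inequalities for the past persist. -/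
theorem Scale.chainValue_le {ν C C' ρ δ : ℝ} {L t N M H : ℕ} (S : E.Scale ν C ρ δ L t N M H)
    (hE : E.MarkovInvariant) (hN : E.NoDriftIn ν) (hC : E.CoveringWith ν C C')
    (hp : p₀ ≤ p₁) {κ₁ κ₂ : Kernel Config Config} [IsMarkovKernel κ₁] [IsMarkovKernel κ₂]
    {H' : ℕ} {F₁ F₂ : (ℕ → ℤ) → ℝ≥0∞} (hF₁ : Measurable F₁) (hF₂ : Measurable F₂)
    (h1 : ∀ h, F₁ h ≤ 1) (j : ℕ) : ∀ {m : ℕ} {d : ℤ} {h₁ h₂ : ℕ → ℤ} (η₁ η₂ : Config),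
    IsPath h₁ → IsPath h₂ → (∀ s ≤ m, h₁ s - d ≤ h₂ s) → (2 : ℤ) ∣ h₂ m - (h₁ m - d) →
    h₂ 0 = 0 → m + j * L ≤ N → 0 ≤ d → H + (d + 2 * t * j) ≤ H' →
    (∀ h₁' h₂' : ℕ → ℤ, (∀ s ≤ m + j * L, h₁' s - (d + 2 * t * j) ≤ h₂' s) → F₁ h₁' ≤ F₂ h₂') →
    E.chainValue p₀ p₁ u L κ₁ F₁ j m h₁ η₁ ≤ E.chainValue p₀ p₁ u L κ₂ F₂ j m h₂ η₂ +
      E.chainError L κ₁ (Sparse (ρ + δ / 4) ⌊(t : ℝ) ^ (1 / 4 : ℝ)⌋₊ H')ᶜ j η₁ +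
      E.chainError L κ₂ (Dense (ρ + 3 * δ / 4) ⌊(t : ℝ) ^ (1 / 4 : ℝ)⌋₊ H')ᶜ j η₂ +
      j * blockError ν C' δ L t H := by
  induction j with
  | zero =>
    intro m d h₁ h₂ η₁ η₂ _ _ hle _ _ _ _ _ hF
    simp only [chainValue, chainError]
    refine (hF h₁ h₂ (by simpa using hle)).trans ?_
    simp
  | succ j ih =>
    intro m d h₁ h₂ η₁ η₂ P₁ P₂ hle hpar h0 hm hd hH hF
    have hm' : m + L + j * L ≤ N := by linarith [add_mul j 1 L]
    have mS := (measurableSet_sparse (ρ + δ / 4) ⌊(t : ℝ) ^ (1 / 4 : ℝ)⌋₊ H').compl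
    have mD := (measurableSet_dense (ρ + 3 * δ / 4) ⌊(t : ℝ) ^ (1 / 4 : ℝ)⌋₊ H').compl
    set bad₁ := (Sparse (ρ + δ / 4) ⌊(t : ℝ) ^ (1 / 4 : ℝ)⌋₊ H')ᶜ with hbad₁
    set bad₂ := (Dense (ρ + 3 * δ / 4) ⌊(t : ℝ) ^ (1 / 4 : ℝ)⌋₊ H')ᶜ with hbad₂
    have mW₁ := measurable_chainValue (E := E) (p₀ := p₀) (p₁ := p₁) (u := u) (L := L) (κ := κ₁)
      hF₁ j (m + L)
    have mW₂ := measurable_chainValue (E := E) (p₀ := p₀) (p₁ := p₁) (u := u) (L := L) (κ := κ₂)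
      hF₂ j (m + L)
    have mE₁ := measurable_chainError (E := E) (L := L) (κ := κ₁) mS j
    have mE₂ := measurable_chainError (E := E) (L := L) (κ := κ₂) mD j
    have mI : ∀ {bad : Set Config} {e : Config → ℝ≥0∞}, MeasurableSet bad → Measurable e →
        Measurable fun η' => bad.indicator (1 : Config → ℝ≥0∞) η' + ∫⁻ ζ, e (ζ L) ∂(E.P η') :=
      fun hb he => (measurable_one.indicator hb).add
        (Measurable.lintegral_kernel (he.comp (measurable_pi_apply L)))
    simp only [chainValue, chainError]
    refine (lintegral_le_of_forall_le (ν := κ₂ η₂)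
      ((measurable_stageValue mW₁).comp (f := fun η : Config => (h₁, η)) (by fun_prop))
      (mI mS mE₁)
      ((measurable_stageValue mW₂).comp (f := fun η : Config => (h₂, η)) (by fun_prop))
      (mI mD mE₂) ((j + 1 : ℕ) * blockError ν C' δ L t H) fun η η' => ?_)
    simp only [Function.comp_apply, Function.uncurry_apply_pair]
    by_cases b₁ : η ∈ bad₁
    · refine (stageValue_le_one (chainValue_le_one h1 j (m + L)) h₁ η).trans ?_
      have : bad₁.indicator (1 : Config → ℝ≥0∞) η = 1 := Set.indicator_of_mem b₁ _
      rw [this]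
      exact le_add_right (le_add_right (le_add_left le_self_add))
    by_cases b₂ : η' ∈ bad₂
    · refine (stageValue_le_one (chainValue_le_one h1 j (m + L)) h₁ η).trans ?_
      have : bad₂.indicator (1 : Config → ℝ≥0∞) η' = 1 := Set.indicator_of_mem b₂ _
      rw [this]
      exact le_add_right (le_add_left le_self_add)
    have hrange : |h₂ m| ≤ m := by
      have := P₂.abs_le 0 m; rw [h0] at this; simpa using this
    push_cast at hH
    have key := S.stageValue_le (u := u) hE hN hC hp (H' := H') P₁ P₂ (hle m le_rfl) hpar
      (G₂ := fun h η => E.chainValue p₀ p₁ u L κ₂ F₂ j (m + L) h η + j * blockError ν C' δ L t H)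
      (by have : m + L ≤ N := le_trans (Nat.le_add_right _ _) hm'
          omega)
      (by rw [abs_of_nonneg (by positivity)]
          have : (0 : ℤ) ≤ 2 * t * j := by positivity
          linarith)
      (not_not.1 b₁) (not_not.1 b₂) mW₁ (mW₂.add_const (j * blockError ν C' δ L t H)) mE₁ mE₂
      (chainValue_le_one h1 j (m + L)) (fun h₁' h₂' η₁' η₂' P₁' P₂' a₁ a₂ hk => by
        refine (ih η₁' η₂' P₁' P₂' (d := d + 2 * t) (fun s hs => ?_) ?_ ?_ hm' (by positivity) ?_
          fun k₁ k₂ hk => hF k₁ k₂ fun s hs => ?_).trans_eq ?_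
        · rcases le_or_gt s m with hsm | hsm
          · have := hle s hsm
            rw [a₁ s hsm, a₂ s hsm]; omega
          · obtain ⟨k, rfl⟩ := Nat.exists_eq_add_of_le hsm.le
            exact hk k (by omega)
        · have := P₁'.dvd m L
          have := P₂'.dvd m L
          rw [a₁ m le_rfl] at *
          rw [a₂ m le_rfl] at *
          omega
        · rw [a₂ 0 (Nat.zero_le _), h0]
        · linarith
        · have := hk s (by linarith [add_mul j 1 L])
          push_cast
          linarith
        · ring)
    refine key.trans ?_
    rw [stageValue_add_const]
    have i₁ : bad₁.indicator (1 : Config → ℝ≥0∞) η = 0 := Set.indicator_of_notMem b₁ _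
    have i₂ : bad₂.indicator (1 : Config → ℝ≥0∞) η' = 0 := Set.indicator_of_notMem b₂ _
    rw [i₁, i₂]
    refine le_of_eq ?_
    push_cast
    ring

/-- The first block, where the environments are ordered. -/
theorem Monotonicity.lintegral_stageValue_le (hM : E.Monotonicity) (hp : p₀ ≤ p₁) {ρ₁ ρ₂ : ℝ}
    (hρ₁ : ρ₁ ∈ E.J) (hρ₂ : ρ₂ ∈ E.J) (hρ : ρ₁ ≤ ρ₂) {L : ℕ} {h : ℕ → ℤ} (P : IsPath h)
    {G₁ G₂ : (ℕ → ℤ) → Config → ℝ≥0∞} {e₁ e₂ : Config → ℝ≥0∞}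
    (hG₁ : Measurable (Function.uncurry G₁)) (hG₂ : Measurable (Function.uncurry G₂))
    (he₁ : Measurable e₁) (he₂ : Measurable e₂)
    (hle : ∀ (h₁' h₂' : ℕ → ℤ) (η₁' η₂' : Config), IsPath h₁' → IsPath h₂' →
      h₁' 0 = h 0 → h₂' 0 = h 0 → (∀ k, h₁' k ≤ h₂' k) →
      G₁ h₁' η₁' ≤ G₂ h₂' η₂' + e₁ η₁' + e₂ η₂') :
    ∫⁻ η, E.stageValue p₀ p₁ u L 0 G₁ h η ∂(E.μ ρ₁) ≤
      ∫⁻ η, E.stageValue p₀ p₁ u L 0 G₂ h η ∂(E.μ ρ₂) +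
      ∫⁻ η, ∫⁻ ζ, e₁ (ζ L) ∂(E.P η) ∂(E.μ ρ₁) + ∫⁻ η, ∫⁻ ζ, e₂ (ζ L) ∂(E.P η) ∂(E.μ ρ₂) := by
  have hquenched : ∀ η₁ η₂ : Config, η₁ ≤ η₂ → E.stageValue p₀ p₁ u L 0 G₁ h η₁ ≤
      E.stageValue p₀ p₁ u L 0 G₂ h η₂ + ∫⁻ ζ, e₂ (ζ L) ∂(E.P η₂) + ∫⁻ ζ, e₁ (ζ L) ∂(E.P η₁) := by
    intro η₁ η₂ hη
    obtain ⟨Q, hQ, hord⟩ := hM.1 η₁ η₂ hη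
    have mf₁ := measurable_extendPath_apply (p₀ := p₀) (p₁ := p₁) (u := u) (m := 0)
      (T := L) hG₁ h
    have mf₂ := measurable_extendPath_apply (p₀ := p₀) (p₁ := p₁) (u := u) (m := 0)
      (T := L) hG₂ h
    have key := hQ.lintegral_le_of_ae mf₁ (he₁.comp (measurable_pi_apply L))
      (mf₂.add (he₂.comp (measurable_pi_apply L))) (by
        filter_upwards [hord] with w hw
        refine (hle _ _ (w.1 L) (w.2 L) P.extendPath P.extendPath (extendPath_of_le le_rfl)
          (extendPath_of_le le_rfl) fun k => ?_).trans_eq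
          (by simp only [Pi.add_apply, Function.comp_apply]; ring)
        have h1 := extendPath_add (p₀ := p₀) (p₁ := p₁) (u := u) (m := 0) (h := h) (ζ := w.1) k
        have h2 := extendPath_add (p₀ := p₀) (p₁ := p₁) (u := u) (m := 0) (h := h) (ζ := w.2) k
        rw [zero_add] at h1 h2
        rw [h1, h2]
        have := traj_sub_le_traj hp u 0 (x₁ := h 0) (x₂ := h 0) (d := 0) (ζ₁ := w.1) (ζ₂ := w.2)
          (T := k) (by simp) (by simp) le_rfl (fun s _ x _ _ => by
            rw [Config.translate_zero]; exact hw s x) k le_rfl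
        simpa using this)
    simp only [Pi.add_apply, Function.comp_apply] at key
    rw [lintegral_add_left mf₂] at key
    exact key
  obtain ⟨Q, hQ, hord⟩ := hM.2 ρ₁ hρ₁ ρ₂ hρ₂ hρ
  have mf₂ : Measurable fun η => E.stageValue p₀ p₁ u L 0 G₂ h η :=
    (measurable_stageValue hG₂).comp (f := fun η : Config => (h, η)) (by fun_prop)
  have key := hQ.lintegral_le_of_ae
    ((measurable_stageValue hG₁).comp (f := fun η : Config => (h, η)) (by fun_prop))
    (Measurable.lintegral_kernel (κ := E.P) (he₁.comp (measurable_pi_apply L)))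
    (mf₂.add (Measurable.lintegral_kernel (κ := E.P) (he₂.comp (measurable_pi_apply L)))) (by
      filter_upwards [hord] with w hw
      exact hquenched w.1 w.2 hw)
  simp only [Pi.add_apply, Function.comp_apply, Function.uncurry_apply_pair] at key
  rw [lintegral_add_left mf₂] at key
  exact key.trans_eq (by ring)

/-- Comparison of two walks over `j + 1` blocks. -/
theorem Scale.lintegral_chain_le {ν C C' ρ δ : ℝ} {L t N M H : ℕ}
    (S : E.Scale ν C ρ δ L t N M H)
    (hE : E.MarkovInvariant) (hS : E.Stationary) (hM : E.Monotonicity) (hN : E.NoDriftIn ν)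
    (hC : E.CoveringWith ν C C') (hp : p₀ ≤ p₁) {ρ' : ℝ} (hρ' : ρ' ∈ E.J) (hle : ρ ≤ ρ')
    {κ₁ κ₂ : Kernel Config Config} [IsMarkovKernel κ₁] [IsMarkovKernel κ₂]
    (hκ₁ : ∀ g : Config → ℝ≥0∞, Measurable g →
      ∫⁻ η, ∫⁻ η', g η' ∂(κ₁ η) ∂(E.μ ρ) = ∫⁻ η, g η ∂(E.μ ρ))
    (hκ₂ : ∀ g : Config → ℝ≥0∞, Measurable g →
      ∫⁻ η, ∫⁻ η', g η' ∂(κ₂ η) ∂(E.μ ρ') = ∫⁻ η, g η ∂(E.μ ρ'))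
    {H' j : ℕ} {F₁ F₂ : (ℕ → ℤ) → ℝ≥0∞} (hF₁ : Measurable F₁) (hF₂ : Measurable F₂)
    (h1 : ∀ h, F₁ h ≤ 1) {h : ℕ → ℤ} (P : IsPath h) (h0 : h 0 = 0) (hjN : L + j * L ≤ N)
    (hH' : H + 2 * t * j ≤ H')
    (hF : ∀ h₁' h₂' : ℕ → ℤ, (∀ s ≤ L + j * L, h₁' s - 2 * t * j ≤ h₂' s) → F₁ h₁' ≤ F₂ h₂') :
    ∫⁻ η, E.stageValue p₀ p₁ u L 0 (E.chainValue p₀ p₁ u L κ₁ F₁ j L) h η ∂(E.μ ρ) ≤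
      ∫⁻ η, E.stageValue p₀ p₁ u L 0 (E.chainValue p₀ p₁ u L κ₂ F₂ j L) h η ∂(E.μ ρ') +
      j * (E.μ ρ (Sparse (ρ + δ / 4) ⌊(t : ℝ) ^ (1 / 4 : ℝ)⌋₊ H')ᶜ +
        E.μ ρ' (Dense (ρ + 3 * δ / 4) ⌊(t : ℝ) ^ (1 / 4 : ℝ)⌋₊ H')ᶜ +
        blockError ν C' δ L t H) := by
  have mS := (measurableSet_sparse (ρ + δ / 4) ⌊(t : ℝ) ^ (1 / 4 : ℝ)⌋₊ H').compl
  have mD := (measurableSet_dense (ρ + 3 * δ / 4) ⌊(t : ℝ) ^ (1 / 4 : ℝ)⌋₊ H').compl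
  have mW₂ := measurable_chainValue (E := E) (p₀ := p₀) (p₁ := p₁) (u := u) (L := L) (κ := κ₂)
      hF₂ j L
  have mE₁ := measurable_chainError (E := E) (L := L) (κ := κ₁) mS j
  have mE₂ := measurable_chainError (E := E) (L := L) (κ := κ₂) mD j
  -- The first block ends with gap `0` and without error; the remaining `j` blocks start from there
  -- with `d = 0`.
  have key := hM.lintegral_stageValue_le (u := u) hp S.rho_mem hρ' hle (L := L) P
    (G₂ := fun h η => E.chainValue p₀ p₁ u L κ₂ F₂ j L h η + j * blockError ν C' δ L t H)
    (measurable_chainValue (κ := κ₁) hF₁ j L) (mW₂.add_const (j * blockError ν C' δ L t H)) mE₁ mE₂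
    (fun h₁ h₂ η₁ η₂ P₁ P₂ a₁ a₂ hk => by
      have key := S.chainValue_le (u := u) hE hN hC hp (κ₁ := κ₁) (κ₂ := κ₂) (H' := H') hF₁ hF₂
        h1 j (m := L) (d := 0) η₁ η₂ P₁ P₂ (fun s _ => by simpa using hk s) ?_ (by rw [a₂, h0])
        hjN le_rfl ?_ ?_
      · exact key.trans_eq (by ring)
      · have := P₁.dvd 0 L
        have := P₂.dvd 0 L
        simp only [zero_add, a₁, a₂] at *
        omega
      · rw [zero_add]; exact_mod_cast hH'
      · simpa using hF)
  rw [hS.lintegral_eq S.rho_mem L mE₁, hS.lintegral_eq hρ' L mE₂,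
    hS.lintegral_chainError S.rho_mem hκ₁ mS, hS.lintegral_chainError hρ' hκ₂ mD] at key
  refine key.trans_eq ?_
  simp only [stageValue_add_const]
  rw [lintegral_add_right _ measurable_const, lintegral_const, measure_univ, mul_one]
  ring

end Environment

/-! ### Refreshed environments as chains of blocks -/

/-- Put `x` in front of the sequence `ω`. -/
def consSeq {α : Type*} (x : α) (ω : ℕ → α) : ℕ → α
  | 0 => x
  | k + 1 => ω k

theorem measurable_consSeq {α : Type*} [MeasurableSpace α] :
    Measurable fun w : α × (ℕ → α) => consSeq w.1 w.2 := by
  refine measurable_pi_lambda _ fun k => ?_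
  cases k with
  | zero => exact measurable_fst
  | succ k => exact (measurable_pi_apply k).comp measurable_snd

/-- Splits off the first block of a refreshed environment, independent of the later ones, for the
induction over blocks. -/
theorem map_consSeq_infinitePi {α : Type*} [MeasurableSpace α] (μ : Measure α)
    [IsProbabilityMeasure μ] :
    (μ.prod (Measure.infinitePi fun _ : ℕ => μ)).map (fun w => consSeq w.1 w.2) =
      Measure.infinitePi fun _ : ℕ => μ := by
  classical
  refine Measure.eq_infinitePi _ fun s t ht => ?_
  -- Padding by `Set.univ` turns the index set into an initial segment, from which coordinate `0`
  -- can be split off.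
  let t' : ℕ → Set α := fun i => if i ∈ s then t i else Set.univ
  have ht' : ∀ i, MeasurableSet (t' i) := by
    intro i; simp only [t']; split_ifs
    · exact ht i
    · exact MeasurableSet.univ
  obtain ⟨n, hn⟩ := s.exists_nat_subset_range
  have hn' : s ⊆ Finset.range (n + 1) := hn.trans (Finset.range_mono (Nat.le_succ n))
  have h1 : Set.pi (s : Set ℕ) t = Set.pi (Finset.range (n + 1) : Set ℕ) t' := by
    ext ω
    simp only [Set.mem_pi, Finset.mem_coe]
    constructor
    · intro h i _
      simp only [t']; split_ifs with hi
      · exact h i hi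
      · trivial
    · intro h i hi
      have := h i (hn' hi)
      simpa [t', hi] using this
  have h2 : ∏ i ∈ s, μ (t i) = ∏ i ∈ Finset.range (n + 1), μ (t' i) := by
    rw [← Finset.prod_subset hn' (f := fun i => μ (t' i))]
    · exact Finset.prod_congr rfl fun i hi => by simp [t', hi]
    · intro i _ hi; simp [t', hi]
  rw [h1, h2, Measure.map_apply measurable_consSeq
    (MeasurableSet.pi (Finset.countable_toSet _) fun i _ => ht' i)]
  have h3 : (fun w : α × (ℕ → α) => consSeq w.1 w.2) ⁻¹'
      Set.pi (Finset.range (n + 1) : Set ℕ) t' =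
      t' 0 ×ˢ Set.pi (Finset.range n : Set ℕ) (fun i => t' (i + 1)) := by
    ext ⟨x, ω⟩
    simp only [Set.mem_preimage, Set.mem_pi, Finset.mem_coe, Finset.mem_range, Set.mem_prod]
    constructor
    · intro h
      exact ⟨h 0 (by omega), fun i hi => h (i + 1) (by omega)⟩
    · rintro ⟨h, h'⟩ i hi
      cases i with
      | zero => exact h
      | succ i => exact h' i (by omega)
  rw [h3, Measure.prod_prod, Measure.infinitePi_pi _ fun i _ => ht' (i + 1),
    Finset.prod_range_succ', mul_comm]

theorem concat_consSeq_of_lt {L k : ℕ} (hk : k < L) (ζ : EnvPath) (ω : ℕ → EnvPath) :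
    Environment.concat L (consSeq ζ ω) k = ζ k := by
  simp [Environment.concat, Nat.div_eq_of_lt hk, Nat.mod_eq_of_lt hk, consSeq]

theorem shift_concat_consSeq {L : ℕ} (hL : 0 < L) (ζ : EnvPath) (ω : ℕ → EnvPath) :
    (Environment.concat L (consSeq ζ ω)).shift L 0 = Environment.concat L ω := by
  funext k
  simp only [EnvPath.shift, Config.translate_zero, Environment.concat]
  rw [Nat.add_div_left k hL, Nat.add_mod_left]
  rfl

namespace Environment

variable {E : Environment} {p₀ p₁ : ℝ} {u : ℕ → unitInterval}

theorem lintegral_annealed (ρ : ℝ) {f : EnvPath → ℝ≥0∞} (hf : Measurable f) :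
    ∫⁻ ζ, f ζ ∂(E.annealed ρ) = ∫⁻ η, ∫⁻ ζ, f ζ ∂(E.P η) ∂(E.μ ρ) :=
  Measure.lintegral_bind E.P.aemeasurable hf.aemeasurable

theorem lintegral_walkLaw {ρ : ℝ} {L : ℕ} {F : (ℕ → ℤ) → ℝ≥0∞} (hF : Measurable F) :
    ∫⁻ X, F X ∂(walkLaw E p₀ p₁ ρ L) =
      ∫⁻ u, ∫⁻ ω, F (traj p₀ p₁ u 0 0 (concat L ω)) ∂(Measure.infinitePi fun _ : ℕ => E.annealed ρ)
        ∂(Measure.infinitePi fun _ : ℕ => (volume : Measure unitInterval)) := by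
  unfold walkLaw
  have hm : Measurable fun w : EnvPath × (ℕ → unitInterval) => F (walk p₀ p₁ w.1 w.2) :=
    hF.comp (measurable_walk p₀ p₁)
  rw [lintegral_map hF (measurable_walk p₀ p₁), lintegral_prod_symm' _ hm]
  refine lintegral_congr fun u => ?_
  unfold finiteRange
  have hu : Measurable fun η : EnvPath => F (walk p₀ p₁ η u) :=
    hm.comp (f := fun η : EnvPath => (η, u)) (by fun_prop)
  rw [lintegral_map hu (measurable_concat L)]
  simp only [walk_eq_traj]

/-- `F` depends only on the path up to time `n`. -/
def DependsUpTo (n : ℕ) (F : (ℕ → ℤ) → ℝ≥0∞) : Prop :=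
  ∀ h h' : ℕ → ℤ, (∀ s ≤ n, h s = h' s) → F h = F h'

theorem extendPath_zero {h : ℕ → ℤ} (h0 : h 0 = 0) (ζ : EnvPath) :
    extendPath p₀ p₁ u 0 h ζ = traj p₀ p₁ u 0 0 ζ := by
  funext s
  have := extendPath_add (p₀ := p₀) (p₁ := p₁) (u := u) (m := 0) (h := h) (ζ := ζ) s
  rwa [zero_add, h0] at this

/-- Up to time `n`, the environment that is refreshed every `n` steps is not refreshed. -/
theorem lintegral_traj_concat_of_le {ρ : ℝ} {n L : ℕ} (hn : n ≤ L) {F : (ℕ → ℤ) → ℝ≥0∞}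
    (hF : Measurable F) (hdep : DependsUpTo n F) :
    ∫⁻ ω, F (traj p₀ p₁ u 0 0 (concat L ω)) ∂(Measure.infinitePi fun _ : ℕ => E.annealed ρ) =
      ∫⁻ ζ, F (traj p₀ p₁ u 0 0 ζ) ∂(E.annealed ρ) := by
  have hm : Measurable fun ζ : EnvPath => F (traj p₀ p₁ u 0 0 ζ) :=
    hF.comp ((measurable_traj p₀ p₁ 0).comp (f := fun ζ : EnvPath => ((u, (0 : ℤ)), ζ))
      (by fun_prop))
  have h0 : (Measure.infinitePi fun _ : ℕ => E.annealed ρ).map (fun ω => ω 0) = E.annealed ρ :=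
    (measurePreserving_eval_infinitePi (fun _ : ℕ => E.annealed ρ) 0).map_eq
  conv_rhs => rw [← h0]
  rw [lintegral_map hm (measurable_pi_apply 0)]
  refine lintegral_congr fun ω => hdep _ _ fun s hs => traj_congr (T := n) (fun k hk => ?_) s hs
  have : k < L := by omega
  simp [concat, Nat.div_eq_of_lt this, Nat.mod_eq_of_lt this]

/-- With the identity as update, nothing happens between blocks, and the Markov property merges them
into one stage. -/
theorem MarkovInvariant.chainValue_id (hE : E.MarkovInvariant) {L : ℕ} {F : (ℕ → ℤ) → ℝ≥0∞}
    (hF : Measurable F) (j m : ℕ) (hdep : DependsUpTo (m + j * L) F) (h : ℕ → ℤ) (η : Config) :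
    E.chainValue p₀ p₁ u L Kernel.id F j m h η =
      E.stageValue p₀ p₁ u (j * L) m (fun h _ => F h) h η := by
  induction j generalizing m h η with
  | zero =>
    have : ∀ ζ, F (extendPath p₀ p₁ u m h ζ) = F h :=
      fun ζ => hdep _ _ fun s hs => extendPath_of_le (by simpa using hs)
    simp [chainValue, stageValue, this]
  | succ j ih =>
    have hm : Measurable fun η' =>
        E.stageValue p₀ p₁ u L m (E.chainValue p₀ p₁ u L Kernel.id F j (m + L)) h η' :=
      (measurable_stageValue (measurable_chainValue hF j (m + L))).comp
        (f := fun η : Config => (h, η)) (by fun_prop)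
    simp only [chainValue]
    rw [Kernel.id_apply, lintegral_dirac' _ hm, add_mul, one_mul, add_comm (j * L) L,
      hE.stageValue_add (G := fun h _ => F h) (hF.comp measurable_fst)]
    have hdep' : DependsUpTo (m + L + j * L) F := by
      have : m + L + j * L = m + (j + 1) * L := by ring
      rwa [this]
    unfold stageValue
    refine lintegral_congr fun ζ => ?_
    exact ih (m + L) hdep' _ _

/-- The value of the walk that is refreshed every `L` steps. -/
theorem lintegral_concat_eq_chainValue {ρ : ℝ} {L : ℕ} (hL : 0 < L) {F : (ℕ → ℤ) → ℝ≥0∞}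
    (hF : Measurable F) (j m : ℕ) (hdep : DependsUpTo (m + j * L) F) (h : ℕ → ℤ) (η : Config) :
    ∫⁻ ω, F (extendPath p₀ p₁ u m h (concat L ω))
        ∂(Measure.infinitePi fun _ : ℕ => E.annealed ρ) =
      E.chainValue p₀ p₁ u L (Kernel.const Config (E.μ ρ)) F j m h η := by
  induction j generalizing m h η with
  | zero =>
    have : ∀ ζ, F (extendPath p₀ p₁ u m h ζ) = F h :=
      fun ζ => hdep _ _ fun s hs => extendPath_of_le (by simpa using hs)
    simp [chainValue, this]
  | succ j ih =>
    have hdep' : DependsUpTo (m + L + j * L) F := by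
      have : m + L + j * L = m + (j + 1) * L := by ring
      rwa [this]
    have hext : ∀ m, Measurable fun w : (ℕ → ℤ) × (ℕ → EnvPath) =>
        F (extendPath p₀ p₁ u m w.1 (concat L w.2)) := fun m =>
      hF.comp ((measurable_extendPath p₀ p₁ u m).comp
        (measurable_fst.prodMk ((measurable_concat L).comp measurable_snd)))
    have hglue : ∀ (ζ : EnvPath) (ω : ℕ → EnvPath),
        extendPath p₀ p₁ u m h (concat L (consSeq ζ ω)) =
          extendPath p₀ p₁ u (m + L) (extendPath p₀ p₁ u m h ζ) (concat L ω) := by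
      intro ζ ω
      rw [← extendPath_extendPath L, shift_concat_consSeq hL]
      exact extendPath_congr (extendPath_congr_env fun k hk => concat_consSeq_of_lt hk ζ ω)
    have hpair : Measurable fun w : EnvPath × (ℕ → EnvPath) =>
        F (extendPath p₀ p₁ u (m + L) (extendPath p₀ p₁ u m h w.1) (concat L w.2)) :=
      (hext (m + L)).comp (Measurable.prodMk ((measurable_extendPath p₀ p₁ u m).comp
        (f := fun w : EnvPath × (ℕ → EnvPath) => (h, w.1)) (by fun_prop)) measurable_snd)
    have hh : Measurable fun ω : ℕ → EnvPath => F (extendPath p₀ p₁ u m h (concat L ω)) :=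
      (hext m).comp (f := fun ω : ℕ → EnvPath => (h, ω)) (by fun_prop)
    rw [← map_consSeq_infinitePi, lintegral_map hh measurable_consSeq]
    simp only [hglue]
    rw [lintegral_prod _ hpair.aemeasurable]
    simp only [chainValue, Kernel.const_apply]
    have h1 : ∀ ζ : EnvPath, ∫⁻ ω, F (extendPath p₀ p₁ u (m + L) (extendPath p₀ p₁ u m h ζ)
        (concat L ω)) ∂(Measure.infinitePi fun _ : ℕ => E.annealed ρ) =
        E.chainValue p₀ p₁ u L (Kernel.const Config (E.μ ρ)) F j (m + L)
          (extendPath p₀ p₁ u m h ζ) (ζ L) := fun ζ => ih (m + L) hdep' _ _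
    simp only [h1]
    rw [lintegral_annealed]
    · rfl
    · exact measurable_extendPath_apply (measurable_chainValue hF j (m + L)) h

/-- The walk up to time `n` in the environment that is refreshed every `n` steps or every `L` steps
is described by the values over blocks of length `L`. -/
theorem exists_kernel_chainValue (hE : E.MarkovInvariant) {ρ : ℝ} {n L L' j : ℕ}
    (hL : 0 < L) (hn : n ≤ L + j * L) (hL' : L' = n ∨ L' = L) :
    ∃ κ : Kernel Config Config, IsMarkovKernel κ ∧
      (∀ g : Config → ℝ≥0∞, Measurable g →
        ∫⁻ η, ∫⁻ η', g η' ∂(κ η) ∂(E.μ ρ) = ∫⁻ η, g η ∂(E.μ ρ)) ∧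
      ∀ F : (ℕ → ℤ) → ℝ≥0∞, Measurable F → DependsUpTo n F → ∀ (u : ℕ → unitInterval) (h : ℕ → ℤ),
        h 0 = 0 →
        ∫⁻ ω, F (traj p₀ p₁ u 0 0 (concat L' ω))
          ∂(Measure.infinitePi fun _ : ℕ => E.annealed ρ) =
        ∫⁻ η, E.stageValue p₀ p₁ u L 0 (E.chainValue p₀ p₁ u L κ F j L) h η ∂(E.μ ρ) := by
  have hmono : ∀ {F}, DependsUpTo n F → DependsUpTo (L + j * L) F :=
    fun hd h h' hh => hd h h' fun s hs => hh s (hs.trans hn)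
  rcases hL' with rfl | rfl
  · refine ⟨Kernel.id, inferInstance, fun g hg => ?_, fun F hF hdep u h h0 => ?_⟩
    · refine lintegral_congr fun η => ?_
      rw [Kernel.id_apply, lintegral_dirac' _ hg]
    · have hm : Measurable fun ζ : EnvPath => F (traj p₀ p₁ u 0 0 ζ) :=
        hF.comp ((measurable_traj p₀ p₁ 0).comp (f := fun ζ : EnvPath => ((u, (0 : ℤ)), ζ))
          (by fun_prop))
      rw [lintegral_traj_concat_of_le le_rfl hF hdep, lintegral_annealed _ hm]
      refine lintegral_congr fun η => ?_
      have h1 : E.stageValue p₀ p₁ u L 0 (E.chainValue p₀ p₁ u L Kernel.id F j L) h η =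
          E.stageValue p₀ p₁ u L 0 (E.stageValue p₀ p₁ u (j * L) (0 + L) (fun h _ => F h)) h η := by
        unfold stageValue
        refine lintegral_congr fun ζ => ?_
        rw [zero_add]
        exact hE.chainValue_id hF j L (hmono hdep) _ _
      rw [h1, ← hE.stageValue_add (G := fun h _ => F h) (hF.comp measurable_fst)]
      unfold stageValue
      simp only [extendPath_zero h0]
  · refine ⟨Kernel.const Config (E.μ ρ), inferInstance, fun g hg => ?_,
      fun F hF hdep u h h0 => ?_⟩
    · simp
    -- The first update already draws a fresh environment, so the initial configuration `fun _ => 0`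
    -- is irrelevant.
    · have := lintegral_concat_eq_chainValue (E := E) (p₀ := p₀) (p₁ := p₁) (u := u) (ρ := ρ) hL hF
        (j + 1) 0 (by
          have : 0 + (j + 1) * L' = L' + j * L' := by ring
          rw [this]; exact hmono hdep) h (fun _ => 0)
      simp only [extendPath_zero h0] at this
      rw [this]
      simp [chainValue]

end Environment

/-! ### From values to couplings of trajectories -/

@[fun_prop]
theorem measurable_upTo (n : ℕ) : Measurable (upTo n) := by
  unfold upTo; fun_prop

instance isProbabilityMeasure_map_upTo (E : Environment) (p₀ p₁ ρ : ℝ) (L n : ℕ) :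
    IsProbabilityMeasure ((walkLaw E p₀ p₁ ρ L).map (upTo n)) :=
  Measure.isProbabilityMeasure_map (measurable_upTo n).aemeasurable

theorem walk_mem_Icc (p₀ p₁ : ℝ) (η : EnvPath) (u : ℕ → unitInterval) (n : ℕ) :
    upTo n (walk p₀ p₁ η u) ∈
      Finset.Icc (fun _ : Fin (n + 1) => (-n : ℤ)) (fun _ : Fin (n + 1) => (n : ℤ)) := by
  rw [Finset.mem_Icc]
  have : ∀ s : Fin (n + 1), |walk p₀ p₁ η u s| ≤ n := by
    intro s
    rw [walk_eq_traj]
    have := (isPath_traj p₀ p₁ u 0 0 η).abs_le 0 s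
    rw [zero_add] at this
    simp only [traj, abs_zero, zero_add] at this
    have := s.2
    omega
  exact ⟨fun s => (abs_le.1 (this s)).1, fun s => (abs_le.1 (this s)).2⟩

theorem map_upTo_compl_Icc (E : Environment) (p₀ p₁ ρ : ℝ) (L n : ℕ) :
    (walkLaw E p₀ p₁ ρ L).map (upTo n)
      ((Finset.Icc (fun _ : Fin (n + 1) => (-n : ℤ)) (fun _ => (n : ℤ)) : Finset _) : Set _)ᶜ = 0 := by
  have hm : MeasurableSet ((Finset.Icc (fun _ : Fin (n + 1) => (-n : ℤ)) (fun _ => (n : ℤ)) :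
      Finset (Fin (n + 1) → ℤ)) : Set (Fin (n + 1) → ℤ)) := Finset.measurableSet _
  rw [Measure.map_apply (measurable_upTo n) hm.compl]
  unfold walkLaw
  rw [Measure.map_apply (measurable_walk p₀ p₁) (measurable_upTo n hm.compl)]
  convert measure_empty (μ := (E.finiteRange ρ L).prod
    (Measure.infinitePi (fun _ : ℕ => (volume : Measure unitInterval))))
  ext w
  simp only [Set.mem_preimage, Set.mem_compl_iff, Set.mem_empty_iff_false, iff_false, not_not]
  exact walk_mem_Icc p₀ p₁ w.1 w.2 n

namespace Environment

variable {E : Environment} {p₀ p₁ : ℝ}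

/-- Strassen's condition for a set `A` of trajectories is the chain comparison for the indicators of
`A` and of its neighbourhood `B`. It holds for each fixed choice of the driving variables, hence on
average. The last block may extend beyond `n`, because the indicators depend only on the path up to
`n`. -/
theorem Scale.exists_coupling {ν C C' ρ δ : ℝ} {L t N M H : ℕ} (S : E.Scale ν C ρ δ L t N M H)
    (hE : E.MarkovInvariant) (hS : E.Stationary) (hM : E.Monotonicity) (hN : E.NoDriftIn ν)
    (hC : E.CoveringWith ν C C') (hp : p₀ ≤ p₁) {ρ' : ℝ} (hρ' : ρ' ∈ E.J) (hle : ρ ≤ ρ')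
    {H' j n L₁ L₂ : ℕ} (hn : n ≤ L + j * L) (hjN : L + j * L ≤ N) (hH' : H + 2 * t * j ≤ H')
    (hL₁ : L₁ = n ∨ L₁ = L) (hL₂ : L₂ = n ∨ L₂ = L) {D : ℝ} (hD0 : 0 ≤ D)
    (hD : j * (E.μ ρ (Sparse (ρ + δ / 4) ⌊(t : ℝ) ^ (1 / 4 : ℝ)⌋₊ H')ᶜ +
        E.μ ρ' (Dense (ρ + 3 * δ / 4) ⌊(t : ℝ) ^ (1 / 4 : ℝ)⌋₊ H')ᶜ +
        blockError ν C' δ L t H) ≤ ENNReal.ofReal D) :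
    ∃ Q : Measure ((Fin (n + 1) → ℤ) × (Fin (n + 1) → ℤ)),
      IsCoupling Q ((walkLaw E p₀ p₁ ρ L₁).map (upTo n)) ((walkLaw E p₀ p₁ ρ' L₂).map (upTo n)) ∧
      Q.real {w | ¬ ∀ s, w.1 s - 2 * t * j ≤ w.2 s} ≤ D := by
  have hL0 : 0 < L := lt_of_lt_of_le S.one_le S.le_block
  obtain ⟨κ₁, _, hκ₁, hv₁⟩ := exists_kernel_chainValue (p₀ := p₀) (p₁ := p₁) hE (ρ := ρ) hL0 hn hL₁
  obtain ⟨κ₂, _, hκ₂, hv₂⟩ := exists_kernel_chainValue (p₀ := p₀) (p₁ := p₁) hE (ρ := ρ') hL0 hn hL₂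
  refine exists_coupling_of_finset _ _ _ _ (map_upTo_compl_Icc E p₀ p₁ ρ L₁ n)
    (map_upTo_compl_Icc E p₀ p₁ ρ' L₂ n) (fun x y => ∀ s, x s - 2 * t * j ≤ y s) D fun A => ?_
  have key : ∀ (ρ : ℝ) (L : ℕ) (A : Set (Fin (n + 1) → ℤ)),
      (walkLaw E p₀ p₁ ρ L).map (upTo n) A = ∫⁻ u, ∫⁻ ω,
        (upTo n ⁻¹' A).indicator 1 (traj p₀ p₁ u 0 0 (concat L ω))
        ∂(Measure.infinitePi fun _ : ℕ => E.annealed ρ)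
        ∂(Measure.infinitePi fun _ : ℕ => (volume : Measure unitInterval)) := by
    intro ρ L A
    have hA : MeasurableSet A := A.to_countable.measurableSet
    rw [Measure.map_apply (measurable_upTo n) hA,
      ← lintegral_indicator_one (measurable_upTo n hA),
      lintegral_walkLaw (measurable_one.indicator (measurable_upTo n hA))]
  have hm : ∀ A : Set (Fin (n + 1) → ℤ), Measurable
      ((upTo n ⁻¹' A).indicator (1 : (ℕ → ℤ) → ℝ≥0∞)) := fun A =>
    measurable_one.indicator (measurable_upTo n A.to_countable.measurableSet)
  have hdep : ∀ A : Set (Fin (n + 1) → ℤ), DependsUpTo n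
      ((upTo n ⁻¹' A).indicator (1 : (ℕ → ℤ) → ℝ≥0∞)) := by
    intro A h h' hh
    have : upTo n h = upTo n h' := funext fun s => hh s (by omega)
    have hmem : h ∈ upTo n ⁻¹' A ↔ h' ∈ upTo n ⁻¹' A := by
      rw [Set.mem_preimage, Set.mem_preimage, this]
    by_cases hA : h' ∈ upTo n ⁻¹' A
    · rw [Set.indicator_of_mem hA, Set.indicator_of_mem (hmem.2 hA)]; rfl
    · rw [Set.indicator_of_notMem hA, Set.indicator_of_notMem fun h => hA (hmem.1 h)]
  set B : Set (Fin (n + 1) → ℤ) := {y | ∃ x ∈ A, ∀ s, x s - 2 * t * j ≤ y s} with hB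
  have hmain : (walkLaw E p₀ p₁ ρ L₁).map (upTo n) A ≤
      (walkLaw E p₀ p₁ ρ' L₂).map (upTo n) B + ENNReal.ofReal D := by
    rw [key, key]
    calc _ ≤ ∫⁻ u, (∫⁻ ω, (upTo n ⁻¹' B).indicator 1 (traj p₀ p₁ u 0 0 (concat L₂ ω))
            ∂(Measure.infinitePi fun _ : ℕ => E.annealed ρ') + ENNReal.ofReal D)
            ∂(Measure.infinitePi fun _ : ℕ => (volume : Measure unitInterval)) := by
          refine lintegral_mono fun u => ?_
          -- Any nearest-neighbour path from `0` would do: only its value at time `0` enters.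
          have P : IsPath fun s => (s : ℤ) := fun s => by simp
          simp only
          rw [hv₁ _ (hm A) (hdep A) u (fun s => (s : ℤ)) rfl,
            hv₂ _ (hm B) (hdep B) u (fun s => (s : ℤ)) rfl]
          refine (S.lintegral_chain_le hE hS hM hN hC hp hρ' hle hκ₁ hκ₂ (hm A) (hm B) ?_ P rfl
            hjN hH' fun h₁ h₂ hh => ?_).trans (by gcongr)
          · intro h
            exact Set.indicator_le_self' (fun _ _ => zero_le) h
          · by_cases hA : upTo n h₁ ∈ (A : Set (Fin (n + 1) → ℤ))
            · have : upTo n h₂ ∈ B := ⟨_, hA, fun s => hh s (by omega)⟩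
              rw [Set.indicator_of_mem (show h₂ ∈ upTo n ⁻¹' B from this)]
              exact Set.indicator_le_self' (fun _ _ => zero_le) h₁
            · rw [Set.indicator_of_notMem
                (show h₁ ∉ upTo n ⁻¹' (A : Set (Fin (n + 1) → ℤ)) from hA)]
              exact zero_le
      _ = _ := by rw [lintegral_add_right _ measurable_const]; simp
  calc ((walkLaw E p₀ p₁ ρ L₁).map (upTo n)).real A
      ≤ ((walkLaw E p₀ p₁ ρ' L₂).map (upTo n) B + ENNReal.ofReal D).toReal :=
        ENNReal.toReal_mono (by finiteness) hmain
    _ = _ := by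
        rw [ENNReal.toReal_add (by finiteness) (by finiteness), ENNReal.toReal_ofReal hD0]
        rfl

end Environment

/-! ### Mean positions and increments over a block -/

theorem map_shift_infinitePi {α : Type*} [MeasurableSpace α] (μ : Measure α)
    [IsProbabilityMeasure μ] (m : ℕ) :
    (Measure.infinitePi fun _ : ℕ => μ).map (fun u k => u (m + k)) =
      Measure.infinitePi fun _ : ℕ => μ := by
  classical
  refine Measure.eq_infinitePi _ fun s t ht => ?_
  have h1 : (fun (u : ℕ → α) k => u (m + k)) ⁻¹' Set.pi (s : Set ℕ) t =
      Set.pi (s.map (addLeftEmbedding m) : Finset ℕ) (fun i => t (i - m)) := by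
    ext u
    simp only [Set.mem_preimage, Set.mem_pi, Finset.mem_coe, Finset.mem_map,
      addLeftEmbedding_apply]
    constructor
    · rintro h _ ⟨i, hi, rfl⟩
      simpa using h i hi
    · intro h i hi
      simpa using h (m + i) ⟨i, hi, rfl⟩
  rw [Measure.map_apply (by fun_prop) (MeasurableSet.pi (Finset.countable_toSet _)
    fun i _ => ht i), h1, Measure.infinitePi_pi _ fun i _ => ht (i - m), Finset.prod_map]
  simp

namespace Environment

variable {E : Environment} {p₀ p₁ : ℝ}

/-- The law of the variables that drive the walk. -/
abbrev driving : Measure (ℕ → unitInterval) :=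
  Measure.infinitePi (fun _ : ℕ => (volume : Measure unitInterval))

/-- The mean position at time `m` of the walk in the environment that is never refreshed. -/
def meanPosition (E : Environment) (p₀ p₁ ρ : ℝ) (m : ℕ) : ℝ :=
  ∫ w, (traj p₀ p₁ w.2 0 0 w.1 m : ℝ) ∂((E.annealed ρ).prod driving)

theorem measurable_traj_pair (m : ℕ) (x : ℤ) (k : ℕ) :
    Measurable fun w : EnvPath × (ℕ → unitInterval) => traj p₀ p₁ w.2 m x w.1 k :=
  (measurable_pi_apply k).comp ((measurable_traj p₀ p₁ m).comp
    (f := fun w : EnvPath × (ℕ → unitInterval) => ((w.2, x), w.1)) (by fun_prop))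

theorem abs_traj_le (u : ℕ → unitInterval) (ζ : EnvPath) (k : ℕ) :
    |(traj p₀ p₁ u 0 0 ζ k : ℝ)| ≤ k := by
  have := (isPath_traj p₀ p₁ u 0 0 ζ).abs_le 0 k
  simp only [zero_add, traj, abs_zero] at this
  exact_mod_cast this

theorem integrable_traj (ρ : ℝ) (k : ℕ) :
    Integrable (fun w : EnvPath × (ℕ → unitInterval) => (traj p₀ p₁ w.2 0 0 w.1 k : ℝ))
      ((E.annealed ρ).prod driving) := by
  refine Integrable.of_bound ((measurable_from_top (f := fun z : ℤ => (z : ℝ))).comp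
    (measurable_traj_pair 0 0 k)).aestronglyMeasurable k (Filter.Eventually.of_forall fun w => ?_)
  rw [Real.norm_eq_abs]
  exact abs_traj_le w.2 w.1 k

theorem abs_meanPosition_le (ρ : ℝ) (k : ℕ) : |E.meanPosition p₀ p₁ ρ k| ≤ k := by
  unfold meanPosition
  rw [← Real.norm_eq_abs]
  refine (norm_integral_le_of_norm_le_const (C := k)
    (Filter.Eventually.of_forall fun w => ?_)).trans_eq (by simp)
  rw [Real.norm_eq_abs]
  exact abs_traj_le w.2 w.1 k

theorem abs_meanPosition_sub_le (ρ : ℝ) (m k : ℕ) :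
    |E.meanPosition p₀ p₁ ρ (m + k) - E.meanPosition p₀ p₁ ρ m| ≤ k := by
  unfold meanPosition
  rw [← integral_sub (integrable_traj ρ _) (integrable_traj ρ _), ← Real.norm_eq_abs]
  refine (norm_integral_le_of_norm_le_const (C := k)
    (Filter.Eventually.of_forall fun w => ?_)).trans_eq (by simp)
  rw [Real.norm_eq_abs, abs_le]
  have := (isPath_traj p₀ p₁ w.2 0 0 w.1).le m k
  constructor
  · have : (traj p₀ p₁ w.2 0 0 w.1 m : ℝ) - k ≤ traj p₀ p₁ w.2 0 0 w.1 (m + k) := by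
      exact_mod_cast this.1
    linarith
  · have : (traj p₀ p₁ w.2 0 0 w.1 (m + k) : ℝ) ≤ traj p₀ p₁ w.2 0 0 w.1 m + k := by
      exact_mod_cast this.2
    linarith

/-- A refresh at time `n` comes too late to influence the position at time `n`. -/
theorem speed_eq (ρ : ℝ) (n : ℕ) : speed E p₀ p₁ ρ n = E.meanPosition p₀ p₁ ρ n / n := by
  have hmap : (walkLaw E p₀ p₁ ρ n).map (fun X => X n) =
      ((E.annealed ρ).prod driving).map (fun w => traj p₀ p₁ w.2 0 0 w.1 n) := by
    ext A hA
    have hF : Measurable (((fun X : ℕ → ℤ => X n) ⁻¹' A).indicator (1 : (ℕ → ℤ) → ℝ≥0∞)) :=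
      measurable_one.indicator (measurable_pi_apply n hA)
    have hdep : DependsUpTo n (((fun X : ℕ → ℤ => X n) ⁻¹' A).indicator
        (1 : (ℕ → ℤ) → ℝ≥0∞)) := by
      intro h h' hh
      have := hh n le_rfl
      have hmem : h ∈ (fun X : ℕ → ℤ => X n) ⁻¹' A ↔ h' ∈ (fun X : ℕ → ℤ => X n) ⁻¹' A := by
        rw [Set.mem_preimage, Set.mem_preimage, this]
      by_cases hA : h' ∈ (fun X : ℕ → ℤ => X n) ⁻¹' A
      · rw [Set.indicator_of_mem hA, Set.indicator_of_mem (hmem.2 hA)]; rfl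
      · rw [Set.indicator_of_notMem hA, Set.indicator_of_notMem fun h => hA (hmem.1 h)]
    have hpair := (measurable_traj_pair (p₀ := p₀) (p₁ := p₁) 0 0 n hA)
    rw [Measure.map_apply (measurable_pi_apply n) hA,
      ← lintegral_indicator_one (measurable_pi_apply n hA), lintegral_walkLaw hF,
      Measure.map_apply (measurable_traj_pair 0 0 n) hA, ← lintegral_indicator_one hpair,
      lintegral_prod_symm' _ (measurable_one.indicator hpair)]
    refine lintegral_congr fun u => ?_
    rw [lintegral_traj_concat_of_le le_rfl hF hdep]
    rfl
  unfold speed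
  rw [integral_div]
  congr 1
  have h1 : ∫ X, (X n : ℝ) ∂(walkLaw E p₀ p₁ ρ n) =
      ∫ z : ℤ, (z : ℝ) ∂((walkLaw E p₀ p₁ ρ n).map fun X => X n) := by
    rw [integral_map (measurable_pi_apply n).aemeasurable
      measurable_from_top.aestronglyMeasurable]
  rw [h1, hmap, integral_map (measurable_traj_pair 0 0 n).aemeasurable
    measurable_from_top.aestronglyMeasurable]
  rfl

/-- The normalized increment of a path over `[m, m + L]`. -/
def increment (L m : ℕ) (h : ℕ → ℤ) : ℝ≥0∞ :=
  -- The truncation gives the bound by `1` on all sequences, as the block estimate requires; it is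
  -- inactive on nearest-neighbour paths.
  ENNReal.ofReal (min 1 ((((h (m + L) - h m : ℤ) : ℝ) + L) / (2 * L)))

theorem measurable_increment (L m : ℕ) : Measurable (increment L m) := by
  unfold increment
  refine ENNReal.measurable_ofReal.comp (measurable_const.min ?_)
  refine (Measurable.add_const ((measurable_from_top (f := fun z : ℤ => (z : ℝ))).comp ?_)
    _).div_const _
  fun_prop

theorem increment_le_one (L m : ℕ) (h : ℕ → ℤ) : increment L m h ≤ 1 := by
  unfold increment
  rw [← ENNReal.ofReal_one]
  exact ENNReal.ofReal_le_ofReal (min_le_left _ _)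

theorem increment_eq_of_isPath {L m : ℕ} (hL : 0 < L) {h : ℕ → ℤ} (P : IsPath h) :
    increment L m h = ENNReal.ofReal ((((h (m + L) - h m : ℤ) : ℝ) + L) / (2 * L)) := by
  unfold increment
  rw [min_eq_right]
  rw [div_le_one (by positivity)]
  have := P.le m L
  have : ((h (m + L) - h m : ℤ) : ℝ) ≤ L := by exact_mod_cast (by omega : h (m + L) - h m ≤ L)
  linarith

/-- The path `s ↦ s` moved so that it visits `0` at time `m`. -/
def line (m : ℕ) : ℕ → ℤ := fun s => s - m

theorem isPath_line (m : ℕ) : IsPath (line m) := fun s => by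
  left; simp only [line]; push_cast; ring

theorem line_self (m : ℕ) : line m m = 0 := by simp [line]

theorem lintegral_increment {ρ : ℝ} {L : ℕ} (hL : 0 < L) (m : ℕ) :
    ∫⁻ u, ∫⁻ η, E.stageValue p₀ p₁ u (m + L) 0 (fun h _ => increment L m h) (line 0) η ∂(E.μ ρ)
      ∂driving =
      ENNReal.ofReal ((E.meanPosition p₀ p₁ ρ (m + L) - E.meanPosition p₀ p₁ ρ m + L) /
        (2 * L)) := by
  have hm : Measurable fun w : EnvPath × (ℕ → unitInterval) =>
      increment L m (traj p₀ p₁ w.2 0 0 w.1) :=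
    (measurable_increment L m).comp ((measurable_traj p₀ p₁ 0).comp
      (f := fun w : EnvPath × (ℕ → unitInterval) => ((w.2, (0 : ℤ)), w.1)) (by fun_prop))
  have h1 : ∀ u, ∫⁻ η, E.stageValue p₀ p₁ u (m + L) 0 (fun h _ => increment L m h) (line 0) η
      ∂(E.μ ρ) = ∫⁻ ζ, increment L m (traj p₀ p₁ u 0 0 ζ) ∂(E.annealed ρ) := by
    intro u
    have : Measurable fun ζ : EnvPath => increment L m (traj p₀ p₁ u 0 0 ζ) :=
      hm.comp (f := fun ζ : EnvPath => (ζ, u)) (by fun_prop)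
    rw [lintegral_annealed _ this]
    unfold stageValue
    simp only [extendPath_zero (line_self 0)]
  have h2 : ∀ w : EnvPath × (ℕ → unitInterval), increment L m (traj p₀ p₁ w.2 0 0 w.1) =
      ENNReal.ofReal (((traj p₀ p₁ w.2 0 0 w.1 (m + L) : ℝ) - traj p₀ p₁ w.2 0 0 w.1 m + L) /
        (2 * L)) := by
    intro w
    rw [increment_eq_of_isPath hL (isPath_traj p₀ p₁ w.2 0 0 w.1)]
    push_cast
    rfl
  have hint : Integrable (fun w : EnvPath × (ℕ → unitInterval) =>
      ((traj p₀ p₁ w.2 0 0 w.1 (m + L) : ℝ) - traj p₀ p₁ w.2 0 0 w.1 m + L) / (2 * L))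
      ((E.annealed ρ).prod driving) :=
    (((integrable_traj ρ _).sub (integrable_traj ρ _)).add (integrable_const _)).div_const _
  simp only [h1]
  rw [← lintegral_prod_symm' _ hm]
  simp only [h2]
  rw [← ofReal_integral_eq_lintegral_ofReal hint (Filter.Eventually.of_forall fun w => ?_)]
  · congr 1
    have hsub : Integrable (fun w : EnvPath × (ℕ → unitInterval) =>
        (traj p₀ p₁ w.2 0 0 w.1 (m + L) : ℝ) - traj p₀ p₁ w.2 0 0 w.1 m)
        ((E.annealed ρ).prod driving) := (integrable_traj ρ _).sub (integrable_traj ρ _)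
    rw [integral_div, integral_add hsub (integrable_const _),
      integral_sub (integrable_traj ρ _) (integrable_traj ρ _)]
    simp [meanPosition]
  · refine div_nonneg ?_ (by positivity)
    have := ((isPath_traj p₀ p₁ w.2 0 0 w.1).le m L).1
    have : (traj p₀ p₁ w.2 0 0 w.1 m : ℝ) - L ≤ traj p₀ p₁ w.2 0 0 w.1 (m + L) := by
      exact_mod_cast this
    linarith

/-- The increment of a walk that starts from `0` at time `m` in a fresh environment. -/
theorem lintegral_increment_line {ρ : ℝ} {L : ℕ} (hL : 0 < L) (m : ℕ) :
    ∫⁻ u, ∫⁻ η, E.stageValue p₀ p₁ u L m (fun h _ => increment L m h) (line m) η ∂(E.μ ρ)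
      ∂driving = ENNReal.ofReal ((E.meanPosition p₀ p₁ ρ L + L) / (2 * L)) := by
  let φ : (ℕ → unitInterval) → ℝ≥0∞ := fun u =>
    ∫⁻ η, E.stageValue p₀ p₁ u (0 + L) 0 (fun h _ => increment L 0 h) (line 0) η ∂(E.μ ρ)
  have hm : Measurable fun w : EnvPath × (ℕ → unitInterval) =>
      increment L 0 (traj p₀ p₁ w.2 0 0 w.1) :=
    (measurable_increment L 0).comp ((measurable_traj p₀ p₁ 0).comp
      (f := fun w : EnvPath × (ℕ → unitInterval) => ((w.2, (0 : ℤ)), w.1)) (by fun_prop))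
  have hφ : φ = fun u => ∫⁻ ζ, increment L 0 (traj p₀ p₁ u 0 0 ζ) ∂(E.annealed ρ) := by
    funext u
    have : Measurable fun ζ : EnvPath => increment L 0 (traj p₀ p₁ u 0 0 ζ) :=
      hm.comp (f := fun ζ : EnvPath => (ζ, u)) (by fun_prop)
    rw [lintegral_annealed _ this]
    simp only [φ, stageValue, extendPath_zero (line_self 0)]
  have mφ : Measurable φ := by
    rw [hφ]
    exact Measurable.lintegral_prod_left' hm
  have h1 : ∀ u : ℕ → unitInterval, ∫⁻ η, E.stageValue p₀ p₁ u L m (fun h _ => increment L m h)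
      (line m) η ∂(E.μ ρ) = φ (fun k => u (m + k)) := by
    intro u
    simp only [φ, stageValue, extendPath_zero (line_self 0)]
    refine lintegral_congr fun η => lintegral_congr fun ζ => ?_
    unfold increment
    have h2 := extendPath_add (p₀ := p₀) (p₁ := p₁) (u := u) (m := m) (h := line m) (ζ := ζ) L
    rw [h2, extendPath_of_le le_rfl, line_self, traj_shift_index, zero_add]
    rfl
  simp only [h1]
  -- The driving variables from time `m` on have the same law as those from time `0` on.
  have h3 := lintegral_map (μ := driving) mφ
    (by fun_prop : Measurable fun (u : ℕ → unitInterval) k => u (m + k))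
  rw [← h3, driving, map_shift_infinitePi]
  have h4 := lintegral_increment (E := E) (p₀ := p₀) (p₁ := p₁) (ρ := ρ) hL 0
  have h5 : E.meanPosition p₀ p₁ ρ 0 = 0 := by simp [meanPosition, traj]
  rw [h5, sub_zero, zero_add] at h4
  rw [← h4]
  simp only [φ, zero_add]

/-- Comparison of the increments of two walks over one block. -/
theorem Scale.stageValue_increment_le {ν C C' ρ δ : ℝ} {L t N M H : ℕ}
    (S : E.Scale ν C ρ δ L t N M H) (hE : E.MarkovInvariant) (hN : E.NoDriftIn ν)
    (hC : E.CoveringWith ν C C') (hp : p₀ ≤ p₁) {u : ℕ → unitInterval} {m H' : ℕ}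
    {h₁ h₂ : ℕ → ℤ} (P₁ : IsPath h₁) (P₂ : IsPath h₂) (hrange : |h₂ m| + L ≤ N)
    (hd : H + |h₁ m - h₂ m + 2 * t| ≤ H') (η₁ η₂ : Config) :
    E.stageValue p₀ p₁ u L m (fun h _ => increment L m h) h₁ η₁ ≤
      E.stageValue p₀ p₁ u L m (fun h _ => increment L m h) h₂ η₂ +
      (Sparse (ρ + δ / 4) ⌊(t : ℝ) ^ (1 / 4 : ℝ)⌋₊ H')ᶜ.indicator 1 η₁ +
      (Dense (ρ + 3 * δ / 4) ⌊(t : ℝ) ^ (1 / 4 : ℝ)⌋₊ H')ᶜ.indicator 1 η₂ +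
      (ENNReal.ofReal (t / L) + blockError ν C' δ L t H) := by
  have hL : 0 < L := lt_of_lt_of_le S.one_le S.le_block
  have hL' : (0 : ℝ) < L := by exact_mod_cast hL
  set bad₁ := (Sparse (ρ + δ / 4) ⌊(t : ℝ) ^ (1 / 4 : ℝ)⌋₊ H')ᶜ with hbad₁
  set bad₂ := (Dense (ρ + 3 * δ / 4) ⌊(t : ℝ) ^ (1 / 4 : ℝ)⌋₊ H')ᶜ with hbad₂
  by_cases b₁ : η₁ ∈ bad₁
  · refine (stageValue_le_one (fun h _ => increment_le_one L m h) h₁ η₁).trans ?_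
    have : bad₁.indicator (1 : Config → ℝ≥0∞) η₁ = 1 := Set.indicator_of_mem b₁ _
    rw [this]
    exact le_add_right (le_add_right le_add_self)
  by_cases b₂ : η₂ ∈ bad₂
  · refine (stageValue_le_one (fun h _ => increment_le_one L m h) h₁ η₁).trans ?_
    have : bad₂.indicator (1 : Config → ℝ≥0∞) η₂ = 1 := Set.indicator_of_mem b₂ _
    rw [this]
    exact le_add_right le_add_self
  have mG : Measurable (Function.uncurry fun (h : ℕ → ℤ) (_ : Config) => increment L m h) :=
    (measurable_increment L m).comp measurable_fst
  -- The shift is the exact gap at time `m`, so order and parity are automatic there. The loss `2 *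
  -- t` becomes `t / L` after normalization by `2 * L`.
  have key := S.stageValue_le (u := u) hE hN hC hp (H' := H') (m := m) (d := h₁ m - h₂ m) P₁ P₂
    (G₁ := fun h _ => increment L m h)
    (G₂ := fun h η => (fun h (_ : Config) => increment L m h) h η + ENNReal.ofReal (t / L))
    (e₁ := fun _ => 0) (e₂ := fun _ => 0) (by simp) (by simp) hrange hd
    (not_not.1 b₁) (not_not.1 b₂) mG (mG.add_const _) measurable_const measurable_const
    (fun h _ => increment_le_one L m h) (fun k₁ k₂ _ _ Q₁ Q₂ a₁ a₂ hk => by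
      have hh := hk L le_rfl
      rw [add_zero, add_zero, increment_eq_of_isPath hL Q₁]
      change _ ≤ increment L m k₂ + _
      rw [increment_eq_of_isPath hL Q₂, a₁ m le_rfl, a₂ m le_rfl,
        ← ENNReal.ofReal_add ?_ (by positivity)]
      · refine ENNReal.ofReal_le_ofReal ?_
        have h3 : ((k₁ (m + L) - h₁ m : ℤ) : ℝ) ≤ (k₂ (m + L) - h₂ m : ℤ) + 2 * t := by
          exact_mod_cast (by linarith : k₁ (m + L) - h₁ m ≤ k₂ (m + L) - h₂ m + 2 * t)
        have h4 : (t : ℝ) / L = 2 * t / (2 * L) := by field_simp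
        rw [h4, ← add_div]
        exact div_le_div_of_nonneg_right (by linarith) (by positivity)
      · refine div_nonneg ?_ (by positivity)
        have := (Q₂.le m L).1
        rw [a₂ m le_rfl] at this
        have : -(L : ℝ) ≤ (k₂ (m + L) - h₂ m : ℤ) := by
          exact_mod_cast (by linarith : -(L : ℤ) ≤ k₂ (m + L) - h₂ m)
        linarith)
  rw [stageValue_add_const (E := E) (p₀ := p₀) (p₁ := p₁) (u := u)
    (fun h (_ : Config) => increment L m h)] at key
  have i₁ : bad₁.indicator (1 : Config → ℝ≥0∞) η₁ = 0 := Set.indicator_of_notMem b₁ _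
  have i₂ : bad₂.indicator (1 : Config → ℝ≥0∞) η₂ = 0 := Set.indicator_of_notMem b₂ _
  rw [i₁, i₂]
  refine key.trans_eq ?_
  simp [add_assoc]

/-- Undoes the normalization: `t / L` becomes `2 * t`, and a failure probability `D` costs `2 * L *
D`. -/
theorem le_of_ofReal_increment_le {a b : ℝ} {L t : ℕ} (hL : 0 < L) {D : ℝ} (hD : 0 ≤ D)
    (hb : -(L : ℝ) ≤ b)
    (h : ENNReal.ofReal ((a + L) / (2 * L)) ≤ ENNReal.ofReal ((b + L) / (2 * L)) +
      (ENNReal.ofReal (t / L) + ENNReal.ofReal D)) : a ≤ b + 2 * t + 2 * L * D := by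
  have hL' : (0 : ℝ) < L := by exact_mod_cast hL
  have hb' : 0 ≤ (b + L) / (2 * L) := div_nonneg (by linarith) (by positivity)
  rw [← ENNReal.ofReal_add (by positivity) hD, ← ENNReal.ofReal_add hb' (by positivity),
    ENNReal.ofReal_le_ofReal_iff (by positivity)] at h
  have h1 := mul_le_mul_of_nonneg_right h (by positivity : (0 : ℝ) ≤ 2 * L)
  have h2 : (a + L) / (2 * L) * (2 * L) = a + L := by field_simp
  have h3 : ((b + L) / (2 * L) + (t / L + D)) * (2 * L) = b + L + 2 * t + 2 * L * D := by
    field_simp; ring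
  rw [h2, h3] at h1
  linarith

theorem lintegral_le_add_const {α : Type*} [MeasurableSpace α] {μ : Measure α}
    [IsProbabilityMeasure μ] {f g : α → ℝ≥0∞} {c : ℝ≥0∞} (h : ∀ a, f a ≤ g a + c) :
    ∫⁻ a, f a ∂μ ≤ ∫⁻ a, g a ∂μ + c := by
  refine (lintegral_mono h).trans_eq ?_
  rw [lintegral_add_right _ measurable_const]
  simp

theorem measurable_stageValue_increment {u : ℕ → unitInterval} (L m : ℕ) :
    Measurable (Function.uncurry (E.stageValue p₀ p₁ u L m (fun h _ => increment L m h))) :=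
  measurable_stageValue ((measurable_increment L m).comp measurable_fst)

theorem MarkovInvariant.stageValue_increment_add (hE : E.MarkovInvariant) {u : ℕ → unitInterval}
    (L m : ℕ) (η : Config) :
    E.stageValue p₀ p₁ u (m + L) 0 (fun h _ => increment L m h) (line 0) η =
      E.stageValue p₀ p₁ u m 0 (E.stageValue p₀ p₁ u L m (fun h _ => increment L m h))
        (line 0) η := by
  rw [hE.stageValue_add (G := fun h _ => increment L m h)
    ((measurable_increment L m).comp measurable_fst), zero_add]

theorem abs_extendPath_line_le {u : ℕ → unitInterval} (ζ : EnvPath) (m : ℕ) :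
    |extendPath p₀ p₁ u 0 (line 0) ζ m| ≤ m := by
  rw [extendPath_zero (line_self 0)]
  have := (isPath_traj p₀ p₁ u 0 0 ζ).abs_le 0 m
  simpa [traj] using this

/-- The walk of smaller density without refresh, compared over a block with a fresh walk. -/
theorem Scale.meanPosition_sub_le {ν C C' ρ δ : ℝ} {L t N M H : ℕ} (S : E.Scale ν C ρ δ L t N M H)
    (hE : E.MarkovInvariant) (hS : E.Stationary) (hN : E.NoDriftIn ν) (hC : E.CoveringWith ν C C')
    (hp : p₀ ≤ p₁) {ρ' : ℝ} {m H' : ℕ} (hm : m + L ≤ N) (hH' : H + m + 2 * t ≤ H')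
    {D : ℝ} (hD0 : 0 ≤ D)
    (hD : E.μ ρ (Sparse (ρ + δ / 4) ⌊(t : ℝ) ^ (1 / 4 : ℝ)⌋₊ H')ᶜ +
        E.μ ρ' (Dense (ρ + 3 * δ / 4) ⌊(t : ℝ) ^ (1 / 4 : ℝ)⌋₊ H')ᶜ +
        blockError ν C' δ L t H ≤ ENNReal.ofReal D) :
    E.meanPosition p₀ p₁ ρ (m + L) - E.meanPosition p₀ p₁ ρ m ≤
      E.meanPosition p₀ p₁ ρ' L + 2 * t + 2 * L * D := by
  have hL : 0 < L := lt_of_lt_of_le S.one_le S.le_block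
  have mS := (measurableSet_sparse (ρ + δ / 4) ⌊(t : ℝ) ^ (1 / 4 : ℝ)⌋₊ H').compl
  have mD := (measurableSet_dense (ρ + 3 * δ / 4) ⌊(t : ℝ) ^ (1 / 4 : ℝ)⌋₊ H').compl
  set bad₁ := (Sparse (ρ + δ / 4) ⌊(t : ℝ) ^ (1 / 4 : ℝ)⌋₊ H')ᶜ
  set bad₂ := (Dense (ρ + 3 * δ / 4) ⌊(t : ℝ) ^ (1 / 4 : ℝ)⌋₊ H')ᶜ
  refine le_of_ofReal_increment_le hL hD0
    ((neg_le_of_abs_le (abs_meanPosition_le ρ' L))) ?_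
  rw [← lintegral_increment hL m, ← lintegral_increment_line hL m]
  refine lintegral_le_add_const fun u => ?_
  set c := ∫⁻ η, E.stageValue p₀ p₁ u L m (fun h _ => increment L m h) (line m) η ∂(E.μ ρ')
  -- The past up to time `m` and the environment `η` at that time are fixed; the average is over a
  -- fresh environment for the second walk.
  have hquenched : ∀ h : ℕ → ℤ, IsPath h → |h m| ≤ m → ∀ η,
      E.stageValue p₀ p₁ u L m (fun h _ => increment L m h) h η ≤ bad₁.indicator 1 η +
        (c + E.μ ρ' bad₂ + (ENNReal.ofReal (t / L) + blockError ν C' δ L t H)) := by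
    intro h P hh η
    have key := lintegral_le_of_forall_le (μ := E.μ ρ) (ν := E.μ ρ')
      (f := fun _ => E.stageValue p₀ p₁ u L m (fun h _ => increment L m h) h η)
      (e := fun _ => bad₁.indicator 1 η) measurable_const measurable_const
      ((measurable_stageValue_increment L m).comp (f := fun η : Config => (line m, η))
        (by fun_prop)) (measurable_one.indicator mD)
      (ENNReal.ofReal (t / L) + blockError ν C' δ L t H)
      (fun _ η' => S.stageValue_increment_le hE hN hC hp P (isPath_line m)
        (by rw [line_self]; simp; omega) (by
          rw [line_self, sub_zero]
          have h1 := neg_abs_le (h m)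
          have h2 := le_abs_self (h m)
          have : |h m + 2 * t| ≤ m + 2 * t := by rw [abs_le]; constructor <;> linarith
          have : (H : ℤ) + m + 2 * t ≤ H' := by exact_mod_cast hH'
          linarith) η η')
    rw [lintegral_const, measure_univ, mul_one, lintegral_const, measure_univ, mul_one,
      lintegral_indicator_one mD] at key
    exact key.trans_eq (by simp only [c, Function.comp_apply, Function.uncurry_apply_pair]; ring)
  -- By stationarity the environment at time `m` has law `E.μ ρ`, whatever the walk did.
  have hsum : ∫⁻ η, ∫⁻ ζ, (bad₁.indicator 1 (ζ m) +
        (c + E.μ ρ' bad₂ + (ENNReal.ofReal (t / L) + blockError ν C' δ L t H))) ∂(E.P η) ∂(E.μ ρ) =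
      E.μ ρ bad₁ + (c + E.μ ρ' bad₂ + (ENNReal.ofReal (t / L) + blockError ν C' δ L t H)) := by
    rw [hS.lintegral_eq S.rho_mem m (g := fun η => bad₁.indicator 1 η +
      (c + E.μ ρ' bad₂ + (ENNReal.ofReal (t / L) + blockError ν C' δ L t H)))
      ((measurable_one.indicator mS).add_const _), lintegral_add_right _ measurable_const,
      lintegral_indicator_one mS]
    simp
  calc _ ≤ _ := lintegral_mono fun η => by
        rw [hE.stageValue_increment_add]
        exact lintegral_mono fun ζ => hquenched _ (isPath_line 0).extendPath
          (abs_extendPath_line_le ζ m) (ζ m)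
    _ = _ := hsum
    _ = c + (ENNReal.ofReal (t / L) + (E.μ ρ bad₁ + E.μ ρ' bad₂ + blockError ν C' δ L t H)) := by
        ring
    _ ≤ _ := by gcongr

/-- A fresh walk of smaller density, compared over a block with the walk without refresh. -/
theorem Scale.meanPosition_le_sub {ν C C' ρ δ : ℝ} {L t N M H : ℕ} (S : E.Scale ν C ρ δ L t N M H)
    (hE : E.MarkovInvariant) (hS : E.Stationary) (hN : E.NoDriftIn ν) (hC : E.CoveringWith ν C C')
    (hp : p₀ ≤ p₁) {ρ' : ℝ} (hρ' : ρ' ∈ E.J) {m H' : ℕ} (hm : m + L ≤ N)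
    (hH' : H + m + 2 * t ≤ H') {D : ℝ} (hD0 : 0 ≤ D)
    (hD : E.μ ρ (Sparse (ρ + δ / 4) ⌊(t : ℝ) ^ (1 / 4 : ℝ)⌋₊ H')ᶜ +
        E.μ ρ' (Dense (ρ + 3 * δ / 4) ⌊(t : ℝ) ^ (1 / 4 : ℝ)⌋₊ H')ᶜ +
        blockError ν C' δ L t H ≤ ENNReal.ofReal D) :
    E.meanPosition p₀ p₁ ρ L ≤
      E.meanPosition p₀ p₁ ρ' (m + L) - E.meanPosition p₀ p₁ ρ' m + 2 * t + 2 * L * D := by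
  have hL : 0 < L := lt_of_lt_of_le S.one_le S.le_block
  have mS := (measurableSet_sparse (ρ + δ / 4) ⌊(t : ℝ) ^ (1 / 4 : ℝ)⌋₊ H').compl
  have mD := (measurableSet_dense (ρ + 3 * δ / 4) ⌊(t : ℝ) ^ (1 / 4 : ℝ)⌋₊ H').compl
  set bad₁ := (Sparse (ρ + δ / 4) ⌊(t : ℝ) ^ (1 / 4 : ℝ)⌋₊ H')ᶜ
  set bad₂ := (Dense (ρ + 3 * δ / 4) ⌊(t : ℝ) ^ (1 / 4 : ℝ)⌋₊ H')ᶜ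
  refine le_of_ofReal_increment_le hL hD0
    ((neg_le_of_abs_le (abs_meanPosition_sub_le ρ' m L))) ?_
  rw [← lintegral_increment hL m, ← lintegral_increment_line hL m]
  refine lintegral_le_add_const fun u => ?_
  set c := ∫⁻ η, E.stageValue p₀ p₁ u L m (fun h _ => increment L m h) (line m) η ∂(E.μ ρ)
  set K := E.μ ρ bad₁ + (ENNReal.ofReal (t / L) + blockError ν C' δ L t H) with hK
  have mV := measurable_stageValue_increment (E := E) (p₀ := p₀) (p₁ := p₁) (u := u) L m
  -- Here the fresh environment is the sparser one and is averaged, while the current environment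
  -- `η'` of the second walk is fixed.
  have hquenched : ∀ h : ℕ → ℤ, IsPath h → |h m| ≤ m → ∀ η',
      c ≤ E.stageValue p₀ p₁ u L m (fun h _ => increment L m h) h η' +
        (bad₂.indicator 1 η' + K) := by
    intro h P hh η'
    have key := lintegral_le_of_forall_le (μ := E.μ ρ) (ν := E.μ ρ')
      (g := fun _ => E.stageValue p₀ p₁ u L m (fun h _ => increment L m h) h η')
      (g' := fun _ => bad₂.indicator 1 η')
      (mV.comp (f := fun η : Config => (line m, η)) (by fun_prop)) (measurable_one.indicator mS)
      measurable_const measurable_const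
      (ENNReal.ofReal (t / L) + blockError ν C' δ L t H)
      (fun η _ => S.stageValue_increment_le hE hN hC hp (isPath_line m) P
        (by have : (m : ℤ) + L ≤ N := by exact_mod_cast hm
            linarith) (by
          rw [line_self, zero_sub]
          have h1 := neg_abs_le (h m)
          have h2 := le_abs_self (h m)
          have : |-h m + 2 * t| ≤ m + 2 * t := by rw [abs_le]; constructor <;> linarith
          have : (H : ℤ) + m + 2 * t ≤ H' := by exact_mod_cast hH'
          linarith) η η')
    rw [lintegral_const, measure_univ, mul_one, lintegral_const, measure_univ, mul_one,
      lintegral_indicator_one mS] at key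
    exact key.trans_eq (by rw [hK]; ring)
  have hsum : ∫⁻ η, ∫⁻ ζ, (bad₂.indicator 1 (ζ m) + K) ∂(E.P η) ∂(E.μ ρ') = E.μ ρ' bad₂ + K := by
    rw [hS.lintegral_eq hρ' m (g := fun η => bad₂.indicator 1 η + K)
      ((measurable_one.indicator mD).add_const _), lintegral_add_right _ measurable_const,
      lintegral_indicator_one mD]
    simp
  calc c = ∫⁻ η, ∫⁻ _, c ∂(E.P η) ∂(E.μ ρ') := by simp
    _ ≤ ∫⁻ η, (E.stageValue p₀ p₁ u (m + L) 0 (fun h _ => increment L m h) (line 0) η +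
          ∫⁻ ζ, (bad₂.indicator 1 (ζ m) + K) ∂(E.P η)) ∂(E.μ ρ') := by
        refine lintegral_mono fun η => ?_
        rw [hE.stageValue_increment_add]
        have m1 := measurable_extendPath_apply (p₀ := p₀) (p₁ := p₁) (u := u) (m := 0) (T := m) mV
          (line 0)
        simp only [stageValue] at m1 ⊢
        rw [← lintegral_add_left m1]
        exact lintegral_mono fun ζ => hquenched _ (isPath_line 0).extendPath
          (abs_extendPath_line_le ζ m) (ζ m)
    _ = ∫⁻ η, E.stageValue p₀ p₁ u (m + L) 0 (fun h _ => increment L m h) (line 0) η ∂(E.μ ρ') +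
          (E.μ ρ' bad₂ + K) := by
        have m2 : Measurable fun η =>
            E.stageValue p₀ p₁ u (m + L) 0 (fun h _ => increment L m h) (line 0) η :=
          (measurable_stageValue (T := m + L) (G := fun h _ => increment L m h)
            ((measurable_increment L m).comp measurable_fst)).comp
            (f := fun η : Config => (line 0, η)) (by fun_prop)
        rw [lintegral_add_left m2, hsum]
    _ ≤ _ := by
        have : E.μ ρ' bad₂ + K = ENNReal.ofReal (t / L) +
            (E.μ ρ bad₁ + E.μ ρ' bad₂ + blockError ν C' δ L t H) := by rw [hK]; ring
        rw [this]
        gcongr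

/-- Environments ordered from the start make the first block free of error; this is the base of the
summation over blocks. -/
theorem Monotonicity.meanPosition_mono (hM : E.Monotonicity) (hp : p₀ ≤ p₁) {ρ ρ' : ℝ}
    (hρ : ρ ∈ E.J) (hρ' : ρ' ∈ E.J) (hle : ρ ≤ ρ') (L : ℕ) :
    E.meanPosition p₀ p₁ ρ L ≤ E.meanPosition p₀ p₁ ρ' L := by
  rcases Nat.eq_zero_or_pos L with rfl | hL
  · simp [meanPosition, traj]
  have h0 : ∀ ρ, E.meanPosition p₀ p₁ ρ 0 = 0 := fun ρ => by simp [meanPosition, traj]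
  have key : ENNReal.ofReal ((E.meanPosition p₀ p₁ ρ L + L) / (2 * L)) ≤
      ENNReal.ofReal ((E.meanPosition p₀ p₁ ρ' L + L) / (2 * L)) +
        (ENNReal.ofReal ((0 : ℕ) / L) + ENNReal.ofReal 0) := by
    rw [← lintegral_increment_line hL 0, ← lintegral_increment_line hL 0]
    simp only [Nat.cast_zero, zero_div, ENNReal.ofReal_zero, add_zero]
    refine lintegral_mono fun u => ?_
    have mG : Measurable (Function.uncurry fun (h : ℕ → ℤ) (_ : Config) => increment L 0 h) :=
      (measurable_increment L 0).comp measurable_fst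
    have := hM.lintegral_stageValue_le (u := u) hp hρ hρ' hle (L := L) (isPath_line 0) mG mG
      (e₁ := fun _ => 0) (e₂ := fun _ => 0) measurable_const measurable_const
      (fun h₁ h₂ _ _ P₁ P₂ a₁ a₂ hk => by
        rw [add_zero, add_zero]
        unfold increment
        rw [a₁, a₂]
        refine ENNReal.ofReal_le_ofReal (min_le_min_left _ ?_)
        gcongr
        exact hk _)
    simpa using this
  have := le_of_ofReal_increment_le hL le_rfl (neg_le_of_abs_le (abs_meanPosition_le ρ' L)) key
  simpa using this

end Environment

/-! ### Density estimates at stationarity -/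

namespace Environment

variable {E : Environment}

/-- The density estimate with its constant `c` fixed. -/
def DensityWith (E : Environment) (c : ℝ) : Prop :=
  ∀ ρ ∈ E.J, ∀ ε : ℝ, 0 < ε → ε < 1 → ∀ l : ℕ, 1 ≤ l → ∀ a : ℤ,
    (E.annealed ρ).real {η | ε * l ≤ |(particles (η 0) a l : ℝ) - ρ * l|} ≤
      2 * Real.exp (-(c * ε ^ 2 * l))

theorem map_eval_zero_annealed (ρ : ℝ) : (E.annealed ρ).map (fun ζ => ζ 0) = E.μ ρ := by
  ext A hA
  have hpre : MeasurableSet ((fun ζ : EnvPath => ζ 0) ⁻¹' A) := measurable_pi_apply 0 hA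
  rw [Measure.map_apply (measurable_pi_apply 0) hA, ← lintegral_indicator_one hpre,
    lintegral_annealed _ (measurable_one.indicator hpre), ← lintegral_indicator_one hA]
  refine lintegral_congr fun η => ?_
  have : ∀ᵐ ζ ∂(E.P η), ((fun ζ : EnvPath => ζ 0) ⁻¹' A).indicator (1 : EnvPath → ℝ≥0∞) ζ =
      A.indicator 1 η := by
    filter_upwards [E.start η] with ζ hζ
    by_cases h : η ∈ A
    · rw [Set.indicator_of_mem h, Set.indicator_of_mem (show ζ ∈ _ from by
        rw [Set.mem_preimage, hζ]; exact h)]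
      rfl
    · rw [Set.indicator_of_notMem h, Set.indicator_of_notMem (show ζ ∉ _ from by
        rw [Set.mem_preimage, hζ]; exact h)]
  rw [lintegral_congr_ae this]
  simp

/-- Deviations of the density by `ε` at a scale between `l / 2` and `l` in `[-H, H]`. -/
theorem DensityWith.measure_le {c : ℝ} (hc : 0 < c) (h : E.DensityWith c) {ρ : ℝ} (hρ : ρ ∈ E.J)
    {ε : ℝ} (hε : 0 < ε) (hε1 : ε < 1) {l H : ℕ} (hl : 1 ≤ l / 2) :
    E.μ ρ {η | ∃ (a : ℤ) (m : ℕ), l / 2 ≤ m ∧ m ≤ l ∧ -(H : ℤ) ≤ a ∧ a + m - 1 ≤ H ∧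
      ε * m ≤ |(particles η a m : ℝ) - ρ * m|} ≤
      ENNReal.ofReal ((2 * H + 1) * (l + 1) * (2 * Real.exp (-(c * ε ^ 2 * (l / 2 : ℕ))))) := by
  set b : ℝ := 2 * Real.exp (-(c * ε ^ 2 * (l / 2 : ℕ))) with hb
  have hsub : {η : Config | ∃ (a : ℤ) (m : ℕ), l / 2 ≤ m ∧ m ≤ l ∧ -(H : ℤ) ≤ a ∧ a + m - 1 ≤ H ∧
      ε * m ≤ |(particles η a m : ℝ) - ρ * m|} ⊆
      ⋃ w ∈ Finset.Icc (-(H : ℤ)) H ×ˢ Finset.Icc (l / 2) l,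
        {η : Config | ε * w.2 ≤ |(particles η w.1 w.2 : ℝ) - ρ * w.2|} := by
    rintro η ⟨a, m, h1, h2, h3, h4, h5⟩
    simp only [Set.mem_iUnion]
    refine ⟨(a, m), ?_, h5⟩
    simp only [Finset.mem_product, Finset.mem_Icc]
    omega
  refine (measure_mono hsub).trans ((measure_biUnion_finset_le _ _).trans ?_)
  have hterm : ∀ w ∈ Finset.Icc (-(H : ℤ)) H ×ˢ Finset.Icc (l / 2) l,
      E.μ ρ {η : Config | ε * w.2 ≤ |(particles η w.1 w.2 : ℝ) - ρ * w.2|} ≤ ENNReal.ofReal b := by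
    rintro ⟨a, m⟩ hw
    simp only [Finset.mem_product, Finset.mem_Icc] at hw
    have hmeas : MeasurableSet {η : Config | ε * m ≤ |(particles η a m : ℝ) - ρ * m|} := by
      refine measurableSet_le measurable_const ?_
      have : Measurable fun η : Config => (particles η a m : ℝ) :=
        measurable_from_nat.comp (measurable_particles a m)
      exact (this.sub_const _).abs
    have key := h ρ hρ ε hε hε1 m (by omega) a
    rw [← map_eval_zero_annealed, Measure.map_apply (measurable_pi_apply 0) hmeas]
    have h2 : (E.annealed ρ) ((fun ζ : EnvPath => ζ 0) ⁻¹'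
        {η : Config | ε * m ≤ |(particles η a m : ℝ) - ρ * m|}) = ENNReal.ofReal
        ((E.annealed ρ).real {η | ε * m ≤ |(particles (η 0) a m : ℝ) - ρ * m|}) := by
      rw [Measure.real, ENNReal.ofReal_toReal (measure_ne_top _ _)]
      rfl
    rw [h2]
    refine ENNReal.ofReal_le_ofReal (key.trans ?_)
    rw [hb]
    have : ((l / 2 : ℕ) : ℝ) ≤ m := by exact_mod_cast hw.2.1
    gcongr
  refine (Finset.sum_le_sum hterm).trans ?_
  rw [Finset.sum_const, nsmul_eq_mul, Finset.card_product, Int.card_Icc, Nat.card_Icc]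
  have hb0 : 0 ≤ b := by positivity
  rw [← ENNReal.ofReal_natCast, ← ENNReal.ofReal_mul (by positivity)]
  refine ENNReal.ofReal_le_ofReal (mul_le_mul_of_nonneg_right ?_ hb0)
  have h1 : ((H : ℤ) + 1 - -(H : ℤ)).toNat = 2 * H + 1 := by omega
  rw [h1]
  have h2 : l + 1 - l / 2 ≤ l + 1 := Nat.sub_le _ _
  calc (((2 * H + 1) * (l + 1 - l / 2) : ℕ) : ℝ) ≤ ((2 * H + 1) * (l + 1) : ℕ) := by
        exact_mod_cast Nat.mul_le_mul_left _ h2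
    _ = _ := by push_cast; ring

theorem DensityWith.measure_sparse_compl_le {c : ℝ} (hc : 0 < c) (h : E.DensityWith c) {ρ : ℝ}
    (hρ : ρ ∈ E.J) {δ : ℝ} (hδ : 0 < δ) (hδ1 : δ < 1) {l H : ℕ} (hl : 1 ≤ l / 2) :
    E.μ ρ (Sparse (ρ + δ / 4) l H)ᶜ ≤ ENNReal.ofReal ((2 * H + 1) * (l + 1) *
      (2 * Real.exp (-(c * (δ / 4) ^ 2 * (l / 2 : ℕ))))) := by
  refine (measure_mono ?_).trans (h.measure_le hc hρ (ε := δ / 4) (by linarith) (by linarith) hl)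
  intro η hη
  simp only [Sparse, Set.mem_compl_iff, Set.mem_ofPred_eq, not_forall, not_le] at hη
  obtain ⟨a, m, h1, h2, h3, h4, h5⟩ := hη
  refine ⟨a, m, h1, h2, h3, h4, le_trans ?_ (le_abs_self _)⟩
  linarith

/-- Since `ρ + δ ≤ ρ'`, a density below `ρ + 3 * δ / 4` deviates from `ρ'` by at least `δ / 4`. -/
theorem DensityWith.measure_dense_compl_le {c : ℝ} (hc : 0 < c) (h : E.DensityWith c) {ρ ρ' : ℝ}
    (hρ : ρ' ∈ E.J) {δ : ℝ} (hδ : 0 < δ) (hδ1 : δ < 1) (hle : ρ + δ ≤ ρ') {l H : ℕ}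
    (hl : 1 ≤ l / 2) :
    E.μ ρ' (Dense (ρ + 3 * δ / 4) l H)ᶜ ≤ ENNReal.ofReal ((2 * H + 1) * (l + 1) *
      (2 * Real.exp (-(c * (δ / 4) ^ 2 * (l / 2 : ℕ))))) := by
  refine (measure_mono ?_).trans (h.measure_le hc hρ (ε := δ / 4) (by linarith) (by linarith) hl)
  intro η hη
  simp only [Dense, Set.mem_compl_iff, Set.mem_ofPred_eq, not_forall, not_le] at hη
  obtain ⟨a, m, h1, h2, h3, h4, h5⟩ := hη
  refine ⟨a, m, h1, h2, h3, h4, le_trans ?_ (neg_le_abs _)⟩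
  have : (ρ + δ) * m ≤ ρ' * m := mul_le_mul_of_nonneg_right hle (Nat.cast_nonneg m)
  linarith

end Environment

/-! ### Choice of the parameters -/

/-- The factor `exp (2 * x)` will bound `L * L`, and `x ^ 8` is the order of the exponents in the
covering and density errors. -/
theorem exists_mul_exp_le {B c : ℝ} (hB : 0 ≤ B) (hc : 0 < c) :
    ∃ x₀ : ℝ, 1 ≤ x₀ ∧ ∀ x ≥ x₀, B * Real.exp (2 * x - c * x ^ 8) ≤ Real.exp (-x) := by
  refine ⟨max 1 ((3 + B) / c), le_max_left _ _, fun x hx => ?_⟩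
  have h1 : 1 ≤ x := (le_max_left _ _).trans hx
  have h2 : (3 + B) / c ≤ x := (le_max_right _ _).trans hx
  have h3 : B ≤ Real.exp B := by linarith [Real.add_one_le_exp B]
  have h4 : 3 + B ≤ c * x := by rw [div_le_iff₀ hc] at h2; linarith
  have h5 : x * x ≤ x ^ 8 := by
    calc x * x = x ^ 2 := (sq x).symm
      _ ≤ x ^ 8 := pow_le_pow_right₀ h1 (by norm_num)
  have h6 : (3 + B) * x ≤ c * x ^ 8 := by
    calc (3 + B) * x ≤ c * x * x := mul_le_mul_of_nonneg_right h4 (by linarith)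
      _ = c * (x * x) := by ring
      _ ≤ c * x ^ 8 := mul_le_mul_of_nonneg_left h5 hc.le
  have h7 : B ≤ B * x := le_mul_of_one_le_right hB h1
  calc B * Real.exp (2 * x - c * x ^ 8) ≤ Real.exp B * Real.exp (2 * x - c * x ^ 8) := by gcongr
    _ = Real.exp (B + (2 * x - c * x ^ 8)) := (Real.exp_add _ _).symm
    _ ≤ _ := Real.exp_le_exp.2 (by linarith)

/-- The covering time `⌊x ^ 40 / 8⌋`. -/
def coverTime (x : ℝ) : ℕ := ⌊x ^ 40 / 8⌋₊

theorem coverTime_le (x : ℝ) : (coverTime x : ℝ) ≤ x ^ 40 / 8 :=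
  Nat.floor_le (by positivity)

theorem le_coverTime {x : ℝ} (hx : 16 ≤ x) : x ^ 40 / 16 ≤ coverTime x := by
  have h1 := Nat.lt_floor_add_one (x ^ 40 / 8)
  have h2 : (16 : ℝ) ≤ x ^ 40 := hx.trans (le_self_pow₀ (by linarith) (by norm_num))
  have h3 : x ^ 40 / 8 < (coverTime x : ℝ) + 1 := h1
  linarith

theorem le_coverTime_rpow {x : ℝ} (hx : 16 ≤ x) :
    x ^ 10 / 2 ≤ (coverTime x : ℝ) ^ (1 / 4 : ℝ) := by
  have h1 : (x ^ 10 / 2) ^ 4 ≤ (coverTime x : ℝ) := by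
    calc (x ^ 10 / 2) ^ 4 = x ^ 40 / 16 := by ring
      _ ≤ _ := le_coverTime hx
  calc x ^ 10 / 2 = ((x ^ 10 / 2) ^ 4) ^ (1 / 4 : ℝ) := by
        rw [← Real.rpow_natCast (x ^ 10 / 2) 4, ← Real.rpow_mul (by positivity)]
        norm_num
    _ ≤ _ := Real.rpow_le_rpow (by positivity) h1 (by norm_num)

theorem one_lt_mul_coverTime {ν x : ℝ} (hν : 0 < ν) (hx : 16 ≤ x) (hx' : ν⁻¹ ≤ x) :
    1 < ν ^ 8 * coverTime x ∧ 1 ≤ ν * coverTime x := by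
  have h0 : 1 ≤ ν * x := by
    calc (1 : ℝ) = ν * ν⁻¹ := (mul_inv_cancel₀ hν.ne').symm
      _ ≤ ν * x := by gcongr
  have h1 := le_coverTime hx
  have hx1 : 1 ≤ x := by linarith
  have h2 : (256 : ℝ) ≤ x ^ 32 := by
    calc (256 : ℝ) = 16 ^ 2 := by norm_num
      _ ≤ x ^ 2 := by gcongr
      _ ≤ x ^ 32 := pow_le_pow_right₀ hx1 (by norm_num)
  have h3 : (256 : ℝ) ≤ x ^ 39 := h2.trans (pow_le_pow_right₀ hx1 (by norm_num))
  constructor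
  · calc (1 : ℝ) < 1 ^ 8 * 256 / 16 := by norm_num
      _ ≤ (ν * x) ^ 8 * x ^ 32 / 16 := by gcongr
      _ = ν ^ 8 * (x ^ 40 / 16) := by ring
      _ ≤ _ := by gcongr
  · calc (1 : ℝ) ≤ 1 * 256 / 16 := by norm_num
      _ ≤ (ν * x) * x ^ 39 / 16 := by gcongr
      _ = ν * (x ^ 40 / 16) := by ring
      _ ≤ _ := by gcongr

/-- The left side is of order at most `x ^ 5`: a factor `x ^ 2` from the density gap `x⁻¹`, and `x ^
3` from the cubed logarithm. The right side is of order `x ^ 10`. Here `68922 = 41 ^ 3 + 1` comes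
from `log (ν * t) ≤ 41 * x`, and the factor `2` from `t ^ (1 / 4) ≥ x ^ 10 / 2`. -/
theorem covering_condition {ν C x : ℝ} (hν : 0 < ν) (hC : 0 < C) (hx : 16 ≤ x) (hx' : ν⁻¹ ≤ x)
    (hx'' : ν ≤ x) (hxC : 2 * 68922 * C / ν < x) :
    C * (x⁻¹ ^ 2)⁻¹ * (1 + |Real.log (ν * coverTime x) ^ 3|) <
      ν * (coverTime x : ℝ) ^ (1 / 4 : ℝ) := by
  have hx1 : 1 ≤ x := by linarith
  have hx0 : 0 < x := by linarith
  have h1 := (one_lt_mul_coverTime hν hx hx').2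
  have hlog0 : 0 ≤ Real.log (ν * coverTime x) := Real.log_nonneg h1
  have hlog : Real.log (ν * coverTime x) ≤ 41 * x := by
    have h2 : ν * coverTime x ≤ x ^ 41 := by
      have := coverTime_le x
      calc ν * coverTime x ≤ x * (x ^ 40 / 8) := by gcongr
        _ = x ^ 41 / 8 := by ring
        _ ≤ x ^ 41 := by linarith [pow_pos hx0 41]
    calc Real.log (ν * coverTime x) ≤ Real.log (x ^ 41) :=
          Real.log_le_log (by linarith) h2
      _ = 41 * Real.log x := by rw [Real.log_pow]; norm_num
      _ ≤ 41 * x := by linarith [Real.log_le_sub_one_of_pos hx0]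
  have h3 : |Real.log (ν * coverTime x) ^ 3| ≤ 68921 * x ^ 3 := by
    rw [abs_of_nonneg (by positivity)]
    calc Real.log (ν * coverTime x) ^ 3 ≤ (41 * x) ^ 3 := by gcongr
      _ = _ := by ring
  have h4 : (1 : ℝ) ≤ x ^ 3 := one_le_pow₀ hx1
  have h5 : C * (2 * 68922) < ν * x := by
    rw [div_lt_iff₀ hν] at hxC; linarith
  calc C * (x⁻¹ ^ 2)⁻¹ * (1 + |Real.log (ν * coverTime x) ^ 3|)
      ≤ C * (x⁻¹ ^ 2)⁻¹ * (x ^ 3 + 68921 * x ^ 3) := by gcongr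
    _ = C * (2 * 68922) * x ^ 5 / 2 := by rw [inv_pow, inv_inv]; ring
    _ < ν * x * x ^ 5 / 2 := by gcongr
    _ = ν * (x ^ 6 / 2) := by ring
    _ ≤ ν * (x ^ 10 / 2) := by
        have : x ^ 6 ≤ x ^ 10 := pow_le_pow_right₀ hx1 (by norm_num)
        gcongr
    _ ≤ _ := by have := le_coverTime_rpow hx; gcongr

theorem scale_le_half {x : ℝ} (hx : 16 ≤ x) :
    1 ≤ ⌊(coverTime x : ℝ) ^ (1 / 4 : ℝ)⌋₊ / 2 ∧
      x ^ 10 / 8 ≤ (⌊(coverTime x : ℝ) ^ (1 / 4 : ℝ)⌋₊ / 2 : ℕ) := by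
  have h1 := le_coverTime_rpow hx
  set y := (coverTime x : ℝ) ^ (1 / 4 : ℝ)
  have h2 := Nat.lt_floor_add_one y
  have h3 : (16 : ℝ) ≤ x ^ 10 := hx.trans (le_self_pow₀ (by linarith) (by norm_num))
  have h4 : (⌊y⌋₊ : ℝ) ≤ 2 * (⌊y⌋₊ / 2 : ℕ) + 1 := by exact_mod_cast (by omega)
  have h5 : x ^ 10 / 8 ≤ (⌊y⌋₊ / 2 : ℕ) := by linarith
  refine ⟨?_, h5⟩
  have : (1 : ℝ) ≤ (⌊y⌋₊ / 2 : ℕ) := by linarith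
  exact_mod_cast this

namespace Environment

variable {E : Environment}

/-- The failure probability of the coupling over a block is small. -/
theorem failure_le {ν C' c x A : ℝ} {L H H' j : ℕ} (hν : 0 < ν) (hC' : 0 < C') (hc : 0 < c)
    (hx : 16 ≤ x) (hxL : x ^ 400 ≤ L) (hLx : Real.log L ≤ x) (hj : 1 ≤ j) (hA : 0 ≤ A)
    (hH : (H : ℝ) ≤ A * (j * L)) (hH' : (2 * H' + 1 : ℝ) ≤ A * (j * L))
    (hexp : (8 * A + C' * A + 20) * Real.exp (2 * x -
      min (c / 128) (min ((C' * (1 + ν⁻¹))⁻¹ / 2) (ν / 4)) * x ^ 8) ≤ Real.exp (-x)) :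
    ENNReal.ofReal ((2 * H' + 1) * (⌊(coverTime x : ℝ) ^ (1 / 4 : ℝ)⌋₊ + 1) *
      (2 * Real.exp (-(c * (x⁻¹ / 4) ^ 2 * (⌊(coverTime x : ℝ) ^ (1 / 4 : ℝ)⌋₊ / 2 : ℕ))))) +
    ENNReal.ofReal ((2 * H' + 1) * (⌊(coverTime x : ℝ) ^ (1 / 4 : ℝ)⌋₊ + 1) *
      (2 * Real.exp (-(c * (x⁻¹ / 4) ^ 2 * (⌊(coverTime x : ℝ) ^ (1 / 4 : ℝ)⌋₊ / 2 : ℕ))))) +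
    blockError ν C' x⁻¹ L (coverTime x) H ≤ ENNReal.ofReal (j * Real.exp (-x)) := by
  have hx1 : 1 ≤ x := by linarith
  have hx0 : 0 < x := by linarith
  have hL1 : (1 : ℝ) ≤ L := (one_le_pow₀ hx1).trans hxL
  have hj1 : (1 : ℝ) ≤ j := by exact_mod_cast hj
  -- A common lower bound for the three rates; `128 = 16 * 8` combines `(x⁻¹ / 4) ^ 2` with `x ^ 10
  -- / 8`.
  set c₀ := min (c / 128) (min ((C' * (1 + ν⁻¹))⁻¹ / 2) (ν / 4))
  have c1 : c₀ ≤ c / 128 := min_le_left _ _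
  have c2 : c₀ ≤ (C' * (1 + ν⁻¹))⁻¹ / 2 := (min_le_right _ _).trans (min_le_left _ _)
  have c3 : c₀ ≤ ν / 4 := (min_le_right _ _).trans (min_le_right _ _)
  set l := ⌊(coverTime x : ℝ) ^ (1 / 4 : ℝ)⌋₊
  have htL : (coverTime x : ℝ) ≤ L := by
    have h1 : x ^ 40 ≤ x ^ 400 := pow_le_pow_right₀ hx1 (by norm_num)
    have := coverTime_le x
    have := pow_pos hx0 40
    linarith
  have ht1 : (1 : ℝ) ≤ coverTime x := by
    have h2 : (16 : ℝ) ≤ x ^ 40 := hx.trans (le_self_pow₀ hx1 (by norm_num))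
    have := le_coverTime hx
    linarith
  have hl : (l : ℝ) + 1 ≤ 2 * L := by
    have h1 : (l : ℝ) ≤ (coverTime x : ℝ) ^ (1 / 4 : ℝ) := Nat.floor_le (by positivity)
    have h2 : (coverTime x : ℝ) ^ (1 / 4 : ℝ) ≤ (coverTime x : ℝ) ^ (1 : ℝ) :=
      Real.rpow_le_rpow_of_exponent_le ht1 (by norm_num)
    rw [Real.rpow_one] at h2
    linarith
  have hL2 : (L : ℝ) * L ≤ Real.exp (2 * x) := by
    have : (L : ℝ) ≤ Real.exp x := by
      rw [← Real.exp_log (by linarith : (0 : ℝ) < L)]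
      exact Real.exp_le_exp.2 hLx
    calc (L : ℝ) * L ≤ Real.exp x * Real.exp x := by gcongr
      _ = _ := by rw [← Real.exp_add]; ring_nf
  set X := Real.exp (2 * x - c₀ * x ^ 8) with hX
  have hXe : Real.exp (2 * x) * Real.exp (-(c₀ * x ^ 8)) = X := by
    rw [← Real.exp_add, hX]; ring_nf
  have e1 : Real.exp (-(c * (x⁻¹ / 4) ^ 2 * (l / 2 : ℕ))) ≤ Real.exp (-(c₀ * x ^ 8)) := by
    refine Real.exp_le_exp.2 (neg_le_neg ?_)
    calc c₀ * x ^ 8 ≤ c / 128 * x ^ 8 := by gcongr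
      _ = c * (x⁻¹ / 4) ^ 2 * (x ^ 10 / 8) := by field_simp; ring
      _ ≤ _ := by have := (scale_le_half hx).2; gcongr
  have e2 : Real.exp (-((C' * (1 + ν⁻¹))⁻¹ * x⁻¹ ^ 2 * (coverTime x : ℝ) ^ (1 / 4 : ℝ))) ≤
      Real.exp (-(c₀ * x ^ 8)) := by
    refine Real.exp_le_exp.2 (neg_le_neg ?_)
    calc c₀ * x ^ 8 ≤ (C' * (1 + ν⁻¹))⁻¹ / 2 * x ^ 8 := by gcongr
      _ = (C' * (1 + ν⁻¹))⁻¹ * (x⁻¹ ^ 2 * (x ^ 10 / 2)) := by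
          have : x⁻¹ ^ 2 * x ^ 10 = x ^ 8 := by field_simp
          rw [← mul_div_assoc, this]; ring
      _ = (C' * (1 + ν⁻¹))⁻¹ * x⁻¹ ^ 2 * (x ^ 10 / 2) := by ring
      _ ≤ _ := by have := le_coverTime_rpow hx; gcongr
  have e3 : Real.exp (-(ν * L / 4)) ≤ X := by
    refine Real.exp_le_exp.2 ?_
    have h1 : x ^ 8 ≤ x ^ 400 := pow_le_pow_right₀ hx1 (by norm_num)
    have : c₀ * x ^ 8 ≤ ν / 4 * L := by
      calc c₀ * x ^ 8 ≤ ν / 4 * x ^ 8 := by gcongr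
        _ ≤ _ := by have := h1.trans hxL; gcongr
    linarith
  set Y := Real.exp (-(c₀ * x ^ 8))
  have b1 : (2 * H' + 1) * ((l : ℝ) + 1) * (2 * Real.exp (-(c * (x⁻¹ / 4) ^ 2 * (l / 2 : ℕ)))) ≤
      4 * A * j * X := by
    calc _ ≤ (A * (j * L)) * (2 * L) * (2 * Y) := by gcongr
      _ = 4 * A * j * (L * L * Y) := by ring
      _ ≤ 4 * A * j * (Real.exp (2 * x) * Y) := by gcongr
      _ = _ := by rw [hXe]
  have b2 : C' * coverTime x * H *
      Real.exp (-((C' * (1 + ν⁻¹))⁻¹ * x⁻¹ ^ 2 * (coverTime x : ℝ) ^ (1 / 4 : ℝ))) ≤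
      C' * A * j * X := by
    calc _ ≤ C' * L * (A * (j * L)) * Y := by gcongr
      _ = C' * A * j * (L * L * Y) := by ring
      _ ≤ C' * A * j * (Real.exp (2 * x) * Y) := by gcongr
      _ = _ := by rw [hXe]
  have b3 : 20 * Real.exp (-(ν * L / 4)) ≤ 20 * j * X := by
    have hX0 : 0 ≤ X := (Real.exp_pos _).le
    calc 20 * Real.exp (-(ν * L / 4)) ≤ 20 * (1 * X) := by linarith
      _ ≤ 20 * (j * X) := by gcongr
      _ = _ := by ring
  unfold blockError
  rw [← ENNReal.ofReal_add (by positivity) (by positivity),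
    ← ENNReal.ofReal_add (by positivity) (by positivity),
    ← ENNReal.ofReal_add (by positivity) (by positivity)]
  refine ENNReal.ofReal_le_ofReal ?_
  -- The summands are the two density errors, the covering error and the no-drift error.
  calc _ ≤ j * ((8 * A + C' * A + 20) * X) := by linarith
    _ ≤ _ := by gcongr

/-- For large `x`, the parameters of the coupling can be chosen with failure probability
`j * exp (-x)` per block, uniformly over block lengths `L` between `x ^ 400` and `exp x`. -/
theorem exists_scale (E : Environment) {ν C C' c : ℝ} (hν : 0 < ν) (hC : 0 < C) (hC' : 0 < C')
    (hc : 0 < c) (hdens : E.DensityWith c) :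
    ∃ x₀ : ℝ, 1 ≤ x₀ ∧ ∀ x ≥ x₀, ∀ L : ℕ, x ^ 400 ≤ L → Real.log L ≤ x →
      ∀ ρ ∈ E.J, ∀ ρ' ∈ E.J, ρ + x⁻¹ ≤ ρ' → ∀ j : ℕ, 1 ≤ j →
      ∃ t N M H H' : ℕ, E.Scale ν C ρ x⁻¹ L t N M H ∧ N = L + j * L ∧ H + 2 * N ≤ H' ∧
        (2 * t : ℝ) < x ^ 40 ∧
        E.μ ρ (Sparse (ρ + x⁻¹ / 4) ⌊(t : ℝ) ^ (1 / 4 : ℝ)⌋₊ H')ᶜ +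
          E.μ ρ' (Dense (ρ + 3 * x⁻¹ / 4) ⌊(t : ℝ) ^ (1 / 4 : ℝ)⌋₊ H')ᶜ +
          blockError ν C' x⁻¹ L t H ≤ ENNReal.ofReal (j * Real.exp (-x)) := by
  set V := ⌈ν⌉₊
  have hV : ν ≤ V := Nat.le_ceil ν
  -- From `N ≤ 2 * j * L`, `H ≤ (3 + 6 * V) * j * L` and `H' = H + 2 * N` it follows that `2 * H' +
  -- 1 ≤ A * j * L`.
  set A : ℝ := 15 + 12 * V
  obtain ⟨x₁, hx₁, hexp⟩ := exists_mul_exp_le (B := 8 * A + C' * A + 20)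
    (c := min (c / 128) (min ((C' * (1 + ν⁻¹))⁻¹ / 2) (ν / 4))) (by positivity)
    (lt_min (by positivity) (lt_min (by positivity) (by positivity)))
  refine ⟨max x₁ (max 16 (max ν⁻¹ (max ν (2 * 68922 * C / ν + 1)))), le_max_of_le_left hx₁,
    fun x hx L hxL hLx ρ hρ ρ' hρ' hρρ' j hj => ?_⟩
  simp only [ge_iff_le, max_le_iff] at hx
  obtain ⟨hxx₁, hx16, hxν, hxν', hxC⟩ := hx
  have hx1 : 1 ≤ x := by linarith
  have hx0 : 0 < x := by linarith
  have hL1 : (1 : ℝ) ≤ L := (one_le_pow₀ hx1).trans hxL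
  have hj1 : (1 : ℝ) ≤ j := by exact_mod_cast hj
  -- Small enough that `2 * t < x ^ 40`, the admissible loss per block, and large enough that `x⁻¹ ^
  -- 2 * t ^ (1 / 4)` is at least `x ^ 8 / 2`.
  set t := coverTime x
  have htx := coverTime_le x
  have hx40 := pow_pos hx0 40
  have htL : (t : ℝ) ≤ L := by
    have h1 : x ^ 40 ≤ x ^ 400 := pow_le_pow_right₀ hx1 (by norm_num)
    linarith
  have ht1 : (1 : ℝ) ≤ t := by
    have h2 : (16 : ℝ) ≤ x ^ 40 := hx16.trans (le_self_pow₀ hx1 (by norm_num))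
    have := le_coverTime hx16
    linarith
  have hinv : 0 < x⁻¹ := by positivity
  have hinv1 : x⁻¹ < 1 := inv_lt_one_of_one_lt₀ (by linarith)
  -- The windows are built outwards: `N` contains the walk over all blocks, `M` leaves room for
  -- drift over a block, and `H` for the covering time, with `+ 1` for strictness. The final `H + 2
  -- * N` also absorbs the shifts.
  set N := L + j * L with hN
  set M := N + 2 * V * L with hM
  set H := M + 4 * V * L + 1 with hH
  have hνt : ν * t ≤ V * L := by gcongr
  have hνL : ν * L ≤ V * L := by gcongr
  have hρx : ρ + x⁻¹ ∈ E.J := ⟨by linarith [hρ.1], lt_of_le_of_lt hρρ' hρ'.2⟩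
  have hjL : (L : ℝ) ≤ j * L := le_mul_of_one_le_left (by linarith) hj1
  have hVjL : (V : ℝ) * L ≤ V * (j * L) := by gcongr
  have hHr : (H : ℝ) ≤ (3 + 6 * V) * (j * L) := by
    simp only [hH, hM, hN]; push_cast; linarith
  refine ⟨t, N, M, H, H + 2 * N, ⟨hρ, hinv, hinv1, hρx, by exact_mod_cast ht1,
    by exact_mod_cast htL,
    by omega, ?_, (one_lt_mul_coverTime hν hx16 hxν).1,
    covering_condition hν hC hx16 hxν hxν' (by linarith), ?_, ?_⟩, rfl, le_rfl, by linarith, ?_⟩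
  · simp only [hH, hM]; push_cast
    have : (0 : ℝ) ≤ N := Nat.cast_nonneg N
    have : (0 : ℝ) ≤ V * L := by positivity
    linarith
  · simp only [hH]; push_cast; linarith
  · simp only [hM]; push_cast; linarith
  · have hl := (scale_le_half hx16).1
    have h1 := hdens.measure_sparse_compl_le hc hρ hinv hinv1 (H := H + 2 * N) hl
    have h2 := hdens.measure_dense_compl_le hc hρ' hinv hinv1 hρρ' (H := H + 2 * N) hl
    refine (add_le_add_left (add_le_add h1 h2) _).trans ?_
    refine failure_le (A := A) hν hC' hc hx16 hxL hLx hj (by positivity) ?_ ?_ (hexp x hxx₁)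
    · refine hHr.trans (mul_le_mul_of_nonneg_right ?_ (by positivity))
      have : (0 : ℝ) ≤ V := Nat.cast_nonneg V
      simp only [A]; linarith
    · have : (N : ℝ) ≤ 2 * (j * L) := by simp only [hN]; push_cast; linarith
      simp only [A]; push_cast
      linarith

end Environment

/-! ### Summation over blocks for the speeds -/

namespace Environment

variable {E : Environment} {p₀ p₁ : ℝ}

/-- Telescoping of the block increments. The first block is compared by monotonicity, so `k + 1`
blocks produce only `k` errors. -/
theorem Scale.meanPosition_mul_le {ν C C' ρ δ : ℝ} {L t N M H : ℕ}
    (S : E.Scale ν C ρ δ L t N M H) (hE : E.MarkovInvariant) (hS : E.Stationary)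
    (hM : E.Monotonicity) (hN : E.NoDriftIn ν) (hC : E.CoveringWith ν C C') (hp : p₀ ≤ p₁)
    {ρ' : ℝ} (hρ' : ρ' ∈ E.J) (hle : ρ ≤ ρ') {H' : ℕ} (hH' : H + 2 * N ≤ H') {D : ℝ}
    (hD0 : 0 ≤ D)
    (hD : E.μ ρ (Sparse (ρ + δ / 4) ⌊(t : ℝ) ^ (1 / 4 : ℝ)⌋₊ H')ᶜ +
      E.μ ρ' (Dense (ρ + 3 * δ / 4) ⌊(t : ℝ) ^ (1 / 4 : ℝ)⌋₊ H')ᶜ +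
      blockError ν C' δ L t H ≤ ENNReal.ofReal D) (k : ℕ) (hk : (k + 1) * L ≤ N) :
    E.meanPosition p₀ p₁ ρ ((k + 1) * L) ≤
        (k + 1) * E.meanPosition p₀ p₁ ρ' L + k * (2 * t + 2 * L * D) ∧
      (k + 1) * E.meanPosition p₀ p₁ ρ L ≤
        E.meanPosition p₀ p₁ ρ' ((k + 1) * L) + k * (2 * t + 2 * L * D) := by
  induction k with
  | zero =>
    have := hM.meanPosition_mono hp S.rho_mem hρ' hle L
    simpa using this
  | succ k ih =>
    have htL := S.le_block
    have e3 : (k + 1 + 1) * L = (k + 1) * L + L := by ring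
    have a1 : (k + 1) * L + L ≤ N := by omega
    obtain ⟨i1, i2⟩ := ih (by omega)
    have a2 : H + (k + 1) * L + 2 * t ≤ H' := by omega
    have h1 := S.meanPosition_sub_le hE hS hN hC hp (ρ' := ρ') a1 a2 hD0 hD
    have h2 := S.meanPosition_le_sub hE hS hN hC hp hρ' a1 a2 hD0 hD
    rw [e3]
    push_cast
    constructor <;> linarith

theorem abs_speed_le_one (ρ : ℝ) {n : ℕ} (hn : 1 ≤ n) : |speed E p₀ p₁ ρ n| ≤ 1 := by
  rw [speed_eq, abs_div, Nat.abs_cast, div_le_one (by exact_mod_cast hn)]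
  exact abs_meanPosition_le ρ n

/-- The comparison of the speeds of two walks with refresh times `n` and `L ≤ n`. -/
theorem Scale.speed_le {ν C C' ρ δ : ℝ} {L t N M H : ℕ}
    (S : E.Scale ν C ρ δ L t N M H) (hE : E.MarkovInvariant) (hS : E.Stationary)
    (hM : E.Monotonicity) (hN : E.NoDriftIn ν) (hC : E.CoveringWith ν C C') (hp : p₀ ≤ p₁)
    {ρ' : ℝ} (hρ' : ρ' ∈ E.J) (hle : ρ ≤ ρ') {H' : ℕ} (hH' : H + 2 * N ≤ H') {D : ℝ}
    (hD0 : 0 ≤ D)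
    (hD : E.μ ρ (Sparse (ρ + δ / 4) ⌊(t : ℝ) ^ (1 / 4 : ℝ)⌋₊ H')ᶜ +
      E.μ ρ' (Dense (ρ + 3 * δ / 4) ⌊(t : ℝ) ^ (1 / 4 : ℝ)⌋₊ H')ᶜ +
      blockError ν C' δ L t H ≤ ENNReal.ofReal D) {k r n : ℕ} (hn : n = (k + 1) * L + r)
    (hk : (k + 1) * L ≤ N) :
    speed E p₀ p₁ ρ n ≤ speed E p₀ p₁ ρ' L + 2 * (r / n) + k * (2 * t / n) + 2 * k * D ∧
      speed E p₀ p₁ ρ L ≤ speed E p₀ p₁ ρ' n + 2 * (r / n) + k * (2 * t / n) + 2 * k * D := by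
  have hL : 0 < L := lt_of_lt_of_le S.one_le S.le_block
  have hLn : L ≤ n := by
    have : L ≤ (k + 1) * L := Nat.le_mul_of_pos_left L k.succ_pos
    omega
  have hL' : (0 : ℝ) < L := by exact_mod_cast hL
  have hLn' : (L : ℝ) ≤ n := by exact_mod_cast hLn
  have hn' : (0 : ℝ) < n := hL'.trans_le hLn'
  have hnr : (n : ℝ) = (k + 1) * L + r := by exact_mod_cast hn
  obtain ⟨h1, h2⟩ := S.meanPosition_mul_le hE hS hM hN hC hp hρ' hle hH' hD0 hD k hk
  have r1 := (abs_le.1 (E.abs_meanPosition_sub_le (p₀ := p₀) (p₁ := p₁) ρ ((k + 1) * L) r)).2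
  have r2 := (abs_le.1 (E.abs_meanPosition_sub_le (p₀ := p₀) (p₁ := p₁) ρ' ((k + 1) * L) r)).1
  rw [← hn] at r1 r2
  have b : ∀ ρ, |speed E p₀ p₁ ρ L| ≤ 1 := fun ρ => abs_speed_le_one ρ hL
  have m : ∀ ρ, E.meanPosition p₀ p₁ ρ L = L * speed E p₀ p₁ ρ L := fun ρ => by
    rw [speed_eq]; field_simp
  have m' : ∀ ρ, E.meanPosition p₀ p₁ ρ n = n * speed E p₀ p₁ ρ n := fun ρ => by
    rw [speed_eq]; field_simp
  have hkD : (k : ℝ) * (2 * L * D) ≤ k * (2 * n * D) := by gcongr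
  have e : ∀ a : ℝ, a + 2 * (r / n) + k * (2 * t / n) + 2 * k * D =
      (n * a + 2 * r + k * (2 * t) + k * (2 * n * D)) / n := fun a => by field_simp
  -- The remaining `r` steps cost `r` for the long walk and another `r` because speeds lie in `[-1,
  -- 1]`; hence the term `2 * r`.
  have s1 := mul_le_mul_of_nonneg_left (abs_le.1 (b ρ')).1 (Nat.cast_nonneg (α := ℝ) r)
  have s2 := mul_le_mul_of_nonneg_left (abs_le.1 (b ρ)).2 (Nat.cast_nonneg (α := ℝ) r)
  rw [e, e, le_div_iff₀ hn', le_div_iff₀ hn', mul_comm _ (n : ℝ), mul_comm _ (n : ℝ), ← m', ← m']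
  rw [m] at h1 h2
  constructor
  · have : (n : ℝ) * speed E p₀ p₁ ρ' L =
        (k + 1) * (L * speed E p₀ p₁ ρ' L) + r * speed E p₀ p₁ ρ' L := by rw [hnr]; ring
    linarith
  · have : (n : ℝ) * speed E p₀ p₁ ρ L =
        (k + 1) * (L * speed E p₀ p₁ ρ L) + r * speed E p₀ p₁ ρ L := by rw [hnr]; ring
    linarith

/-- The scale `x = f ^ (1 / 40)` attached to a function `f` of the block length. -/
theorem rpow_scale_bounds {x₀ f : ℝ} (hx₀ : 1 ≤ x₀) {L : ℕ} (hL : x₀ ≤ Real.log L)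
    (hf : Real.log L ^ 90 ≤ f) (hfL : f ≤ (L : ℝ) ^ (1 / 10 : ℝ)) :
    ∃ x : ℝ, x₀ ≤ x ∧ f ^ (1 / 40 : ℝ) = x ∧ f ^ (-(1 / 40) : ℝ) = x⁻¹ ∧ x ^ 40 = f ∧
      x ^ 400 ≤ L ∧ Real.log L ≤ x := by
  have hlog1 : 1 ≤ Real.log L := hx₀.trans hL
  have hf1 : 1 ≤ f := (one_le_pow₀ hlog1).trans hf
  have hx40 : (f ^ (1 / 40 : ℝ)) ^ 40 = f := by
    rw [← Real.rpow_natCast, ← Real.rpow_mul (by linarith)]; norm_num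
  have hx1 : 1 ≤ f ^ (1 / 40 : ℝ) := Real.one_le_rpow hf1 (by norm_num)
  have hlog : Real.log L ≤ f ^ (1 / 40 : ℝ) := by
    -- Since `x ≥ 1`, `log L ^ 90 ≤ f = x ^ 40 ≤ x ^ 90`.
    refine le_of_pow_le_pow_left₀ (n := 90) (by norm_num) (by linarith) (hf.trans ?_)
    calc f = (f ^ (1 / 40 : ℝ)) ^ 40 := hx40.symm
      _ ≤ _ := pow_le_pow_right₀ hx1 (by norm_num)
  refine ⟨f ^ (1 / 40 : ℝ), hL.trans hlog, rfl, Real.rpow_neg (by linarith) _, hx40, ?_, hlog⟩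
  calc (f ^ (1 / 40 : ℝ)) ^ 400 = ((f ^ (1 / 40 : ℝ)) ^ 40) ^ 10 := by rw [← pow_mul]
    _ = f ^ 10 := by rw [hx40]
    _ ≤ ((L : ℝ) ^ (1 / 10 : ℝ)) ^ 10 := by gcongr
    _ = L := by
      rw [← Real.rpow_natCast, ← Real.rpow_mul (by positivity)]; norm_num

theorem ceil_natCast_div {n L j : ℕ} (hL : 0 < L) (h₁ : j * L < n) (h₂ : n ≤ L + j * L) :
    ⌈(n : ℝ) / L⌉ = j + 1 := by
  have hL' : (0 : ℝ) < L := by exact_mod_cast hL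
  have h₁' : (j * L : ℝ) < n := by exact_mod_cast h₁
  have h₂' : (n : ℝ) ≤ L + j * L := by exact_mod_cast h₂
  rw [Int.ceil_eq_iff]
  push_cast
  rw [lt_div_iff₀ hL', div_le_iff₀ hL']
  constructor <;> linarith

end Environment

end

/-! ### Proof of the proposition -/

theorem proposition3p1 (E : Environment) (ν : ℝ) (hν : 0 < ν)
    (hP1 : E.MarkovInvariant) (hP2 : E.Stationary) (hP3 : E.Monotonicity)
    (hP4 : E.DensityAtStationarity) (hC21 : E.NoDriftIn ν) (hC22 : E.Covering ν) :
    ∃ L₀ : ℕ, 1 ≤ L₀ ∧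
      ∀ p₀ p₁ : ℝ, 0 ≤ p₀ → p₀ < p₁ → p₁ ≤ 1 →
      ∀ L : ℕ, L₀ < L →
      ∀ f : ℝ, Real.log L ^ 90 ≤ f → f ≤ (L : ℝ) ^ (1 / 10 : ℝ) →
      ∀ n : ℕ, 1 ≤ n →
      ∀ ρ ∈ E.J, f ^ (-(1 / 40) : ℝ) < ρ →
      ∀ ε : ℝ, f ^ (-(1 / 40) : ℝ) ≤ ε → ρ + ε ∈ E.J →
        -- first walk refreshed every `n` steps, second walk refreshed every `L` steps
        ((∃ Q : Measure ((Fin (n + 1) → ℤ) × (Fin (n + 1) → ℤ)),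
            IsCoupling Q ((walkLaw E p₀ p₁ ρ n).map (upTo n))
              ((walkLaw E p₀ p₁ (ρ + ε) L).map (upTo n)) ∧
            Q.real {w | ∃ s, ((w.2 s - w.1 s : ℤ) : ℝ) < -(⌈(n : ℝ) / L - 1⌉ * f)} ≤
              (⌈(n : ℝ) / L⌉ - 1) ^ 2 * Real.exp (-f ^ (1 / 40 : ℝ)) ∧
            (L < n →
              Q.real {w | ∃ s, ((w.2 s - w.1 s : ℤ) : ℝ) ≤ -(⌈(n : ℝ) / L - 1⌉ * f)} ≤
                (⌈(n : ℝ) / L⌉ - 1) ^ 2 * Real.exp (-f ^ (1 / 40 : ℝ)))) ∧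
          speed E p₀ p₁ ρ n ≤ speed E p₀ p₁ (ρ + ε) L
            + 2 * ((n - L * ⌊(n : ℝ) / L⌋) / n) + ⌈(n : ℝ) / L - 1⌉ * (f / n)
            + 2 * (⌈(n : ℝ) / L⌉ - 1) ^ 2 * Real.exp (-f ^ (1 / 40 : ℝ))) ∧
        -- first walk refreshed every `L` steps, second walk refreshed every `n` steps
        ((∃ Q : Measure ((Fin (n + 1) → ℤ) × (Fin (n + 1) → ℤ)),
            IsCoupling Q ((walkLaw E p₀ p₁ ρ L).map (upTo n))
              ((walkLaw E p₀ p₁ (ρ + ε) n).map (upTo n)) ∧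
            Q.real {w | ∃ s, ((w.2 s - w.1 s : ℤ) : ℝ) < -(⌈(n : ℝ) / L - 1⌉ * f)} ≤
              (⌈(n : ℝ) / L⌉ - 1) ^ 2 * Real.exp (-f ^ (1 / 40 : ℝ)) ∧
            (L < n →
              Q.real {w | ∃ s, ((w.2 s - w.1 s : ℤ) : ℝ) ≤ -(⌈(n : ℝ) / L - 1⌉ * f)} ≤
                (⌈(n : ℝ) / L⌉ - 1) ^ 2 * Real.exp (-f ^ (1 / 40 : ℝ)))) ∧
          speed E p₀ p₁ ρ L ≤ speed E p₀ p₁ (ρ + ε) n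
            + 2 * ((n - L * ⌊(n : ℝ) / L⌋) / n) + ⌈(n : ℝ) / L - 1⌉ * (f / n)
            + 2 * (⌈(n : ℝ) / L⌉ - 1) ^ 2 * Real.exp (-f ^ (1 / 40 : ℝ))) := by
  obtain ⟨c, hc, hdens⟩ := hP4
  obtain ⟨C, C', hC, hC', hcov⟩ := hC22
  obtain ⟨x₀, hx₀, key⟩ := E.exists_scale hν hC hC' hc hdens
  -- For `L` beyond this value `log L ≥ x₀`, hence also `x ≥ x₀`.
  refine ⟨⌈Real.exp x₀⌉₊, Nat.one_le_ceil_iff.2 (Real.exp_pos _), ?_⟩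
  intro p₀ p₁ _ hp _ L hL f hf hfL n hn ρ hρ _ ε hε hρ'
  have hLexp : Real.exp x₀ ≤ L := (Nat.le_ceil _).trans (by exact_mod_cast hL.le)
  have hL0 : (0 : ℝ) < L := (Real.exp_pos _).trans_le hLexp
  have hL0' : 0 < L := by exact_mod_cast hL0
  obtain ⟨x, hx, e1, e2, rfl, hxL, hLx⟩ := Environment.rpow_scale_bounds hx₀
    ((Real.le_log_iff_exp_le hL0).2 hLexp) hf hfL
  rw [e2] at hε
  rw [e1]
  have hx0 : 0 < x := by linarith
  -- This is `⌈n / L⌉ - 1`; subtracting one first handles the case that `L` divides `n`.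
  set j := (n - 1) / L with hj
  have hj1 : j * L < n := lt_of_le_of_lt (Nat.div_mul_le_self _ _) (by omega)
  have hj2 : n ≤ L + j * L := by
    have := Nat.lt_div_mul_add (a := n - 1) hL0'
    rw [← hj] at this
    omega
  have c1 : ⌈(n : ℝ) / L⌉ = j + 1 := Environment.ceil_natCast_div hL0' hj1 hj2
  have c2 : ⌈(n : ℝ) / L - 1⌉ = j := by rw [Int.ceil_sub_one, c1]; ring
  -- The density gap used is `x⁻¹ ≤ ε`, as `ε` itself need not be below `1`. The maximum covers `j =
  -- 0`, where `key` does not apply.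
  obtain ⟨t, N, M, H, H', S, hN, hH', ht, hbad⟩ := key x hx L hxL hLx ρ hρ (ρ + ε) hρ'
    (by linarith) (max j 1) (le_max_right _ _)
  set D := (max j 1 : ℕ) * Real.exp (-x)
  have hD0 : 0 ≤ D := by positivity
  -- The windows grow with `j`, so the failure bound per block carries a factor `j`; the sum over
  -- `j` blocks makes it a square.
  have hjD : (j : ℝ) * D = (j : ℝ) ^ 2 * Real.exp (-x) := by
    rcases Nat.eq_zero_or_pos j with h | h
    · simp [h]
    · simp only [D, max_eq_left (show 1 ≤ j from h)]; ring
  have hjN : L + j * L ≤ N := by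
    rw [hN]; exact Nat.add_le_add_left (Nat.mul_le_mul_right _ (le_max_left _ _)) _
  have hle : ρ ≤ ρ + ε := by
    have : 0 < x⁻¹ := by positivity
    linarith
  have htj : H + 2 * t * j ≤ H' := by
    have : t * j ≤ j * L := by rw [mul_comm]; exact Nat.mul_le_mul_left _ S.le_block
    have : 2 * t * j = 2 * (t * j) := by ring
    omega
  have coupling : ∀ L₁ L₂ : ℕ, (L₁ = n ∨ L₁ = L) → (L₂ = n ∨ L₂ = L) →
      ∃ Q : Measure ((Fin (n + 1) → ℤ) × (Fin (n + 1) → ℤ)),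
        IsCoupling Q ((walkLaw E p₀ p₁ ρ L₁).map (upTo n))
          ((walkLaw E p₀ p₁ (ρ + ε) L₂).map (upTo n)) ∧
        Q.real {w | ∃ s, ((w.2 s - w.1 s : ℤ) : ℝ) < -(j * x ^ 40)} ≤
          (j : ℝ) ^ 2 * Real.exp (-x) ∧
        (L < n → Q.real {w | ∃ s, ((w.2 s - w.1 s : ℤ) : ℝ) ≤ -(j * x ^ 40)} ≤
          (j : ℝ) ^ 2 * Real.exp (-x)) := by
    intro L₁ L₂ h₁ h₂
    obtain ⟨Q, hQ, hQle⟩ := S.exists_coupling hP1 hP2 hP3 hC21 hcov hp.le hρ' hle hj2 hjN htj h₁ h₂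
      (D := (j : ℝ) ^ 2 * Real.exp (-x)) (by positivity) (by
        rw [← hjD, ENNReal.ofReal_mul (Nat.cast_nonneg _), ENNReal.ofReal_natCast]
        gcongr)
    have hQp : IsProbabilityMeasure Q := by
      have : IsProbabilityMeasure (Q.map Prod.fst) := by
        rw [hQ.1]
        exact Measure.isProbabilityMeasure_map
          (measurable_pi_lambda _ fun s => measurable_pi_apply _).aemeasurable
      exact Measure.isProbabilityMeasure_of_map Prod.fst
    refine ⟨Q, hQ, (measureReal_mono ?_).trans hQle, fun hLn => (measureReal_mono ?_).trans hQle⟩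
    · rintro w ⟨s, hs⟩ h
      have h' : (w.1 s : ℝ) - 2 * t * j ≤ w.2 s := by exact_mod_cast h s
      have : (2 * t : ℝ) * j ≤ x ^ 40 * j := by gcongr
      push_cast at hs
      linarith
    · rintro w ⟨s, hs⟩ h
      have h' : (w.1 s : ℝ) - 2 * t * j ≤ w.2 s := by exact_mod_cast h s
      -- For `n > L` there is at least one costly block, and `2 * t < x ^ 40` makes the total loss
      -- strictly smaller than allowed.
      have hj0 : 0 < j := Nat.div_pos (by omega) hL0'
      have hj0' : (0 : ℝ) < j := by exact_mod_cast hj0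
      have : (2 * t : ℝ) * j < x ^ 40 * j := by gcongr
      push_cast at hs
      linarith
  have speeds : ∀ L₁ L₂ : ℕ, (L₁ = n ∧ L₂ = L ∨ L₁ = L ∧ L₂ = n) →
      speed E p₀ p₁ ρ L₁ ≤ speed E p₀ p₁ (ρ + ε) L₂ +
        2 * ((n - L * ⌊(n : ℝ) / L⌋) / n) + j * (x ^ 40 / n) + 2 * (j : ℝ) ^ 2 * Real.exp (-x) := by
    intro L₁ L₂ h₁₂
    have hn0 : (0 : ℝ) < n := by exact_mod_cast hn
    have hfloor : ⌊(n : ℝ) / L⌋ = (n / L : ℕ) := by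
      rw [← Nat.floor_div_eq_div (K := ℝ), Int.natCast_floor_eq_floor (by positivity)]
    rw [hfloor]
    -- For `n < L` the remainder term equals `2`, and the claim is trivial for speeds in `[-1, 1]`.
    rcases Nat.eq_zero_or_pos (n / L) with h0 | h0
    · have b₁ := (abs_le.1 (Environment.abs_speed_le_one (E := E) (p₀ := p₀) (p₁ := p₁) ρ
        (n := L₁) (by omega))).2
      have b₂ := (abs_le.1 (Environment.abs_speed_le_one (E := E) (p₀ := p₀) (p₁ := p₁) (ρ + ε)
        (n := L₂) (by omega))).1
      have e : ((n : ℝ) - L * ((n / L : ℕ) : ℤ)) / n = 1 := by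
        rw [h0]; simp [hn0.ne']
      have p1 : 0 ≤ (j : ℝ) * (x ^ 40 / n) := by positivity
      have p2 : 0 ≤ 2 * (j : ℝ) ^ 2 * Real.exp (-x) := by positivity
      rw [e]
      linarith
    · obtain ⟨k, hk⟩ := Nat.exists_eq_succ_of_ne_zero h0.ne'
      have hnk : n = (k + 1) * L + n % L := by
        rw [← Nat.succ_eq_add_one, ← hk, mul_comm]; exact (Nat.div_add_mod n L).symm
      have hkj : k ≤ j := by
        have : (k + 1) * L ≤ (1 + j) * L := by linarith [hj2, Nat.zero_le (n % L)]
        have := Nat.le_of_mul_le_mul_right this hL0'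
        omega
      have hkN : (k + 1) * L ≤ N := by omega
      have hs := S.speed_le hP1 hP2 hP3 hC21 hcov hp.le hρ' hle hH' hD0 hbad hnk hkN
      have e : (n : ℝ) - L * (((n / L : ℕ) : ℤ) : ℝ) = (n % L : ℕ) := by
        have := Nat.div_add_mod n L
        have h : (L : ℝ) * (n / L : ℕ) + (n % L : ℕ) = n := by exact_mod_cast this
        rw [Int.cast_natCast]
        linarith
      have hkj' : (k : ℝ) ≤ j := by exact_mod_cast hkj
      have p1 : (k : ℝ) * (2 * t / n) ≤ j * (x ^ 40 / n) := by gcongr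
      have p2 : (k : ℝ) * D ≤ (j : ℝ) ^ 2 * Real.exp (-x) := by
        rw [← hjD]; gcongr
      rw [e]
      rcases h₁₂ with ⟨rfl, rfl⟩ | ⟨rfl, rfl⟩
      · linarith [hs.1]
      · linarith [hs.2]
  rw [c1, c2]
  simp only [Int.cast_add, Int.cast_natCast, Int.cast_one, add_sub_cancel_right]
  exact ⟨⟨coupling n L (Or.inl rfl) (Or.inr rfl), speeds n L (Or.inl ⟨rfl, rfl⟩)⟩,
    ⟨coupling L n (Or.inr rfl) (Or.inl rfl), speeds L n (Or.inr ⟨rfl, rfl⟩)⟩⟩
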